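/- Let $M$ be a smooth finite-dimensional Riemannian manifold without boundary, with Riemannian distance $\operatorname{dist}$. Let $0<\alpha\le 1$ and let $f:M\to M$ be a $C^{1+\alpha}$ diffeomorphism, i.e. a $C^1$ diffeomorphism whose derivative is locally $\alpha$-Hölder continuous in charts. Let $\Lambda\subset M$ be a compact set with $f(\Lambda)\subset\Lambda$ and with a dominated splitting: there are continuous $Df$-invariant subbundles with $T_\Lambda M=E^{cs}\oplus E^{cu}$, a constant $0<\lambda<1$ and a Riemannian metric on $M$ (possibly different from the given one) in which $$\|Df|E^{cs}_x\|\cdot\|Df^{-1}|E^{cu}_{f(x)}\|\le\lambda\qquad\text{for every }x\in\Lambda .$$ Let $\tilde E^{cs},\tilde E^{cu}$ be continuous extensions of these bundles to an open neighbourhood $U$ of $\Lambda$ with $T_UM=\tilde E^{cs}\oplus\tilde E^{cu}$, let $0<a<1$, and let $$C^{cu}_a(x)=\{v_1+v_2: v_1\in\tilde E^{cs}_x,\ v_2\in\tilde E^{cu}_x,\ \|v_1\|\le a\|v_2\|\},\qquad x\in U,$$ be the centre-unstable cone field of width $a$. An embedded disk of dimension $d$ is the image of the closed unit ball of $\mathbb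 R^d$ under a map that is $C^1$ on a neighbourhood of the ball, injective on the ball, and an immersion at each of its points. Suppose that $\Delta\subset U$ is an embedded disk of dimension $d=\dim\tilde E^{cu}_x\ge 1$ $(x\in\Delta)$ that is tangent to the centre-unstable cone field, i.e. $T_x\Delta\subset C^{cu}_a(x)$ for every $x\in\Delta$. Suppose that $\operatorname{Leb}_\Delta(\Delta\cap\Lambda)>0$, where $\operatorname{Leb}_\Delta$ is the Riemannian volume of $\Delta$ with the metric induced from $M$, and that $$\liminf_{n\to+\infty}\frac1n\sum_{j=1}^{n}\log\|Df^{-1}|E^{cu}_{f^j(x)}\|<0\qquad\text{for every }x\in\Delta\cap\Lambda\qquad\text{(NUE)}.$$ Then $\Lambda$ contains a local unstable disk: there are an embedded disk $\gamma\subset\Lambda$ of dimension $d$ and constants $C>0$, $0<\tau<1$ such that $\operatorname{dist}(f^{-n}(x),f^{-n}(y))\le C\tau^n$ for all $x,y\in\gamma$ and all $n\ge 0$. -/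

import Mathlib

open Set Filter Topology Manifold Bundle MeasureTheory
open scoped ContDiff NNReal ENNReal

namespace DominatedSplitting

noncomputable section

attribute [local instance 2000] chartedSpaceSelf

variable {E : Type*} [NormedAddCommGroup E] [NormedSpace ℝ E]
  {M : Type*}

/-- The closed unit ball of `ℝ^d`. -/
abbrev unitBall (d : ℕ) : Set (EuclideanSpace ℝ (Fin d)) := Metric.closedBall 0 1

section Smooth

variable [TopologicalSpace M] [ChartedSpace E M]

/-- A `C^1` diffeomorphism is of class `C^{1+α}` if its derivative, read in charts, is locally
`α`-Hölder continuous. -/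
def IsC1Holder (α : ℝ≥0) (f : M ≃ₘ^1⟮𝓘(ℝ, E), 𝓘(ℝ, E)⟯ M) : Prop :=
  ∀ x₀ : M, ∃ V ∈ 𝓝 (extChartAt 𝓘(ℝ, E) x₀ x₀), ∃ C : ℝ≥0,
    HolderOnWith C α (fderiv ℝ (writtenInExtChartAt 𝓘(ℝ, E) 𝓘(ℝ, E) x₀ f)) V

/-- A family of subspaces of the tangent spaces of `M` is a continuous subbundle of `TM` over
`S ⊆ M`: near each point of `S` it is spanned by a continuous linearly independent frame. -/
def IsContinuousSubbundleOn [IsManifold 𝓘(ℝ, E) 1 M]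
    (F : ∀ x : M, Submodule ℝ (TangentSpace 𝓘(ℝ, E) x)) (S : Set M) : Prop :=
  ∀ x₀ ∈ S, ∃ V ∈ 𝓝[S] x₀, ∃ k : ℕ, ∃ s : Fin k → ∀ x : M, TangentSpace 𝓘(ℝ, E) x,
    (∀ i, ContinuousOn (fun x => (⟨x, s i x⟩ : TangentBundle 𝓘(ℝ, E) M)) V) ∧
    ∀ x ∈ V, LinearIndependent ℝ (fun i => s i x) ∧
      Submodule.span ℝ (range fun i => s i x) = F x

/-- Two families of subspaces form a continuous splitting `TM = F ⊕ G` over `S ⊆ M`. -/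
structure IsContinuousSplittingOn [IsManifold 𝓘(ℝ, E) 1 M]
    (F G : ∀ x : M, Submodule ℝ (TangentSpace 𝓘(ℝ, E) x)) (S : Set M) : Prop where
  left : IsContinuousSubbundleOn F S
  right : IsContinuousSubbundleOn G S
  isCompl : ∀ x ∈ S, IsCompl (F x) (G x)

/-- The length of a tangent vector for a Riemannian metric `g`. -/
def metricNorm [IsManifold 𝓘(ℝ, E) 1 M]
    (g : ContMDiffRiemannianMetric 𝓘(ℝ, E) ∞ E (fun x : M => TangentSpace 𝓘(ℝ, E) x))
    {x : M} (v : TangentSpace 𝓘(ℝ, E) x) : ℝ :=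
  √(g.inner x v v)

/-- `T_Λ M = E^cs ⊕ E^cu` is a dominated splitting over `Λ`: it is continuous, `Df`-invariant, and
for some Riemannian metric on `M` and some `0 < lam < 1` one has
`‖Df | E^cs_x‖ * ‖Df⁻¹ | E^cu_{f x}‖ ≤ lam` for every `x ∈ Λ`. The last inequality is
spelled out on vectors. -/
structure IsDominatedSplitting [IsManifold 𝓘(ℝ, E) 1 M]
    (f : M ≃ₘ^1⟮𝓘(ℝ, E), 𝓘(ℝ, E)⟯ M) (Λ : Set M)
    (Ecs Ecu : ∀ x : M, Submodule ℝ (TangentSpace 𝓘(ℝ, E) x)) : Prop where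
  splitting : IsContinuousSplittingOn Ecs Ecu Λ
  map_cs : ∀ x ∈ Λ, (Ecs x).map (mfderiv 𝓘(ℝ, E) 𝓘(ℝ, E) f x).toLinearMap = Ecs (f x)
  map_cu : ∀ x ∈ Λ, (Ecu x).map (mfderiv 𝓘(ℝ, E) 𝓘(ℝ, E) f x).toLinearMap = Ecu (f x)
  dominated :
    ∃ g : ContMDiffRiemannianMetric 𝓘(ℝ, E) ∞ E (fun x : M => TangentSpace 𝓘(ℝ, E) x),
    ∃ lam : ℝ, 0 < lam ∧ lam < 1 ∧ ∀ x ∈ Λ, ∀ u ∈ Ecs x, ∀ w ∈ Ecu (f x),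
      metricNorm g (mfderiv 𝓘(ℝ, E) 𝓘(ℝ, E) f x u) *
        metricNorm g (mfderiv 𝓘(ℝ, E) 𝓘(ℝ, E) f.symm (f x) w) ≤
      lam * (metricNorm g u * metricNorm g w)

/-- `φ` parametrizes an embedded `C^1` disk of dimension `d`, namely the image `φ '' unitBall d`:
it is injective on the closed unit ball, and `C^1` (on a neighbourhood) and immersive at each of
its points. -/
structure IsEmbeddedDisk (d : ℕ) (φ : EuclideanSpace ℝ (Fin d) → M) : Prop where
  contMDiffAt : ∀ p ∈ unitBall d,
    ContMDiffAt 𝓘(ℝ, EuclideanSpace ℝ (Fin d)) 𝓘(ℝ, E) 1 φ p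
  injOn : InjOn φ (unitBall d)
  immersive : ∀ p ∈ unitBall d,
    Function.Injective (mfderiv 𝓘(ℝ, EuclideanSpace ℝ (Fin d)) 𝓘(ℝ, E) φ p)

end Smooth

section Riemannian

variable [TopologicalSpace M] [ChartedSpace E M]
  [RiemannianBundle (fun x : M => TangentSpace 𝓘(ℝ, E) x)]

/-- The centre-unstable cone of width `a` at `x`: the vectors `v₁ + v₂` with
`v₁ ∈ F x`, `v₂ ∈ G x` and `‖v₁‖ ≤ a ‖v₂‖`, for a splitting `F ⊕ G`. -/
def cuCone (F G : ∀ x : M, Submodule ℝ (TangentSpace 𝓘(ℝ, E) x)) (a : ℝ) (x : M) :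
    Set (TangentSpace 𝓘(ℝ, E) x) :=
  {v | ∃ v₁ ∈ F x, ∃ v₂ ∈ G x, v = v₁ + v₂ ∧ ‖v₁‖ ≤ a * ‖v₂‖}

/-- The embedded disk `φ '' unitBall d` is tangent to the centre-unstable cone field of width `a`:
its tangent space at each point has the dimension of the centre-unstable bundle `G`
and is contained in the cone. -/
def IsTangentToCuCone (F G : ∀ x : M, Submodule ℝ (TangentSpace 𝓘(ℝ, E) x)) (a : ℝ)
    (d : ℕ) (φ : EuclideanSpace ℝ (Fin d) → M) : Prop :=
  ∀ p ∈ unitBall d, Module.finrank ℝ (G (φ p)) = d ∧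
    range (mfderiv 𝓘(ℝ, EuclideanSpace ℝ (Fin d)) 𝓘(ℝ, E) φ p) ⊆ cuCone F G a (φ p)

/-- The Gram matrix, at the parameter `p`, of the Riemannian metric induced on a parametrized
disk. -/
def inducedMetric (d : ℕ) (φ : EuclideanSpace ℝ (Fin d) → M) (p : EuclideanSpace ℝ (Fin d)) :
    Matrix (Fin d) (Fin d) ℝ :=
  Matrix.gram ℝ fun i => mfderiv 𝓘(ℝ, EuclideanSpace ℝ (Fin d)) 𝓘(ℝ, E) φ p
    (EuclideanSpace.single i (1 : ℝ) : EuclideanSpace ℝ (Fin d))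

/-- The measure of `Δ ∩ A` for the Riemannian volume of the disk `Δ = φ '' unitBall d`
(with the metric induced from `M`), for Borel sets `A`: the integral over the parameters of
the Riemannian density `√det`. -/
def lebDisk (d : ℕ) (φ : EuclideanSpace ℝ (Fin d) → M) (A : Set M) : ℝ≥0∞ :=
  ∫⁻ p in unitBall d ∩ φ ⁻¹' A, ENNReal.ofReal √(inducedMetric (E := E) d φ p).det

/-- The norm of `Df⁻¹ | E^cu_y`. -/
def normInvCu (f : M ≃ₘ^1⟮𝓘(ℝ, E), 𝓘(ℝ, E)⟯ M)
    (Ecu : ∀ x : M, Submodule ℝ (TangentSpace 𝓘(ℝ, E) x)) (y : M) : ℝ :=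
  ‖(mfderiv 𝓘(ℝ, E) 𝓘(ℝ, E) f.symm y).comp (Ecu y).subtypeL‖

/-- Non-uniform expansion along the centre-unstable direction at `x`:
`liminf (1/n) ∑_{j=1}^n log ‖Df⁻¹ | E^cu_{f^j x}‖ < 0`. -/
def NUE (f : M ≃ₘ^1⟮𝓘(ℝ, E), 𝓘(ℝ, E)⟯ M)
    (Ecu : ∀ x : M, Submodule ℝ (TangentSpace 𝓘(ℝ, E) x)) (x : M) : Prop :=
  liminf (fun n : ℕ => (((1 / (n : ℝ)) *
    ∑ j ∈ Finset.Icc 1 n, Real.log (normInvCu f Ecu (f^[j] x)) : ℝ) : EReal)) atTop < 0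

end Riemannian

/-- `φ` parametrizes an unstable disk of dimension `d`: it is an embedded `C^1` disk on which the
distances of the backward iterates go to zero exponentially fast. -/
structure IsUnstableDisk [EMetricSpace M] [ChartedSpace E M]
    (f : M ≃ₘ^1⟮𝓘(ℝ, E), 𝓘(ℝ, E)⟯ M) (d : ℕ)
    (φ : EuclideanSpace ℝ (Fin d) → M) : Prop where
  isEmbeddedDisk : IsEmbeddedDisk (E := E) d φ
  contracted : ∃ C τ : ℝ, 0 < C ∧ 0 < τ ∧ τ < 1 ∧
    ∀ x ∈ φ '' unitBall d, ∀ y ∈ φ '' unitBall d, ∀ n : ℕ,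
      edist (f.symm^[n] x) (f.symm^[n] y) ≤ ENNReal.ofReal (C * τ ^ n)

end

end DominatedSplitting

/-!
The iterates of the disk are studied in finitely many charts around `Λ`, with coordinates adapted to
the splitting at the points of `Λ` (`CuAtlas`). In these coordinates `f` is block diagonal up to an
error of order `1 + α`, so that the graph transform applies: the slope of a disk transverse to
`E^cs`, such as a disk tangent to the centre-unstable cone field, decreases geometrically under
iteration (`DominatedStep.slope_le`). Domination may hold for another metric than the one in which
`E^cu` is expanded. It only enters through a pair of seminorms uniformly comparable with the ambient
norms, and needs no adapted metric.

Non-uniform expansion provides, for each point of `Δ ∩ Λ`, infinitely many hyperbolic times: times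
`n` such that, from each time `j` between a fixed `N` and `n`, the derivative of `f^(n-j)` along
`E^cu` expands at a definite exponential rate (`exists_hyperbolic_time`). At such a time a small
neighbourhood of the point in `Δ` is mapped onto a graph of a fixed size `δ`, which is contracted
exponentially by the backward iterates, with a distortion of volume bounded independently of `n`
(`PreDisk`, `CuAtlas.exists_preDisk`). These neighbourhoods form a Vitali family for the part of `Δ ∩ Λ` on which
the rate and the starting time are fixed, and this part has positive measure for a suitable choice.
Hence there are late hyperbolic times at which `Λ` fills such a neighbourhood up to an arbitrarily
small proportion (`CuAtlas.exists_preDisk_measure_diff_lt`). By bounded distortion and `f(Λ) ⊆ Λ`,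
points of `Λ` are arbitrarily dense in the image disks (`TransverseDisk.exists_dense_preDisk`), and a
limit of the image disks is a Lipschitz disk contained in the compact set `Λ`.

It remains to see that the limit is of class `C^1`. The iterated disks are only known to be `C^1`, so
their tangent spaces need not converge. Instead the secants through points of `Λ` are used. Two
nearby backward orbits in the centre-unstable cone, one of them in `Λ`, separate in the direction of
`E^cu` up to an error `lam ^ n + dist ^ α`, by domination and the Hölder condition alone
(`CuAtlas.exists_secant_le`). As the points of `Λ` become dense, this passes to the limit disk at all
of its points, with the error `dist ^ α`. So the limit disk is differentiable with tangent spaces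
`E^cu`, which are continuous on `Λ` (`contDiffOn_one_of_secant`, `CuAtlas.exists_limit_disk`).
-/

namespace DominatedSplitting

/-! ### The graph transform for one step, and volume of nearly linear maps -/

section

section ConeAlgebra

variable {X Y : Type*} [NormedAddCommGroup X] [NormedSpace ℝ X]
  [NormedAddCommGroup Y] [NormedSpace ℝ Y]

theorem norm_symm_mul_le (A : X ≃L[ℝ] X) (u : X) :
    ‖u‖ ≤ ‖(A.symm : X →L[ℝ] X)‖ * ‖A u‖ := by
  simpa using (A.symm : X →L[ℝ] X).le_opNorm (A u)

theorem inv_norm_symm_sub_mul_le (A : X ≃L[ℝ] X) {κ : ℝ} {u u' : X}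
    (h : ‖u' - A u‖ ≤ κ * ‖u‖) :
    (‖(A.symm : X →L[ℝ] X)‖⁻¹ - κ) * ‖u‖ ≤ ‖u'‖ := by
  have h1 := norm_symm_mul_le A u
  have h2 : ‖A u‖ ≤ ‖u'‖ + ‖u' - A u‖ := by
    have := norm_sub_norm_le (A u) u'
    rw [norm_sub_rev] at this
    linarith
  have h3 : ‖(A.symm : X →L[ℝ] X)‖⁻¹ * ‖u‖ ≤ ‖A u‖ := by
    rcases (norm_nonneg (A.symm : X →L[ℝ] X)).eq_or_lt with h0 | h0
    · rw [← h0]; simp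
    · rw [inv_mul_le_iff₀ h0]; exact h1
  rw [sub_mul]; linarith

/-- The comparison of the norms in which domination is expressed with the ambient norms, and the
domination inequality itself, for one step `(A, D)` of a block diagonal cocycle. -/
structure DominatedStep (A : X ≃L[ℝ] X) (D : Y →L[ℝ] Y) (nX nX' : Seminorm ℝ X)
    (nY nY' : Seminorm ℝ Y) (C lam : ℝ) : Prop where
  one_le : 1 ≤ C
  lam_nonneg : 0 ≤ lam
  lam_le_one : lam ≤ 1
  norm_symm_le : ‖(A.symm : X →L[ℝ] X)‖ ≤ C
  nX_le : ∀ u, nX u ≤ C * ‖u‖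
  le_nX : ∀ u, ‖u‖ ≤ C * nX u
  nX'_le : ∀ u, nX' u ≤ C * ‖u‖
  le_nX' : ∀ u, ‖u‖ ≤ C * nX' u
  nY_le : ∀ z, nY z ≤ C * ‖z‖
  nY'_le : ∀ z, nY' z ≤ C * ‖z‖
  dominated : ∀ u z, nY' (D z) * nX (A.symm u) ≤ lam * (nY z * nX' u)

/-- The inverse of one nonlinear step is Lipschitz with twice the constant of the linear step. -/
theorem DominatedStep.norm_le {A : X ≃L[ℝ] X} {D : Y →L[ℝ] Y} {nX nX' : Seminorm ℝ X}
    {nY nY' : Seminorm ℝ Y} {C lam : ℝ} (h : DominatedStep A D nX nX' nY nY' C lam)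
    {κ : ℝ} (hκ : C * κ ≤ 1 / 2) {u u' : X} (hu : ‖u' - A u‖ ≤ κ * ‖u‖) :
    ‖u‖ ≤ 2 * C * ‖u'‖ := by
  have h1 := norm_symm_mul_le A u
  have h2 : ‖A u‖ ≤ ‖u'‖ + ‖u' - A u‖ := by
    have := norm_sub_norm_le (A u) u'
    rw [norm_sub_rev] at this
    linarith
  have h3 : ‖u‖ ≤ C * ‖A u‖ :=
    h1.trans (mul_le_mul_of_nonneg_right h.norm_symm_le (norm_nonneg _))
  have hC := h.one_le
  have h4 : C * ‖A u‖ ≤ C * (‖u'‖ + κ * ‖u‖) := by gcongr; linarith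
  have h5 : C * κ * ‖u‖ ≤ 1 / 2 * ‖u‖ := by gcongr
  nlinarith

/-- One step of the graph transform acting on a pair of points: the slope with respect to the
dominated splitting is contracted by `lam`, up to the nonlinearity `κ`. -/
theorem DominatedStep.slope_le {A : X ≃L[ℝ] X} {D : Y →L[ℝ] Y} {nX nX' : Seminorm ℝ X}
    {nY nY' : Seminorm ℝ Y} {C lam : ℝ} (h : DominatedStep A D nX nX' nY nY' C lam)
    {κ s : ℝ} (hκ0 : 0 ≤ κ) (hκ : C * κ ≤ 1 / 2) (hs : 0 ≤ s) {u u' : X} {z z' : Y}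
    (hu : ‖u' - A u‖ ≤ κ * ‖u‖) (hz : ‖z' - D z‖ ≤ κ * ‖u‖) (hzu : ‖z‖ ≤ ‖u‖)
    (hslope : nY z ≤ s * nX u) :
    nY' z' ≤ (lam * s + 4 * C ^ 5 * κ) * nX' u' := by
  have hC := h.one_le
  have hC0 : 0 ≤ C := by linarith
  have hlam := h.lam_nonneg
  have hn' : 0 ≤ nX' u' := apply_nonneg _ _
  have hu1 : ‖u‖ ≤ 2 * C ^ 2 * nX' u' := by
    have := h.norm_le hκ hu
    have h2 := h.le_nX' u'
    calc ‖u‖ ≤ 2 * C * ‖u'‖ := this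
      _ ≤ 2 * C * (C * nX' u') := by gcongr
      _ = _ := by ring
  have hz1 : nY' z' ≤ nY' (D z) + C * (κ * ‖u‖) := by
    have h1 : nY' z' ≤ nY' (D z) + nY' (z' - D z) := by
      have := map_add_le_add nY' (D z) (z' - D z)
      simpa using this
    have h2 : nY' (z' - D z) ≤ C * (κ * ‖u‖) :=
      (h.nY'_le _).trans (by gcongr)
    linarith
  have hA : nX' (A u) ≤ nX' u' + C * (κ * ‖u‖) := by
    have h1 : nX' (A u) ≤ nX' u' + nX' (A u - u') := by
      have := map_add_le_add nX' u' (A u - u')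
      simpa using this
    have h2 : nX' (A u - u') ≤ C * (κ * ‖u‖) := by
      refine (h.nX'_le _).trans ?_
      rw [norm_sub_rev]; gcongr
    linarith
  have hD : nY' (D z) ≤ lam * s * nX' u' + C ^ 2 * (C * (κ * ‖u‖)) := by
    -- The domination inequality at the vector `A u`, whose preimage is `u`, is divided by `nX u`.
    rcases eq_or_ne u 0 with rfl | hu0
    · have : z = 0 := by simpa using hzu
      subst this
      simp only [map_zero, norm_zero, mul_zero, add_zero]
      positivity
    · have hpos : 0 < nX u := by
        have := h.le_nX u
        have h0 : 0 < ‖u‖ := norm_pos_iff.2 hu0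
        by_contra hneg
        have : C * nX u ≤ 0 := mul_nonpos_of_nonneg_of_nonpos hC0 (not_lt.1 hneg)
        linarith
      have hdom := h.dominated (A u) z
      rw [ContinuousLinearEquiv.symm_apply_apply] at hdom
      have hY2 : nY z ≤ C ^ 2 * nX u := by
        calc nY z ≤ C * ‖z‖ := h.nY_le z
          _ ≤ C * ‖u‖ := by gcongr
          _ ≤ C * (C * nX u) := by gcongr; exact h.le_nX u
          _ = _ := by ring
      have hY0 : 0 ≤ nY z := apply_nonneg _ _
      have hκu : 0 ≤ C * (κ * ‖u‖) := by positivity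
      have : nY' (D z) * nX u ≤ (lam * s * nX' u' + C ^ 2 * (C * (κ * ‖u‖))) * nX u := by
        calc nY' (D z) * nX u ≤ lam * (nY z * nX' (A u)) := hdom
          _ ≤ lam * (nY z * (nX' u' + C * (κ * ‖u‖))) := by gcongr
          _ = lam * (nY z * nX' u') + lam * (nY z * (C * (κ * ‖u‖))) := by ring
          _ ≤ lam * ((s * nX u) * nX' u') + 1 * ((C ^ 2 * nX u) * (C * (κ * ‖u‖))) := by
            gcongr
            exact h.lam_le_one
          _ = _ := by ring
      exact le_of_mul_le_mul_right this hpos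
  have hfin : C ^ 2 * (C * (κ * ‖u‖)) + C * (κ * ‖u‖) ≤ 4 * C ^ 5 * κ * nX' u' := by
    have h1 : C * (κ * ‖u‖) ≤ C ^ 3 * (κ * ‖u‖) := by
      gcongr
      exact le_self_pow₀ hC (by norm_num)
    calc C ^ 2 * (C * (κ * ‖u‖)) + C * (κ * ‖u‖)
        ≤ C ^ 3 * (κ * ‖u‖) + C ^ 3 * (κ * ‖u‖) := by
          have : C ^ 2 * (C * (κ * ‖u‖)) = C ^ 3 * (κ * ‖u‖) := by ring
          linarith
      _ = 2 * C ^ 3 * κ * ‖u‖ := by ring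
      _ ≤ 2 * C ^ 3 * κ * (2 * C ^ 2 * nX' u') := by gcongr
      _ = _ := by ring
  calc nY' z' ≤ nY' (D z) + C * (κ * ‖u‖) := hz1
    _ ≤ _ := by rw [add_mul]; linarith

end ConeAlgebra

section Volume

variable {X : Type*} [NormedAddCommGroup X] [NormedSpace ℝ X] [FiniteDimensional ℝ X]
  [MeasurableSpace X] [BorelSpace X]

/-- If `T` is `K`-Lipschitz as a function of `G`, it multiplies volumes by at most `K ^ dim`. -/
theorem addHaar_image_le_of_dist_le (μ : Measure X) [μ.IsAddHaarMeasure] {P : Type*} (S : Set P)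
    (G T : P → X) (K : ℝ) (hK : 0 ≤ K)
    (h : ∀ p ∈ S, ∀ q ∈ S, ‖T p - T q‖ ≤ K * ‖G p - G q‖) :
    μ (T '' S) ≤ ENNReal.ofReal (K ^ Module.finrank ℝ X) * μ (G '' S) := by
  classical
  set n := Module.finrank ℝ X
  -- Haar measures are multiples of the Hausdorff measure, for which Lipschitz maps behave well.
  have hμ : ∃ c : ℝ≥0, μ = c • (Measure.hausdorffMeasure (n : ℝ) : Measure X) := by
    have : (Measure.hausdorffMeasure (n : ℝ) : Measure X).IsAddHaarMeasure :=
      isAddHaarMeasure_hausdorffMeasure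
    exact ⟨_, Measure.isAddLeftInvariant_eq_smul _ _⟩
  obtain ⟨c, hc⟩ := hμ
  rcases S.eq_empty_or_nonempty with rfl | ⟨p₀, hp₀⟩
  · simp
  have : Nonempty P := ⟨p₀⟩
  have hg : ∀ v ∈ G '' S, Function.invFunOn G S v ∈ S ∧ G (Function.invFunOn G S v) = v :=
    fun v hv => ⟨Function.invFunOn_mem hv, Function.invFunOn_eq hv⟩
  have hTS : T '' S = (fun v => T (Function.invFunOn G S v)) '' (G '' S) := by
    ext y; constructor
    · rintro ⟨p, hp, rfl⟩
      refine ⟨G p, ⟨p, hp, rfl⟩, ?_⟩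
      have h1 := hg (G p) ⟨p, hp, rfl⟩
      have := h _ h1.1 p hp
      rw [h1.2, sub_self, norm_zero, mul_zero] at this
      exact sub_eq_zero.1 (norm_le_zero_iff.1 this)
    · rintro ⟨v, hv, rfl⟩
      exact ⟨_, (hg v hv).1, rfl⟩
  have hL : LipschitzOnWith K.toNNReal (fun v => T (Function.invFunOn G S v)) (G '' S) := by
    refine LipschitzOnWith.of_dist_le_mul fun v hv v' hv' => ?_
    rw [dist_eq_norm, dist_eq_norm, Real.coe_toNNReal _ hK]
    have := h _ (hg v hv).1 _ (hg v' hv').1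
    rwa [(hg v hv).2, (hg v' hv').2] at this
  have := hL.hausdorffMeasure_image_le (d := n) (by positivity)
  rw [hTS, hc]
  simp only [Measure.smul_apply, ENNReal.smul_def, smul_eq_mul]
  calc _ ≤ (c : ℝ≥0∞) * ((K.toNNReal : ℝ≥0∞) ^ (n : ℝ) *
        Measure.hausdorffMeasure (n : ℝ) (G '' S)) := by gcongr
    _ = _ := by
      rw [ENNReal.rpow_natCast, ENNReal.ofReal_pow hK]
      simp only [ENNReal.ofReal]
      ring

/-- A map that is, as a function of `G`, close to the linear isomorphism `A` multiplies volumes by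
almost `|det A|`. -/
theorem addHaar_image_near_linear (μ : Measure X) [μ.IsAddHaarMeasure] {P : Type*} (S : Set P)
    (A : X ≃L[ℝ] X) (G T : P → X) {C κ : ℝ} (hC : ‖(A.symm : X →L[ℝ] X)‖ ≤ C) (hκ0 : 0 ≤ κ)
    (hκ : C * κ ≤ 1 / 2)
    (h : ∀ p ∈ S, ∀ q ∈ S, ‖T p - T q - A (G p - G q)‖ ≤ κ * ‖G p - G q‖) :
    μ (T '' S) ≤ ENNReal.ofReal (Real.exp (2 * Module.finrank ℝ X * C * κ)) *
        (ENNReal.ofReal |LinearMap.det (A : X →ₗ[ℝ] X)| * μ (G '' S)) ∧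
    ENNReal.ofReal |LinearMap.det (A : X →ₗ[ℝ] X)| * μ (G '' S) ≤
      ENNReal.ofReal (Real.exp (2 * Module.finrank ℝ X * C * κ)) * μ (T '' S) := by
  set n := Module.finrank ℝ X
  have hC0 : 0 ≤ C := (norm_nonneg _).trans hC
  have hCκ : 0 ≤ C * κ := mul_nonneg hC0 hκ0
  set T' : P → X := fun p => A.symm (T p)
  have hTS : T '' S = A '' (T' '' S) := by
    rw [image_image]; simp [T']
  have hdet : μ (T '' S) = ENNReal.ofReal |LinearMap.det (A : X →ₗ[ℝ] X)| * μ (T' '' S) := by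
    rw [hTS]
    exact Measure.addHaar_image_linearMap μ (A : X →ₗ[ℝ] X) (T' '' S)
  have hT' : ∀ p ∈ S, ∀ q ∈ S, ‖(T' p - T' q) - (G p - G q)‖ ≤ C * κ * ‖G p - G q‖ := by
    intro p hp q hq
    have : (T' p - T' q) - (G p - G q) = (A.symm : X →L[ℝ] X) (T p - T q - A (G p - G q)) := by
      simp [T']
    rw [this]
    calc _ ≤ ‖(A.symm : X →L[ℝ] X)‖ * ‖T p - T q - A (G p - G q)‖ :=
          ContinuousLinearMap.le_opNorm _ _
      _ ≤ C * (κ * ‖G p - G q‖) := by gcongr; exact h p hp q hq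
      _ = _ := by ring
  have h1 : ∀ p ∈ S, ∀ q ∈ S, ‖T' p - T' q‖ ≤ (1 + C * κ) * ‖G p - G q‖ := by
    intro p hp q hq
    have := hT' p hp q hq
    have h2 := norm_sub_norm_le (T' p - T' q) (G p - G q)
    linarith
  have h2 : ∀ p ∈ S, ∀ q ∈ S, ‖G p - G q‖ ≤ (1 + 2 * (C * κ)) * ‖T' p - T' q‖ := by
    intro p hp q hq
    have h3 := hT' p hp q hq
    have h4 := norm_sub_norm_le (G p - G q) (T' p - T' q)
    rw [norm_sub_rev (G p - G q)] at h4
    have h5 : (1 - C * κ) * ‖G p - G q‖ ≤ ‖T' p - T' q‖ := by linarith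
    have h6 : 1 ≤ (1 + 2 * (C * κ)) * (1 - C * κ) := by nlinarith
    calc ‖G p - G q‖ ≤ (1 + 2 * (C * κ)) * (1 - C * κ) * ‖G p - G q‖ :=
          le_mul_of_one_le_left (norm_nonneg _) h6
      _ ≤ _ := by rw [mul_assoc]; gcongr
  have hexp : ∀ t : ℝ, 0 ≤ t → t ≤ 2 * (C * κ) →
      (1 + t) ^ n ≤ Real.exp (2 * n * C * κ) := by
    intro t ht0 ht
    calc (1 + t) ^ n ≤ (Real.exp t) ^ n := by
          gcongr
          linarith [Real.add_one_le_exp t]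
      _ = Real.exp (n * t) := by rw [← Real.exp_nat_mul]
      _ ≤ _ := by
        apply Real.exp_le_exp.2
        calc (n : ℝ) * t ≤ n * (2 * (C * κ)) := by gcongr
          _ = _ := by ring
  constructor
  · rw [hdet]
    calc _ ≤ ENNReal.ofReal |LinearMap.det (A : X →ₗ[ℝ] X)| *
          (ENNReal.ofReal ((1 + C * κ) ^ n) * μ (G '' S)) := by
            gcongr
            exact addHaar_image_le_of_dist_le μ S G T' _ (by positivity) h1
      _ ≤ ENNReal.ofReal |LinearMap.det (A : X →ₗ[ℝ] X)| *
          (ENNReal.ofReal (Real.exp (2 * n * C * κ)) * μ (G '' S)) := by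
            gcongr
            exact hexp _ hCκ (by linarith)
      _ = _ := by ring
  · rw [hdet]
    calc _ ≤ ENNReal.ofReal |LinearMap.det (A : X →ₗ[ℝ] X)| *
          (ENNReal.ofReal ((1 + 2 * (C * κ)) ^ n) * μ (T' '' S)) := by
            gcongr
            exact addHaar_image_le_of_dist_le μ S T' G _ (by positivity) h2
      _ ≤ ENNReal.ofReal |LinearMap.det (A : X →ₗ[ℝ] X)| *
          (ENNReal.ofReal (Real.exp (2 * n * C * κ)) * μ (T' '' S)) := by
            gcongr
            exact hexp _ (by positivity) le_rfl
      _ = _ := by ring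

end Volume

end

/-! ### Orbits of graphs under nonlinear perturbations of a dominated cocycle -/

section

set_option linter.unusedSectionVars false

section GraphOrbit

variable {P X Y : Type*} [NormedAddCommGroup X] [NormedSpace ℝ X]
  [NormedAddCommGroup Y] [NormedSpace ℝ Y]

/-- The parameters in `V₀` whose centre-unstable coordinates stay within `ρ i` up to time `n`. -/
def trackSet (w : ℕ → P → X × Y) (V₀ : Set P) (ρ : ℕ → ℝ) (n : ℕ) : Set P :=
  {p ∈ V₀ | ∀ i ≤ n, ‖(w i p).1‖ ≤ ρ i}

/-- Local coordinates `w 0, …, w n` of `n` successive iterates of a disk, parametrized by `V₀`,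
which are related by the block diagonal maps `A i × D i` up to an error `κ i`. At time `0` the disk
is a graph of slope `s` over the ball of radius `ρ 0`, and the radii `ρ i` are chosen such that the
graph over the ball of radius `ρ i` expands over the ball of radius `ρ (i + 1)`. -/
structure GraphOrbit (w : ℕ → P → X × Y) (A : ℕ → X ≃L[ℝ] X) (D : ℕ → Y →L[ℝ] Y)
    (nX : ℕ → Seminorm ℝ X) (nY : ℕ → Seminorm ℝ Y) (C lam s κ₀ : ℝ) (κ ρ : ℕ → ℝ)
    (V₀ : Set P) (p₀ : P) (n : ℕ) : Prop where
  step : ∀ i < n, DominatedStep (A i) (D i) (nX i) (nX (i + 1)) (nY i) (nY (i + 1)) C lam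
  one_le : 1 ≤ C
  le_nY : ∀ i ≤ n, ∀ z, ‖z‖ ≤ C * nY i z
  nX_le : ∀ i ≤ n, ∀ u, nX i u ≤ C * ‖u‖
  s_nonneg : 0 ≤ s
  s_le : C ^ 2 * s ≤ 1
  κ_nonneg : ∀ i < n, 0 ≤ κ i
  κ_le : ∀ i < n, κ i ≤ κ₀
  κ₀_le : C * κ₀ ≤ 1 / 2
  κ₀_le' : 4 * C ^ 5 * κ₀ ≤ (1 - lam) * s
  ρ_nonneg : ∀ i ≤ n, 0 ≤ ρ i
  ρ_succ : ∀ i < n, ρ (i + 1) = (‖((A i).symm : X →L[ℝ] X)‖⁻¹ - κ₀) * ρ i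
  mem : p₀ ∈ V₀
  base : ∀ i ≤ n, w i p₀ = 0
  approx : ∀ i < n, ∀ p ∈ V₀, ∀ q ∈ V₀, (∀ j ≤ i, ‖w j p‖ ≤ ρ j) → (∀ j ≤ i, ‖w j q‖ ≤ ρ j) →
    ‖w (i + 1) p - w (i + 1) q - (A i ((w i p).1 - (w i q).1), D i ((w i p).2 - (w i q).2))‖ ≤
      κ i * ‖w i p - w i q‖
  slope₀ : ∀ p ∈ V₀, ∀ q ∈ V₀, nY 0 ((w 0 p).2 - (w 0 q).2) ≤ s * nX 0 ((w 0 p).1 - (w 0 q).1)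
  surj₀ : Metric.closedBall 0 (ρ 0) ⊆ (fun p => (w 0 p).1) '' V₀

theorem trackSet_zero (w : ℕ → P → X × Y) (V₀ : Set P) (ρ : ℕ → ℝ) :
    trackSet w V₀ ρ 0 = {p ∈ V₀ | ‖(w 0 p).1‖ ≤ ρ 0} := by
  ext p; simp [trackSet]

theorem trackSet_antitone (w : ℕ → P → X × Y) (V₀ : Set P) (ρ : ℕ → ℝ) :
    Antitone (trackSet w V₀ ρ) :=
  fun _ _ h _ hp => ⟨hp.1, fun i hi => hp.2 i (hi.trans h)⟩

theorem mem_trackSet_succ {w : ℕ → P → X × Y} {V₀ : Set P} {ρ : ℕ → ℝ} {n : ℕ} {p : P} :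
    p ∈ trackSet w V₀ ρ (n + 1) ↔ p ∈ trackSet w V₀ ρ n ∧ ‖(w (n + 1) p).1‖ ≤ ρ (n + 1) := by
  constructor
  · exact fun h => ⟨trackSet_antitone w V₀ ρ n.le_succ h, h.2 _ le_rfl⟩
  · rintro ⟨h, h'⟩
    refine ⟨h.1, fun i hi => ?_⟩
    rcases Nat.of_le_succ hi with hi | rfl
    · exact h.2 i hi
    · exact h'

namespace GraphOrbit

variable {w : ℕ → P → X × Y} {A : ℕ → X ≃L[ℝ] X} {D : ℕ → Y →L[ℝ] Y}
    {nX : ℕ → Seminorm ℝ X} {nY : ℕ → Seminorm ℝ Y} {C lam s κ₀ : ℝ} {κ ρ : ℕ → ℝ}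
    {V₀ : Set P} {p₀ : P} {n : ℕ}

theorem norm_snd_le_of_slope (h : GraphOrbit w A D nX nY C lam s κ₀ κ ρ V₀ p₀ n) {i : ℕ}
    (hi : i ≤ n) {u : X} {z : Y} (hz : nY i z ≤ s * nX i u) : ‖z‖ ≤ ‖u‖ := by
  have hC := h.one_le
  have hs := h.s_nonneg
  calc ‖z‖ ≤ C * nY i z := h.le_nY i hi z
    _ ≤ C * (s * nX i u) := by gcongr
    _ ≤ C * (s * (C * ‖u‖)) := by gcongr; exact h.nX_le i hi u
    _ = (C ^ 2 * s) * ‖u‖ := by ring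
    _ ≤ 1 * ‖u‖ := by gcongr; exact h.s_le
    _ = _ := one_mul _

theorem base_mem (h : GraphOrbit w A D nX nY C lam s κ₀ κ ρ V₀ p₀ n) {i : ℕ} (hi : i ≤ n) :
    p₀ ∈ trackSet w V₀ ρ i :=
  ⟨h.mem, fun j hj => by rw [h.base j (hj.trans hi)]; simpa using h.ρ_nonneg j (hj.trans hi)⟩

/-- The iterated graphs keep the slope `s`: the factor `lam` makes up for the nonlinearity, which is at
most `κ₀`. The point `p₀` serves to show that the centre-stable coordinates stay within `ρ i` too, so
that the estimate `approx` applies. -/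
theorem slope (h : GraphOrbit w A D nX nY C lam s κ₀ κ ρ V₀ p₀ n) :
    ∀ i ≤ n, ∀ p ∈ trackSet w V₀ ρ i, ∀ q ∈ trackSet w V₀ ρ i,
      nY i ((w i p).2 - (w i q).2) ≤ s * nX i ((w i p).1 - (w i q).1) := by
  intro i
  induction i using Nat.strong_induction_on with
  | _ i ih =>
    intro hi p hp q hq
    rcases i with _ | i
    · exact h.slope₀ p hp.1 q hq.1
    have hnorm : ∀ p ∈ trackSet w V₀ ρ (i + 1), ∀ j ≤ i, ‖w j p‖ ≤ ρ j := by
      intro p hp j hj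
      have hpj := trackSet_antitone w V₀ ρ (show j ≤ i + 1 by omega) hp
      have h1 := ih j (by omega) (by omega) p hpj p₀ (h.base_mem (by omega))
      rw [h.base j (by omega)] at h1
      simp only [Prod.fst_zero, Prod.snd_zero, sub_zero] at h1
      have h2 := h.norm_snd_le_of_slope (by omega) h1
      rw [Prod.norm_def, max_eq_left h2]
      exact hp.2 j (by omega)
    have hsl := ih i (by omega) (by omega) p (trackSet_antitone w V₀ ρ i.le_succ hp) q
      (trackSet_antitone w V₀ ρ i.le_succ hq)
    have hle := h.norm_snd_le_of_slope (by omega) hsl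
    have happ := h.approx i (by omega) p hp.1 q hq.1 (hnorm p hp) (hnorm q hq)
    have hn : ‖w i p - w i q‖ = ‖(w i p).1 - (w i q).1‖ := by
      rw [Prod.norm_def, Prod.fst_sub, Prod.snd_sub, max_eq_left hle]
    rw [hn] at happ
    have hC := h.one_le
    have hκ : C * κ i ≤ 1 / 2 := by
      have := h.κ_le i (by omega)
      have h3 := h.κ₀_le
      nlinarith
    have := (h.step i (by omega)).slope_le (h.κ_nonneg i (by omega)) hκ h.s_nonneg
      ((norm_fst_le _).trans happ) ((norm_snd_le _).trans happ) hle hsl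
    refine this.trans ?_
    refine mul_le_mul_of_nonneg_right ?_ (apply_nonneg _ _)
    have h4 : 4 * C ^ 5 * κ i ≤ 4 * C ^ 5 * κ₀ := by
      gcongr; exact h.κ_le i (by omega)
    have h5 := h.κ₀_le'
    linarith

theorem norm_snd_le (h : GraphOrbit w A D nX nY C lam s κ₀ κ ρ V₀ p₀ n) {i : ℕ} (hi : i ≤ n)
    {p q : P} (hp : p ∈ trackSet w V₀ ρ i) (hq : q ∈ trackSet w V₀ ρ i) :
    ‖(w i p).2 - (w i q).2‖ ≤ ‖(w i p).1 - (w i q).1‖ :=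
  h.norm_snd_le_of_slope hi (h.slope i hi p hp q hq)

/-- The slope of the iterated graphs, measured in the ambient norms. -/
theorem norm_snd_le_slope (h : GraphOrbit w A D nX nY C lam s κ₀ κ ρ V₀ p₀ n) {i : ℕ} (hi : i ≤ n)
    {p q : P} (hp : p ∈ trackSet w V₀ ρ i) (hq : q ∈ trackSet w V₀ ρ i) :
    ‖(w i p).2 - (w i q).2‖ ≤ C ^ 2 * s * ‖(w i p).1 - (w i q).1‖ := by
  have hC := h.one_le
  have hs := h.s_nonneg
  calc _ ≤ C * nY i ((w i p).2 - (w i q).2) := h.le_nY i hi _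
    _ ≤ C * (s * nX i ((w i p).1 - (w i q).1)) := by gcongr; exact h.slope i hi p hp q hq
    _ ≤ C * (s * (C * ‖(w i p).1 - (w i q).1‖)) := by gcongr; exact h.nX_le i hi _
    _ = _ := by ring

theorem norm_sub_eq (h : GraphOrbit w A D nX nY C lam s κ₀ κ ρ V₀ p₀ n) {i : ℕ} (hi : i ≤ n)
    {p q : P} (hp : p ∈ trackSet w V₀ ρ i) (hq : q ∈ trackSet w V₀ ρ i) :
    ‖w i p - w i q‖ = ‖(w i p).1 - (w i q).1‖ := by
  rw [Prod.norm_def, Prod.fst_sub, Prod.snd_sub, max_eq_left (h.norm_snd_le hi hp hq)]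

theorem norm_eq (h : GraphOrbit w A D nX nY C lam s κ₀ κ ρ V₀ p₀ n) {i : ℕ} (hi : i ≤ n)
    {p : P} (hp : p ∈ trackSet w V₀ ρ i) : ‖w i p‖ = ‖(w i p).1‖ := by
  have := h.norm_sub_eq hi hp (h.base_mem hi)
  simpa [h.base i hi] using this

theorem norm_le (h : GraphOrbit w A D nX nY C lam s κ₀ κ ρ V₀ p₀ n) {i : ℕ} (hi : i ≤ n)
    {p : P} (hp : p ∈ trackSet w V₀ ρ i) : ∀ j ≤ i, ‖w j p‖ ≤ ρ j := fun j hj => by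
  rw [h.norm_eq (hj.trans hi) (trackSet_antitone w V₀ ρ hj hp)]
  exact hp.2 j hj

theorem norm_fst_sub_le (h : GraphOrbit w A D nX nY C lam s κ₀ κ ρ V₀ p₀ n) {i : ℕ} (hi : i < n)
    {p q : P} (hp : p ∈ trackSet w V₀ ρ i) (hq : q ∈ trackSet w V₀ ρ i) :
    ‖(w (i + 1) p).1 - (w (i + 1) q).1 - A i ((w i p).1 - (w i q).1)‖ ≤
      κ i * ‖(w i p).1 - (w i q).1‖ := by
  have := h.approx i hi p hp.1 q hq.1 (h.norm_le hi.le hp) (h.norm_le hi.le hq)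
  rw [h.norm_sub_eq hi.le hp hq] at this
  exact (norm_fst_le _).trans this

/-- The expansion of the iterated graphs, at the rate at which the radii `ρ i` grow. -/
theorem expand (h : GraphOrbit w A D nX nY C lam s κ₀ κ ρ V₀ p₀ n) {i : ℕ} (hi : i < n)
    {p q : P} (hp : p ∈ trackSet w V₀ ρ i) (hq : q ∈ trackSet w V₀ ρ i) :
    (‖((A i).symm : X →L[ℝ] X)‖⁻¹ - κ₀) * ‖(w i p).1 - (w i q).1‖ ≤
      ‖(w (i + 1) p).1 - (w (i + 1) q).1‖ := by
  apply inv_norm_symm_sub_mul_le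
  refine (h.norm_fst_sub_le hi hp hq).trans ?_
  gcongr
  exact h.κ_le i hi

/-- Distances along the iterated graphs contract backwards as the radii do. -/
theorem backward_contraction (h : GraphOrbit w A D nX nY C lam s κ₀ κ ρ V₀ p₀ n) {i j : ℕ}
    (hij : i ≤ j) (hj : j ≤ n) {p q : P} (hp : p ∈ trackSet w V₀ ρ j)
    (hq : q ∈ trackSet w V₀ ρ j) :
    ρ j * ‖(w i p).1 - (w i q).1‖ ≤ ρ i * ‖(w j p).1 - (w j q).1‖ := by
  induction j, hij using Nat.le_induction with
  | base => exact le_rfl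
  | succ j hij ih =>
    have hp' := trackSet_antitone w V₀ ρ j.le_succ hp
    have hq' := trackSet_antitone w V₀ ρ j.le_succ hq
    have h1 := ih (by omega) hp' hq'
    have h2 := h.expand (show j < n by omega) hp' hq'
    rw [h.ρ_succ j (by omega)]
    set e := ‖((A j).symm : X →L[ℝ] X)‖⁻¹ - κ₀
    rcases le_or_gt e 0 with he | he
    · calc e * ρ j * ‖(w i p).1 - (w i q).1‖ ≤ 0 :=
          mul_nonpos_of_nonpos_of_nonneg
            (mul_nonpos_of_nonpos_of_nonneg he (h.ρ_nonneg j (by omega))) (norm_nonneg _)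
        _ ≤ _ := mul_nonneg (h.ρ_nonneg i (by omega)) (norm_nonneg _)
    · calc e * ρ j * ‖(w i p).1 - (w i q).1‖ = e * (ρ j * ‖(w i p).1 - (w i q).1‖) := by ring
        _ ≤ e * (ρ i * ‖(w j p).1 - (w j q).1‖) := by gcongr
        _ = ρ i * (e * ‖(w j p).1 - (w j q).1‖) := by ring
        _ ≤ _ := mul_le_mul_of_nonneg_left h2 (h.ρ_nonneg i (by omega))

/-- Each iterated disk contains a graph over the full ball of radius `ρ i`. -/
theorem surj [CompleteSpace X] (h : GraphOrbit w A D nX nY C lam s κ₀ κ ρ V₀ p₀ n) :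
    ∀ i ≤ n, Metric.closedBall 0 (ρ i) ⊆ (fun p => (w i p).1) '' trackSet w V₀ ρ i := by
  classical
  have : Nonempty P := ⟨p₀⟩
  intro i
  induction i with
  | zero =>
    intro _ v hv
    obtain ⟨p, hp, rfl⟩ := h.surj₀ hv
    refine ⟨p, ?_, rfl⟩
    rw [trackSet_zero]
    exact ⟨hp, by simpa using hv⟩
  | succ i ih =>
    intro hi v hv
    have ih := ih (by omega)
    set g : X → P := Function.invFunOn (fun p => (w i p).1) (trackSet w V₀ ρ i)
    have hg : ∀ v ∈ Metric.closedBall (0 : X) (ρ i), g v ∈ trackSet w V₀ ρ i ∧ (w i (g v)).1 = v :=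
      fun v hv => ⟨Function.invFunOn_mem (ih hv), Function.invFunOn_eq (ih hv)⟩
    set T : X → X := fun v => (w (i + 1) (g v)).1
    have hκ := h.κ_nonneg i (by omega)
    have hT : ApproximatesLinearOn T (A i : X →L[ℝ] X) (Metric.closedBall 0 (ρ i))
        ⟨κ i, hκ⟩ := by
      intro v hv v' hv'
      have := h.norm_fst_sub_le (show i < n by omega) (hg v hv).1 (hg v' hv').1
      rw [(hg v hv).2, (hg v' hv').2] at this
      exact this
    have h0 : (0 : X) ∈ Metric.closedBall (0 : X) (ρ i) :=
      Metric.mem_closedBall_self (h.ρ_nonneg i (by omega))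
    have hT0 : T 0 = 0 := by
      have := h.norm_fst_sub_le (show i < n by omega) (hg 0 h0).1 (h.base_mem (by omega))
      rw [(hg 0 h0).2, h.base i (by omega), h.base (i + 1) hi] at this
      simpa [T] using this
    set Ainv : (A i : X →L[ℝ] X).NonlinearRightInverse := (A i).toNonlinearRightInverse
    have hsurj := hT.surjOn_closedBall_of_nonlinearRightInverse Ainv (h.ρ_nonneg i (by omega))
      subset_rfl
    have hn : (Ainv.nnnorm : ℝ) = ‖((A i).symm : X →L[ℝ] X)‖ := rfl
    rw [hT0, hn] at hsurj
    have hv' : v ∈ Metric.closedBall (0 : X)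
        ((‖((A i).symm : X →L[ℝ] X)‖⁻¹ - ((⟨κ i, hκ⟩ : ℝ≥0) : ℝ)) * ρ i) := by
      refine Metric.closedBall_subset_closedBall ?_ hv
      rw [h.ρ_succ i (by omega)]
      refine mul_le_mul_of_nonneg_right ?_ (h.ρ_nonneg i (by omega))
      exact sub_le_sub_left (h.κ_le i (by omega)) _
    obtain ⟨u, hu, rfl⟩ := hsurj hv'
    refine ⟨g u, mem_trackSet_succ.2 ⟨(hg u hu).1, ?_⟩, rfl⟩
    simpa using hv

theorem image_eq [CompleteSpace X] (h : GraphOrbit w A D nX nY C lam s κ₀ κ ρ V₀ p₀ n) {i : ℕ}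
    (hi : i ≤ n) :
    (fun p => (w i p).1) '' trackSet w V₀ ρ i = Metric.closedBall 0 (ρ i) := by
  refine Subset.antisymm ?_ (h.surj i hi)
  rintro _ ⟨p, hp, rfl⟩
  simpa using hp.2 i le_rfl

/-- Bounded distortion: up to a factor controlled by the sum of the errors `κ i`, the passage from
time `0` to time `n` multiplies the volume of all sets by the same number. -/
theorem distortion [FiniteDimensional ℝ X] [MeasurableSpace X] [BorelSpace X] (μ : Measure X)
    [μ.IsAddHaarMeasure] (h : GraphOrbit w A D nX nY C lam s κ₀ κ ρ V₀ p₀ n) :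
    ∀ i ≤ n, ∃ m : ℝ≥0∞, m ≠ 0 ∧ m ≠ ⊤ ∧ ∀ S ⊆ trackSet w V₀ ρ i,
      μ ((fun p => (w i p).1) '' S) ≤
        ENNReal.ofReal (Real.exp (2 * Module.finrank ℝ X * C * ∑ j ∈ Finset.range i, κ j)) *
          (m * μ ((fun p => (w 0 p).1) '' S)) ∧
      m * μ ((fun p => (w 0 p).1) '' S) ≤
        ENNReal.ofReal (Real.exp (2 * Module.finrank ℝ X * C * ∑ j ∈ Finset.range i, κ j)) *
          μ ((fun p => (w i p).1) '' S) := by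
  intro i
  induction i with
  | zero => exact fun _ => ⟨1, one_ne_zero, ENNReal.one_ne_top, fun S _ => by simp⟩
  | succ i ih =>
    intro hi
    obtain ⟨m, hm0, hm1, hm⟩ := ih (by omega)
    refine ⟨ENNReal.ofReal |LinearMap.det ((A i : X ≃L[ℝ] X) : X →ₗ[ℝ] X)| * m, ?_, ?_, ?_⟩
    · refine mul_ne_zero ?_ hm0
      simp only [ne_eq, ENNReal.ofReal_eq_zero, not_le, abs_pos]
      exact (LinearEquiv.isUnit_det' (A i).toLinearEquiv).ne_zero
    · exact ENNReal.mul_ne_top ENNReal.ofReal_ne_top hm1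
    intro S hS
    have hS' := hS.trans (trackSet_antitone w V₀ ρ i.le_succ)
    obtain ⟨h1, h2⟩ := hm S hS'
    have hC := h.one_le
    have hκ : C * κ i ≤ 1 / 2 := by
      have := h.κ_le i (by omega)
      have h3 := h.κ₀_le
      nlinarith
    obtain ⟨h3, h4⟩ := addHaar_image_near_linear μ S (A i) (fun p => (w i p).1)
      (fun p => (w (i + 1) p).1) (h.step i (by omega)).norm_symm_le (h.κ_nonneg i (by omega)) hκ
      (fun p hp q hq => h.norm_fst_sub_le (by omega) (hS' hp) (hS' hq))
    have hexp : ENNReal.ofReal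
        (Real.exp (2 * Module.finrank ℝ X * C * ∑ j ∈ Finset.range (i + 1), κ j)) =
        ENNReal.ofReal (Real.exp (2 * Module.finrank ℝ X * C * κ i)) *
        ENNReal.ofReal (Real.exp (2 * Module.finrank ℝ X * C * ∑ j ∈ Finset.range i, κ j)) := by
      rw [← ENNReal.ofReal_mul (Real.exp_pos _).le, ← Real.exp_add, Finset.sum_range_succ]
      congr 2; ring
    rw [hexp]
    set a := ENNReal.ofReal (Real.exp (2 * Module.finrank ℝ X * C * κ i))
    set b := ENNReal.ofReal (Real.exp (2 * Module.finrank ℝ X * C * ∑ j ∈ Finset.range i, κ j))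
    set t := ENNReal.ofReal |LinearMap.det ((A i : X ≃L[ℝ] X) : X →ₗ[ℝ] X)|
    constructor
    · calc _ ≤ a * (t * μ ((fun p => (w i p).1) '' S)) := h3
        _ ≤ a * (t * (b * (m * μ ((fun p => (w 0 p).1) '' S)))) := by gcongr
        _ = _ := by ring
    · calc _ = t * (m * μ ((fun p => (w 0 p).1) '' S)) := by ring
        _ ≤ t * (b * μ ((fun p => (w i p).1) '' S)) := by gcongr
        _ = b * (t * μ ((fun p => (w i p).1) '' S)) := by ring
        _ ≤ b * (a * μ ((fun p => (w (i + 1) p).1) '' S)) := by gcongr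
        _ = _ := by ring

end GraphOrbit

end GraphOrbit

end

/-! ### Centre-unstable atlases and hyperbolic times -/

section

/-- Finitely many charts around the points of `Λ`, with the dominated splitting read in them.
At each `q ∈ Λ` the frame `frame c q` identifies `X × Y` with the model space `E` in such a way that
`X × 0` and `0 × Y` are the centre-unstable and the centre-stable space at `q`, read in the chart
`c`, and that the derivative of `f` becomes the block diagonal map `A q × D q`. All estimates are
uniform: `r` is a radius, `C` a constant, `α` the Hölder exponent of the derivative. The seminorms
`nX`, `nY` carry the domination inequality; they may differ from the ambient norms, with respect
to which expansion is measured. The chart `c` is used around the points of the compact set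
`dom c ⊆ Λ`, `idx q` is a preferred chart at `q ∈ Λ`, and `par c` inverts `chart c` near `dom c`. The
projections onto the centre-unstable space are assumed continuous, but not the frames themselves,
which can be chosen in an arbitrary way. -/
structure CuAtlas {M : Type*} [EMetricSpace M] (X Y E ι : Type*) [NormedAddCommGroup X]
    [NormedSpace ℝ X] [NormedAddCommGroup Y] [NormedSpace ℝ Y] [NormedAddCommGroup E]
    [NormedSpace ℝ E] (f : M → M) (Λ : Set M) where
  source : ι → Set M
  chart : ι → M → E
  par : ι → E → M
  idx : M → ι
  dom : ι → Set M
  frame : ι → M → (X × Y) ≃L[ℝ] E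
  A : M → X ≃L[ℝ] X
  D : M → Y →L[ℝ] Y
  nX : M → Seminorm ℝ X
  nY : M → Seminorm ℝ Y
  r : ℝ
  C : ℝ
  α : ℝ
  lam : ℝ
  r_pos : 0 < r
  one_le : 1 ≤ C
  α_pos : 0 < α
  α_le : α ≤ 1
  lam_nonneg : 0 ≤ lam
  lam_lt : lam < 1
  isOpen_source : ∀ c, IsOpen (source c)
  continuousOn_chart : ∀ c, ContinuousOn (chart c) (source c)
  mem_dom_idx : ∀ q ∈ Λ, q ∈ dom (idx q)
  isCompact_dom : ∀ c, IsCompact (dom c)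
  dom_subset : ∀ c, dom c ⊆ Λ
  dom_subset_source : ∀ c, dom c ⊆ source c
  mem_dom : ∀ q ∈ Λ, ∀ y ∈ source (idx q), ‖chart (idx q) y - chart (idx q) q‖ ≤ r → y ∈ Λ →
    y ∈ dom (idx q)
  par_mem : ∀ c, ∀ q ∈ dom c, ∀ ξ, ‖ξ - chart c q‖ ≤ r → par c ξ ∈ source c ∧ chart c (par c ξ) = ξ
  edist_le : ∀ c, ∀ q ∈ dom c, ∀ y ∈ source c, ∀ y' ∈ source c, ‖chart c y - chart c q‖ ≤ r →
    ‖chart c y' - chart c q‖ ≤ r → edist y y' ≤ ENNReal.ofReal (C * ‖chart c y - chart c y'‖)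
  norm_lt_of_edist : ∀ ε > 0, ∃ ε' > 0, ∀ c, ∀ q ∈ dom c, ∀ y ∈ source c, ∀ y' ∈ source c,
    ‖chart c y - chart c q‖ ≤ r → ‖chart c y' - chart c q‖ ≤ r →
    edist y y' < ENNReal.ofReal ε' → ‖chart c y - chart c y'‖ < ε
  map_mem : ∀ c c', ∀ q ∈ dom c, f q ∈ dom c' → ∀ y ∈ source c, ‖chart c y - chart c q‖ ≤ r →
    f y ∈ source c'
  approx : ∀ c c', ∀ q ∈ dom c, f q ∈ dom c' → ∀ ρ ≤ r, ∀ y ∈ source c, ∀ y' ∈ source c,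
    ‖chart c y - chart c q‖ ≤ ρ → ‖chart c y' - chart c q‖ ≤ ρ →
    ‖chart c' (f y) - chart c' (f y') - frame c' (f q)
      ((A q : X →L[ℝ] X).prodMap (D q) ((frame c q).symm (chart c y - chart c y')))‖ ≤
      C * ρ ^ α * ‖chart c y - chart c y'‖
  frame_le : ∀ c, ∀ q ∈ dom c, ∀ w, ‖frame c q w‖ ≤ C * ‖w‖
  symm_frame_le : ∀ c, ∀ q ∈ dom c, ∀ ξ, ‖(frame c q).symm ξ‖ ≤ C * ‖ξ‖
  step : ∀ q ∈ Λ, DominatedStep (A q) (D q) (nX q) (nX (f q)) (nY q) (nY (f q)) C lam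
  le_nY : ∀ q ∈ Λ, ∀ z, ‖z‖ ≤ C * nY q z
  continuousOn_proj : ∀ c, ContinuousOn (fun q =>
    ((frame c q : X × Y →L[ℝ] E) ∘L ((ContinuousLinearMap.inl ℝ X Y) ∘L
      (ContinuousLinearMap.fst ℝ X Y))) ∘L ((frame c q).symm : E →L[ℝ] X × Y)) (dom c)

namespace CuAtlas

variable {M X Y E ι : Type*} [EMetricSpace M] [NormedAddCommGroup X]
    [NormedSpace ℝ X] [NormedAddCommGroup Y] [NormedSpace ℝ Y] [NormedAddCommGroup E]
    [NormedSpace ℝ E] {f : M → M} {Λ : Set M} (T : CuAtlas X Y E ι f Λ)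

/-- The coordinates of `y` in the chart `c`, centred at `q` and split along the frame at `q`. -/
def coord (c : ι) (q y : M) : X × Y := (T.frame c q).symm (T.chart c y - T.chart c q)

theorem norm_chart_sub_eq (c : ι) (q y y' : M) :
    T.chart c y - T.chart c y' = T.frame c q (T.coord c q y - T.coord c q y') := by
  simp [coord, map_sub]

theorem frame_coord (c : ι) (q y : M) :
    T.frame c q (T.coord c q y) = T.chart c y - T.chart c q := by
  simp [coord]

@[simp] theorem coord_self (c : ι) (q : M) : T.coord c q q = 0 := by simp [coord]

theorem norm_chart_sub_le {c : ι} {q : M} (hq : q ∈ T.dom c) (y y' : M) :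
    ‖T.chart c y - T.chart c y'‖ ≤ T.C * ‖T.coord c q y - T.coord c q y'‖ := by
  rw [T.norm_chart_sub_eq c q]; exact T.frame_le c q hq _

theorem norm_coord_sub_le {c : ι} {q : M} (hq : q ∈ T.dom c) (y y' : M) :
    ‖T.coord c q y - T.coord c q y'‖ ≤ T.C * ‖T.chart c y - T.chart c y'‖ := by
  have : T.coord c q y - T.coord c q y' = (T.frame c q).symm (T.chart c y - T.chart c y') := by
    simp [coord, map_sub]
  rw [this]; exact T.symm_frame_le c q hq _

theorem norm_chart_sub_self_le {c : ι} {q : M} (hq : q ∈ T.dom c) {y : M} {ρ : ℝ}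
    (h : ‖T.coord c q y‖ ≤ ρ) : ‖T.chart c y - T.chart c q‖ ≤ T.C * ρ := by
  have := T.norm_chart_sub_le hq y q
  rw [coord_self, sub_zero] at this
  exact this.trans (mul_le_mul_of_nonneg_left h (by linarith [T.one_le]))

theorem continuousAt_coord (c : ι) (q : M) {y : M} (hy : y ∈ T.source c) :
    ContinuousAt (T.coord c q) y := by
  have h1 := (T.continuousOn_chart c).continuousAt ((T.isOpen_source c).mem_nhds hy)
  exact (T.frame c q).symm.continuous.continuousAt.comp (h1.sub continuousAt_const)

/-- A radius on which the nonlinearity of `f` in the coordinates is at most `ε`. -/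
theorem exists_pos_le {ε : ℝ} (hε : 0 < ε) : ∃ ρ > 0, T.C * ρ ≤ T.r ∧ T.C ^ 4 * ρ ^ T.α ≤ ε := by
  have h1 : Tendsto (fun ρ : ℝ => T.C * ρ) (𝓝[>] 0) (𝓝 0) := by
    have : Continuous (fun ρ : ℝ => T.C * ρ) := by fun_prop
    simpa using (this.tendsto 0).mono_left nhdsWithin_le_nhds
  have h2 : Tendsto (fun ρ : ℝ => T.C ^ 4 * ρ ^ T.α) (𝓝[>] 0) (𝓝 0) := by
    have := ((Real.continuousAt_rpow_const 0 T.α (Or.inr T.α_pos.le)).tendsto.const_mul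
      (T.C ^ 4)).mono_left (nhdsWithin_le_nhds (s := Ioi 0))
    simpa [Real.zero_rpow T.α_pos.ne'] using this
  have h3 := (h1.eventually_lt_const T.r_pos).and
    ((h2.eventually_lt_const hε).and self_mem_nhdsWithin)
  obtain ⟨ρ, h4, h5, h6⟩ := h3.exists
  exact ⟨ρ, h6, h4.le, h5.le⟩

/-- In the coordinates centred at `q` and `f q`, the map `f` is close to `A q × D q`. -/
theorem coord_approx {c c' : ι} {q : M} (hq : q ∈ T.dom c) (hfq : f q ∈ T.dom c') {ρ : ℝ}
    (hρ0 : 0 ≤ ρ) (hρ : T.C * ρ ≤ T.r) {y y' : M} (hy : y ∈ T.source c) (hy' : y' ∈ T.source c)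
    (hyρ : ‖T.coord c q y‖ ≤ ρ) (hyρ' : ‖T.coord c q y'‖ ≤ ρ) :
    ‖T.coord c' (f q) (f y) - T.coord c' (f q) (f y') -
      (T.A q ((T.coord c q y).1 - (T.coord c q y').1),
        T.D q ((T.coord c q y).2 - (T.coord c q y').2))‖ ≤
      T.C ^ 4 * ρ ^ T.α * ‖T.coord c q y - T.coord c q y'‖ := by
  have hC := T.one_le
  have hC0 : 0 ≤ T.C := by linarith
  have h1 := T.approx c c' q hq hfq (T.C * ρ) hρ y hy y' hy' (T.norm_chart_sub_self_le hq hyρ)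
    (T.norm_chart_sub_self_le hq hyρ')
  have hsymm : (T.frame c q).symm (T.chart c y - T.chart c y') =
      T.coord c q y - T.coord c q y' := by simp [coord, map_sub]
  rw [hsymm] at h1
  have h2 := T.symm_frame_le c' (f q) hfq (T.chart c' (f y) - T.chart c' (f y') -
    T.frame c' (f q) ((T.A q : X →L[ℝ] X).prodMap (T.D q) (T.coord c q y - T.coord c q y')))
  rw [map_sub, ContinuousLinearEquiv.symm_apply_apply] at h2
  have h3 : (T.frame c' (f q)).symm (T.chart c' (f y) - T.chart c' (f y')) =
      T.coord c' (f q) (f y) - T.coord c' (f q) (f y') := by simp [coord, map_sub]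
  rw [h3] at h2
  have hpow : (T.C * ρ) ^ T.α ≤ T.C * ρ ^ T.α := by
    rw [Real.mul_rpow hC0 hρ0]
    gcongr
    calc T.C ^ T.α ≤ T.C ^ (1 : ℝ) := Real.rpow_le_rpow_of_exponent_le hC T.α_le
      _ = T.C := Real.rpow_one _
  refine h2.trans ?_
  calc _ ≤ T.C * (T.C * (T.C * ρ) ^ T.α * ‖T.chart c y - T.chart c y'‖) := by gcongr
    _ ≤ T.C * (T.C * (T.C * ρ ^ T.α) * (T.C * ‖T.coord c q y - T.coord c q y'‖)) := by
      gcongr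
      exact T.norm_chart_sub_le hq y y'
    _ = _ := by ring

theorem map_mem_of_coord {c c' : ι} {q : M} (hq : q ∈ T.dom c) (hfq : f q ∈ T.dom c') {ρ : ℝ}
    (hρ : T.C * ρ ≤ T.r) {y : M} (hy : y ∈ T.source c)
    (hyρ : ‖T.coord c q y‖ ≤ ρ) : f y ∈ T.source c' :=
  T.map_mem c c' q hq hfq y hy ((T.norm_chart_sub_self_le hq hyρ).trans hρ)

/-- The coordinates of `y` in the preferred chart at the point `q ∈ Λ`. -/
def loc (q y : M) : X × Y := T.coord (T.idx q) q y

@[simp] theorem loc_self (q : M) : T.loc q q = 0 := T.coord_self _ _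

/-- A disk transverse to the centre-stable direction has finite slope. -/
theorem exists_slope_bound {P : Type*} [NormedAddCommGroup P] [NormedSpace ℝ P] {q : M} (hq : q ∈ Λ)
    (G : P ≃L[ℝ] X) (Z : P →L[ℝ] Y) :
    ∃ s, 0 ≤ s ∧ ∀ e, T.nY q (Z e) ≤ s * T.nX q (G e) := by
  have hC := T.one_le
  have hst := T.step q hq
  refine ⟨T.C * (‖Z‖ * (‖(G.symm : X →L[ℝ] P)‖ * T.C)), by positivity, fun e => ?_⟩
  calc T.nY q (Z e) ≤ T.C * ‖Z e‖ := hst.nY_le _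
    _ ≤ T.C * (‖Z‖ * ‖e‖) := by gcongr; exact Z.le_opNorm e
    _ ≤ T.C * (‖Z‖ * (‖(G.symm : X →L[ℝ] P)‖ * ‖G e‖)) := by
      gcongr
      simpa using (G.symm : X →L[ℝ] P).le_opNorm (G e)
    _ ≤ T.C * (‖Z‖ * (‖(G.symm : X →L[ℝ] P)‖ * (T.C * T.nX q (G e)))) := by
      gcongr; exact hst.le_nX _
    _ = _ := by ring

/-- Along the orbit of a point of `Λ` where a disk is transverse to the centre-stable direction, the
iterated disks remain differentiable graphs, and their slope decreases like `lam ^ n`. -/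
theorem hasStrictFDerivAt_iterate {P : Type*} [NormedAddCommGroup P] [NormedSpace ℝ P]
    (hinv : MapsTo f Λ Λ) {φ : P → M} {p : P} (hp : φ p ∈ Λ) {G : P ≃L[ℝ] X} {Z : P →L[ℝ] Y}
    (hd : HasStrictFDerivAt (fun p' => T.loc (φ p) (φ p')) ((G : P →L[ℝ] X).prod Z) p)
    (hφ : ContinuousAt φ p) {s : ℝ} (hf : Continuous f)
    (hslope : ∀ e, T.nY (φ p) (Z e) ≤ s * T.nX (φ p) (G e)) (n : ℕ) :
    ∃ (G' : P ≃L[ℝ] X) (Z' : P →L[ℝ] Y),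
      HasStrictFDerivAt (fun p' => T.loc (f^[n] (φ p)) (f^[n] (φ p')))
        ((G' : P →L[ℝ] X).prod Z') p ∧
      ∀ e, T.nY (f^[n] (φ p)) (Z' e) ≤ T.lam ^ n * s * T.nX (f^[n] (φ p)) (G' e) := by
  induction n with
  | zero => exact ⟨G, Z, hd, fun e => by simpa using hslope e⟩
  | succ n ih =>
    obtain ⟨G', Z', hd', hs'⟩ := ih
    set q := f^[n] (φ p) with hqdef
    have hqΛ : q ∈ Λ := hinv.iterate n hp
    have hfqΛ : f q ∈ Λ := hinv hqΛ
    have hst := T.step q hqΛ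
    rw [Function.iterate_succ_apply']
    simp only [Function.iterate_succ_apply', ← hqdef]
    refine ⟨G'.trans (T.A q), (T.D q).comp Z', ?_, fun e => ?_⟩
    · set w : P → X × Y := fun p' => T.loc q (f^[n] (φ p'))
      have hw : HasStrictFDerivAt w ((G' : P →L[ℝ] X).prod Z') p := hd'
      have hw0 : w p = 0 := by simp [w, ← hqdef]
      set L : X × Y →L[ℝ] X × Y := (T.A q : X →L[ℝ] X).prodMap (T.D q)
      have hcomp : HasStrictFDerivAt (fun p' => L (w p')) (L ∘L ((G' : P →L[ℝ] X).prod Z')) p :=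
        L.hasStrictFDerivAt.comp p hw
      have hLeq : (((G'.trans (T.A q) : P ≃L[ℝ] X) : P →L[ℝ] X).prod ((T.D q).comp Z')) =
          L ∘L ((G' : P →L[ℝ] X).prod Z') := by
        ext e <;> simp [L]
      rw [hLeq]
      have hsrc : ∀ᶠ p' in 𝓝 p, f^[n] (φ p') ∈ T.source (T.idx q) := by
        have hc : ContinuousAt (fun p' => f^[n] (φ p')) p :=
          (hf.iterate n).continuousAt.comp hφ
        exact hc.preimage_mem_nhds ((T.isOpen_source _).mem_nhds
          (T.dom_subset_source _ (T.mem_dom_idx q hqΛ)))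
      -- Near the base point, `f` in coordinates differs from `L` by a map of small Lipschitz constant.
      have hlit : (fun x : P × P => (T.loc (f q) (f (f^[n] (φ x.1))) -
          T.loc (f q) (f (f^[n] (φ x.2)))) - (L (w x.1) - L (w x.2))) =o[𝓝 (p, p)]
          fun x => x.1 - x.2 := by
        refine Asymptotics.IsLittleO.trans_isBigO (g := fun x : P × P => w x.1 - w x.2) ?_
          hw.isBigO_sub
        rw [Asymptotics.isLittleO_iff]
        intro ε hε
        have hC := T.one_le
        obtain ⟨ρ, hρ0, hρr, hρε⟩ := T.exists_pos_le hε
        have hwc : ∀ᶠ p' in 𝓝 p, ‖w p'‖ ≤ ρ := by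
          have := hw.continuousAt.norm
          rw [ContinuousAt, hw0, norm_zero] at this
          exact (this.eventually_lt_const hρ0).mono fun _ h => h.le
        have hboth := (hsrc.and hwc)
        have h1 : ∀ᶠ x : P × P in 𝓝 (p, p), (f^[n] (φ x.1) ∈ T.source (T.idx q) ∧ ‖w x.1‖ ≤ ρ) ∧
            (f^[n] (φ x.2) ∈ T.source (T.idx q) ∧ ‖w x.2‖ ≤ ρ) := by
          rw [nhds_prod_eq]; exact hboth.prod_mk hboth
        filter_upwards [h1] with x hx
        have := T.coord_approx (T.mem_dom_idx q hqΛ) (T.mem_dom_idx (f q) hfqΛ) hρ0.le hρr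
          hx.1.1 hx.2.1 hx.1.2 hx.2.2
        refine le_trans (le_of_eq ?_) (this.trans (mul_le_mul_of_nonneg_right hρε (norm_nonneg _)))
        congr 1
        simp only [loc, w, L, map_sub]
        rfl
      have hc2 := hcomp.isLittleO
      refine HasStrictFDerivAt.of_isLittleO ?_
      refine (hlit.add hc2).congr_left fun x => ?_
      abel
    · have hdom := hst.dominated (T.A q (G' e)) (Z' e)
      rw [ContinuousLinearEquiv.symm_apply_apply] at hdom
      have hs1 := hs' e
      have hlam := T.lam_nonneg
      rcases (apply_nonneg (T.nX q) (G' e)).eq_or_lt with h0 | h0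
      · have hG : ‖G' e‖ ≤ 0 := by
          have := hst.le_nX (G' e); rwa [← h0, mul_zero] at this
        have he : e = 0 := by
          have : G' e = 0 := norm_le_zero_iff.1 hG
          simpa using this
        subst he
        simp
      · have : T.nY (f q) (T.D q (Z' e)) * T.nX q (G' e) ≤
            (T.lam ^ (n + 1) * s * T.nX (f q) (T.A q (G' e))) * T.nX q (G' e) := by
          refine hdom.trans ?_
          have h2 : 0 ≤ T.nX (f q) (T.A q (G' e)) := apply_nonneg _ _
          calc T.lam * (T.nY q (Z' e) * T.nX (f q) (T.A q (G' e)))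
              ≤ T.lam * ((T.lam ^ n * s * T.nX q (G' e)) * T.nX (f q) (T.A q (G' e))) := by
                gcongr
            _ = _ := by ring
        exact le_of_mul_le_mul_right this h0

end CuAtlas

/-- A strictly differentiable disk is, near a point, a graph over a small ball, of slope close to
the slope of its tangent space. -/
theorem exists_graph_nhds {P X Y : Type*} [NormedAddCommGroup P] [NormedSpace ℝ P]
    [FiniteDimensional ℝ P] [NormedAddCommGroup X] [NormedSpace ℝ X] [CompleteSpace X]
    [NormedAddCommGroup Y] [NormedSpace ℝ Y] {w : P → X × Y} {p : P} {G : P ≃L[ℝ] X} {Z : P →L[ℝ] Y}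
    (hw : HasStrictFDerivAt w ((G : P →L[ℝ] X).prod Z) p) (hw0 : w p = 0)
    {nX : Seminorm ℝ X} {nY : Seminorm ℝ Y} {C s : ℝ} (hC : 0 ≤ C) (hs : 0 < s)
    (hnX : ∀ u, nX u ≤ C * ‖u‖) (hnX' : ∀ u, ‖u‖ ≤ C * nX u) (hnY : ∀ z, nY z ≤ C * ‖z‖)
    (hslope : ∀ e, nY (Z e) ≤ s / 2 * nX (G e)) {κ : ℝ} (hκ : 0 < κ) {U : Set P} (hU : U ∈ 𝓝 p) :
    ∃ ρ₀ > 0, ∃ V₀ ∈ 𝓝 p, V₀ ⊆ U ∧ ∃ K : ℝ,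
      (∀ q ∈ V₀, ∀ q' ∈ V₀, nY ((w q).2 - (w q').2) ≤ s * nX ((w q).1 - (w q').1)) ∧
      (∀ q ∈ V₀, ∀ q' ∈ V₀, ‖(w q).1 - (w q').1 - G (q - q')‖ ≤ κ * ‖q - q'‖) ∧
      (∀ q ∈ V₀, ∀ q' ∈ V₀, ‖q - q'‖ ≤ K * ‖(w q).1 - (w q').1‖) ∧
      (Metric.closedBall 0 ρ₀ ⊆ (fun q => (w q).1) '' V₀) := by
  set b := ‖(G.symm : X →L[ℝ] P)‖ with hb
  have hb0 : 0 ≤ b := norm_nonneg _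
  -- `κ'` is so small that `w.1` remains invertible and that the slope grows from `s / 2` to at most `s`.
  set κ' : ℝ := min κ (min (1 / (2 * b + 1)) (s / 2 / ((s / 2 + 1) * C * (2 * b) * C + 1)))
  have hκ'0 : 0 < κ' := by
    have h3 : 0 ≤ (s / 2 + 1) * C * (2 * b) * C := by positivity
    refine lt_min hκ (lt_min (by positivity) (by positivity))
  have hκ'κ : κ' ≤ κ := min_le_left _ _
  have hκ'b : κ' * (2 * b + 1) ≤ 1 := by
    rw [← le_div_iff₀ (by positivity)]
    exact (min_le_right _ _).trans (min_le_left _ _)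
  have hκ's : κ' * ((s / 2 + 1) * C * (2 * b) * C + 1) ≤ s / 2 := by
    have h3 : 0 ≤ (s / 2 + 1) * C * (2 * b) * C := by positivity
    rw [← le_div_iff₀ (by positivity)]
    exact (min_le_right _ _).trans (min_le_right _ _)
  obtain ⟨V₁, hV₁, happ⟩ := hw.approximates_deriv_on_nhds (c := ⟨κ', hκ'0.le⟩) (Or.inr hκ'0)
  obtain ⟨t, ht0, ht⟩ := Metric.nhds_basis_closedBall.mem_iff.1 (inter_mem hU hV₁)
  set V₀ := Metric.closedBall p t
  have happ' : ∀ q ∈ V₀, ∀ q' ∈ V₀, ‖w q - w q' - ((G : P →L[ℝ] X).prod Z) (q - q')‖ ≤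
      κ' * ‖q - q'‖ := fun q hq q' hq' => happ q (ht hq).2 q' (ht hq').2
  have hfst : ∀ q ∈ V₀, ∀ q' ∈ V₀, ‖(w q).1 - (w q').1 - G (q - q')‖ ≤ κ' * ‖q - q'‖ :=
    fun q hq q' hq' => (norm_fst_le _).trans (happ' q hq q' hq')
  have hsnd : ∀ q ∈ V₀, ∀ q' ∈ V₀, ‖(w q).2 - (w q').2 - Z (q - q')‖ ≤ κ' * ‖q - q'‖ :=
    fun q hq q' hq' => (norm_snd_le _).trans (happ' q hq q' hq')
  have hbG : ∀ e, ‖e‖ ≤ b * ‖G e‖ := fun e => by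
    simpa using (G.symm : X →L[ℝ] P).le_opNorm (G e)
  have hlip : ∀ q ∈ V₀, ∀ q' ∈ V₀, ‖q - q'‖ ≤ 2 * b * ‖(w q).1 - (w q').1‖ := by
    intro q hq q' hq'
    have h1 := hfst q hq q' hq'
    have h2 := hbG (q - q')
    have h3 : ‖G (q - q')‖ ≤ ‖(w q).1 - (w q').1‖ + κ' * ‖q - q'‖ := by
      have := norm_sub_norm_le (G (q - q')) ((w q).1 - (w q').1)
      rw [norm_sub_rev (G (q - q'))] at this; linarith
    have h4 : b * ‖G (q - q')‖ ≤ b * (‖(w q).1 - (w q').1‖ + κ' * ‖q - q'‖) := by gcongr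
    have h5 : b * κ' ≤ 1 / 2 := by nlinarith
    have h6 : b * κ' * ‖q - q'‖ ≤ 1 / 2 * ‖q - q'‖ := by gcongr
    nlinarith
  set Ginv : (G : P →L[ℝ] X).NonlinearRightInverse := G.toNonlinearRightInverse
  have hGinv : (Ginv.nnnorm : ℝ) = b := rfl
  have happG : ApproximatesLinearOn (fun q => (w q).1) (G : P →L[ℝ] X) V₀ ⟨κ', hκ'0.le⟩ :=
    fun q hq q' hq' => hfst q hq q' hq'
  have hsurj := happG.surjOn_closedBall_of_nonlinearRightInverse Ginv ht0.le subset_rfl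
  rw [hGinv, hw0] at hsurj
  -- The case `b = 0` only occurs if `X` is trivial.
  have hρ : 0 < (b⁻¹ - κ') * t ∨ b = 0 := by
    rcases hb0.eq_or_lt with h | h
    · exact Or.inr h.symm
    · left
      have : κ' < b⁻¹ := by
        rw [lt_inv_comm₀ hκ'0 h, ← one_div, lt_div_iff₀ hκ'0]
        nlinarith
      exact mul_pos (sub_pos.2 this) ht0
  have hsurj' : ∃ ρ₀ > 0, Metric.closedBall 0 ρ₀ ⊆ (fun q => (w q).1) '' V₀ := by
    rcases hρ with h | h
    · exact ⟨_, h, hsurj⟩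
    · refine ⟨1, one_pos, fun v _ => ⟨p, Metric.mem_closedBall_self ht0.le, ?_⟩⟩
      have h1 : ∀ v : X, v = 0 := fun v => by
        have h2 := hbG (G.symm v)
        rw [h, zero_mul] at h2
        have h3 : G.symm v = 0 := norm_le_zero_iff.1 h2
        simpa using h3
      rw [h1 v]; exact h1 _
  obtain ⟨ρ₀, hρ₀, hsurj'⟩ := hsurj'
  refine ⟨ρ₀, hρ₀, V₀, Metric.closedBall_mem_nhds p ht0, fun q hq => (ht hq).1, 2 * b, ?_,
    fun q hq q' hq' => (hfst q hq q' hq').trans (by gcongr), hlip, hsurj'⟩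
  intro q hq q' hq'
  set e := q - q'
  set u := (w q).1 - (w q').1
  set z := (w q).2 - (w q').2
  have h1 : nY z ≤ nY (Z e) + nY (z - Z e) := by
    have := map_add_le_add nY (Z e) (z - Z e); simpa using this
  have h2 : nY (z - Z e) ≤ C * (κ' * ‖e‖) := (hnY _).trans (by gcongr; exact hsnd q hq q' hq')
  have h3 : nX (G e) ≤ nX u + nX (G e - u) := by
    have := map_add_le_add nX u (G e - u); simpa using this
  have h4 : nX (G e - u) ≤ C * (κ' * ‖e‖) := by
    refine (hnX _).trans ?_
    rw [norm_sub_rev]; gcongr; exact hfst q hq q' hq'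
  have h5 : ‖e‖ ≤ 2 * b * (C * nX u) :=
    (hlip q hq q' hq').trans (by gcongr; exact hnX' u)
  have hn : 0 ≤ nX u := apply_nonneg _ _
  calc nY z ≤ s / 2 * nX (G e) + C * (κ' * ‖e‖) := by linarith [hslope e]
    _ ≤ s / 2 * (nX u + C * (κ' * ‖e‖)) + C * (κ' * ‖e‖) := by gcongr; linarith
    _ = s / 2 * nX u + (s / 2 + 1) * C * κ' * ‖e‖ := by ring
    _ ≤ s / 2 * nX u + (s / 2 + 1) * C * κ' * (2 * b * (C * nX u)) := by gcongr
    _ = s / 2 * nX u + (κ' * ((s / 2 + 1) * C * (2 * b) * C)) * nX u := by ring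
    _ ≤ s / 2 * nX u + s / 2 * nX u := by gcongr; linarith
    _ = s * nX u := by ring

/-- If the averages of `a` are frequently at most `-c`, there are arbitrarily large times `n` such
that the averages of `a` over all intervals `[m, n)` with `N ≤ m` are at most `-c / 2`: these are
the times where the partial sums of `a + c / 2` reach a new minimum. -/
theorem exists_hyperbolic_time {a : ℕ → ℝ} {c : ℝ} (hc : 0 < c)
    (h : ∃ᶠ n : ℕ in atTop, ∑ i ∈ Finset.range n, a i ≤ -c * n) (N N' : ℕ) :
    ∃ n ≥ N', N ≤ n ∧ ∀ m, N ≤ m → m ≤ n → ∑ i ∈ Finset.Ico m n, a i ≤ -(c / 2) * (n - m : ℕ) := by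
  set S : ℕ → ℝ := fun n => ∑ i ∈ Finset.range n, (a i + c / 2) with hS
  have hSn : ∀ n, S n = ∑ i ∈ Finset.range n, a i + c / 2 * n := by
    intro n; simp [hS, Finset.sum_add_distrib, mul_comm]
  set N₁ := max N N'
  -- The partial sums tend to `-∞` along a subsequence, so their minimum over `[N, n₀]` for a suitable
  -- `n₀` is attained beyond `N₁`.
  obtain ⟨B, hB⟩ : ∃ B, ∀ m ≤ N₁, B ≤ S m := by
    obtain ⟨B, hB⟩ := ((Finset.range (N₁ + 1)).image S).bddBelow
    exact ⟨B, fun m hm => hB (by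
      simp only [Finset.coe_image, Finset.coe_range, mem_image, mem_Iio]
      exact ⟨m, by omega, rfl⟩)⟩
  have hlarge : ∀ᶠ n : ℕ in atTop, -(c / 2) * (n : ℝ) < B ∧ N₁ ≤ n := by
    refine Filter.Eventually.and ?_ (eventually_ge_atTop _)
    have : Tendsto (fun n : ℕ => -(c / 2) * (n : ℝ)) atTop atBot :=
      tendsto_natCast_atTop_atTop.const_mul_atTop_of_neg (by linarith)
    exact this.eventually_lt_atBot B
  obtain ⟨n₀, hn₀, hn₀B, hn₀N⟩ := (h.and_eventually hlarge).exists
  have hSn₀ : S n₀ < B := by rw [hSn]; linarith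
  obtain ⟨n, hn, hmin⟩ := Finset.exists_min_image (Finset.Icc N n₀) S
    ⟨n₀, Finset.mem_Icc.2 ⟨(le_max_left _ _).trans hn₀N, le_rfl⟩⟩
  rw [Finset.mem_Icc] at hn
  have hnN₁ : N₁ < n := by
    by_contra hcon
    have h1 := hB n (not_lt.1 hcon)
    have h2 := hmin n₀ (Finset.mem_Icc.2 ⟨(le_max_left _ _).trans hn₀N, le_rfl⟩)
    linarith
  refine ⟨n, ((le_max_right N N').trans hnN₁.le), hn.1, fun m hm hmn => ?_⟩
  have h1 := hmin m (Finset.mem_Icc.2 ⟨hm, hmn.trans hn.2⟩)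
  have h2 : ∑ i ∈ Finset.Ico m n, (a i + c / 2) = S n - S m :=
    Finset.sum_Ico_eq_sub _ hmn
  rw [Finset.sum_add_distrib, Finset.sum_const, Nat.card_Ico, nsmul_eq_mul] at h2
  nlinarith

end

/-! ### Disks that become large at hyperbolic times -/

section

theorem sum_pow_sub_le {x : ℝ} (hx0 : 0 ≤ x) (hx1 : x < 1) (n : ℕ) :
    ∑ i ∈ Finset.range n, x ^ (n - i) ≤ (1 - x)⁻¹ := by
  calc ∑ i ∈ Finset.range n, x ^ (n - i) ≤ ∑ i ∈ Finset.range n, x ^ (n - 1 - i) := by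
        refine Finset.sum_le_sum fun i hi => pow_le_pow_of_le_one hx0 hx1.le (by omega)
    _ = ∑ i ∈ Finset.range n, x ^ i := Finset.sum_range_reflect (fun i => x ^ i) n
    _ ≤ ∑' i, x ^ i := (summable_geometric_of_lt_one hx0 hx1).sum_le_tsum _
        fun i _ => pow_nonneg hx0 i
    _ = (1 - x)⁻¹ := tsum_geometric_of_lt_one hx0 hx1

variable {M X Y E ι : Type*} [EMetricSpace M] [NormedAddCommGroup X]
    [NormedSpace ℝ X] [NormedAddCommGroup Y] [NormedSpace ℝ Y] [NormedAddCommGroup E]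
    [NormedSpace ℝ E] {f : M → M} {Λ : Set M}

/-- The coordinates of the `j`-th iterate of the disk `φ`, in the chart centred at the `j`-th
iterate of its point with parameter `p`. -/
def CuAtlas.track (T : CuAtlas X Y E ι f Λ) (φ : X → M) (p : X) (j : ℕ) (p' : X) : X × Y :=
  T.loc (f^[j] (φ p)) (f^[j] (φ p'))

@[simp] theorem CuAtlas.track_self (T : CuAtlas X Y E ι f Λ) (φ : X → M) (p : X) (j : ℕ) :
    T.track φ p j p = 0 := T.loc_self _

/-- A hyperbolic pre-disk around the parameter `p`: a set `V` of parameters whose `n`-th iterate is a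
graph over the ball of radius `δ` around `f^n (φ p)`, such that the iterates between the times `N`
and `n` are graphs of slope at most `η` which are contracted backwards at the rate `τ`, and such that
`f^n` has distortion at most `K` on `V`. -/
structure PreDisk [MeasurableSpace X] (T : CuAtlas X Y E ι f Λ) (μ : Measure X) (φ : X → M) (p : X)
    (N n : ℕ) (δ τ η : ℝ) (K : ℝ≥0∞) (V : Set X) : Prop where
  mem : p ∈ V
  mem_source : ∀ p' ∈ V, ∀ j, N ≤ j → j ≤ n → f^[j] (φ p') ∈ T.source (T.idx (f^[j] (φ p)))
  norm_le : ∀ p' ∈ V, ∀ j, N ≤ j → j ≤ n → ‖T.track φ p j p'‖ ≤ δ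
  slope : ∀ p' ∈ V, ∀ p'' ∈ V, ∀ j, N ≤ j → j ≤ n →
    ‖(T.track φ p j p').2 - (T.track φ p j p'').2‖ ≤
      η * ‖(T.track φ p j p').1 - (T.track φ p j p'').1‖
  contraction : ∀ p' ∈ V, ∀ p'' ∈ V, ∀ j, N ≤ j → j ≤ n →
    ‖T.track φ p j p' - T.track φ p j p''‖ ≤
      τ ^ (n - j) * ‖(T.track φ p n p').1 - (T.track φ p n p'').1‖
  image : (fun p' => (T.track φ p n p').1) '' V = Metric.closedBall 0 δ
  lipschitz : ∃ c : ℝ, ∀ p' ∈ V, ∀ p'' ∈ V,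
    ‖p' - p''‖ ≤ c * ‖(T.track φ p n p').1 - (T.track φ p n p'').1‖
  distortion : ∃ m : ℝ≥0∞, m ≠ 0 ∧ m ≠ ⊤ ∧ ∀ S ⊆ V,
    μ ((fun p' => (T.track φ p n p').1) '' S) ≤ K * (m * μ S) ∧
    m * μ S ≤ K * μ ((fun p' => (T.track φ p n p').1) '' S)
  mem_nhds : ∀ p' ∈ V, ‖(T.track φ p n p').1‖ < δ → V ∈ 𝓝 p'

namespace PreDisk

variable [MeasurableSpace X] {T : CuAtlas X Y E ι f Λ} {μ : Measure X} {φ : X → M} {p : X}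
    {N n : ℕ} {δ τ η : ℝ} {K : ℝ≥0∞} {V : Set X}

/-- The image of a hyperbolic pre-disk is parametrized by its projection to the ball of radius `δ`. -/
theorem exists_inverse (h : PreDisk T μ φ p N n δ τ η K V) :
    ∃ g : X → X, ContinuousOn g (Metric.closedBall 0 δ) ∧
      (∀ v ∈ Metric.closedBall (0 : X) δ, g v ∈ V ∧ (T.track φ p n (g v)).1 = v) ∧
      ∀ q ∈ V, g (T.track φ p n q).1 = q := by
  set g : X → X := Function.invFunOn (fun p' => (T.track φ p n p').1) V
  obtain ⟨c, hc⟩ := h.lipschitz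
  have hg : ∀ v ∈ Metric.closedBall (0 : X) δ, g v ∈ V ∧ (T.track φ p n (g v)).1 = v := by
    intro v hv
    rw [← h.image] at hv
    exact ⟨Function.invFunOn_mem hv, Function.invFunOn_eq hv⟩
  refine ⟨g, ?_, hg, fun q hq => ?_⟩
  · have hL : LipschitzOnWith c.toNNReal g (Metric.closedBall 0 δ) := by
      refine LipschitzOnWith.of_dist_le_mul fun v hv v' hv' => ?_
      have := hc _ (hg v hv).1 _ (hg v' hv').1
      rw [(hg v hv).2, (hg v' hv').2] at this
      rw [dist_eq_norm, dist_eq_norm, Real.coe_toNNReal']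
      exact this.trans (mul_le_mul_of_nonneg_right (le_max_left _ _) (norm_nonneg _))
    exact hL.continuousOn
  · have h1 : (T.track φ p n q).1 ∈ Metric.closedBall (0 : X) δ := by
      rw [← h.image]; exact ⟨q, hq, rfl⟩
    have h2 := hc _ (hg _ h1).1 q hq
    rw [(hg _ h1).2, sub_self, norm_zero, mul_zero] at h2
    exact sub_eq_zero.1 (norm_le_zero_iff.1 h2)

/-- The part of a hyperbolic pre-disk which is mapped onto a smaller ball. -/
def inner (T : CuAtlas X Y E ι f Λ) (φ : X → M) (p : X) (n : ℕ) (V : Set X) (δ' : ℝ) : Set X :=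
  {q ∈ V | ‖(T.track φ p n q).1‖ ≤ δ'}

theorem exists_inner_eq (h : PreDisk T μ φ p N n δ τ η K V) {δ' : ℝ} (hδ' : δ' ≤ δ) :
    ∃ g : X → X, ContinuousOn g (Metric.closedBall 0 δ') ∧
      inner T φ p n V δ' = g '' Metric.closedBall 0 δ' := by
  obtain ⟨g, hg, hg1, hg2⟩ := h.exists_inverse
  refine ⟨g, hg.mono (Metric.closedBall_subset_closedBall hδ'), Subset.antisymm ?_ ?_⟩
  · rintro q ⟨hq, hq'⟩
    exact ⟨_, by simpa using hq', hg2 q hq⟩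
  · rintro _ ⟨v, hv, rfl⟩
    have := hg1 v (Metric.closedBall_subset_closedBall hδ' hv)
    exact ⟨this.1, by rw [this.2]; simpa using hv⟩

theorem inner_self (h : PreDisk T μ φ p N n δ τ η K V) : inner T φ p n V δ = V := by
  refine Subset.antisymm (fun q hq => hq.1) fun q hq => ⟨hq, ?_⟩
  have : (T.track φ p n q).1 ∈ Metric.closedBall (0 : X) δ := by
    rw [← h.image]; exact ⟨q, hq, rfl⟩
  simpa using this

theorem isCompact_inner [FiniteDimensional ℝ X] (h : PreDisk T μ φ p N n δ τ η K V) {δ' : ℝ}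
    (hδ' : δ' ≤ δ) : IsCompact (inner T φ p n V δ') := by
  obtain ⟨g, hg, hgV⟩ := h.exists_inner_eq hδ'
  have := FiniteDimensional.proper_real X
  rw [hgV]
  exact (isCompact_closedBall _ _).image_of_continuousOn hg

theorem isPreconnected_inner (h : PreDisk T μ φ p N n δ τ η K V) {δ' : ℝ} (hδ' : δ' ≤ δ) :
    IsPreconnected (inner T φ p n V δ') := by
  obtain ⟨g, hg, hgV⟩ := h.exists_inner_eq hδ'
  rw [hgV]
  exact (convex_closedBall _ _).isPreconnected.image g hg

theorem image_inner (h : PreDisk T μ φ p N n δ τ η K V) {δ' : ℝ} (hδ' : δ' ≤ δ) :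
    (fun q => (T.track φ p n q).1) '' inner T φ p n V δ' = Metric.closedBall 0 δ' := by
  obtain ⟨g, -, hg1, -⟩ := h.exists_inverse
  refine Subset.antisymm ?_ fun v hv => ?_
  · rintro _ ⟨q, hq, rfl⟩
    simpa using hq.2
  · have := hg1 v (Metric.closedBall_subset_closedBall hδ' hv)
    exact ⟨g v, ⟨this.1, by rw [this.2]; simpa using hv⟩, this.2⟩

/-- A hyperbolic pre-disk is not much larger than its inner part. -/
theorem measure_mul_le (h : PreDisk T μ φ p N n δ τ η K V) {δ' : ℝ} (hδ' : δ' ≤ δ) :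
    μ V * μ (Metric.closedBall 0 δ') ≤
      K * K * μ (Metric.closedBall 0 δ) * μ (inner T φ p n V δ') := by
  obtain ⟨m, hm0, hm1, hm⟩ := h.distortion
  have h1 := (hm V subset_rfl).2
  have h2 := (hm (inner T φ p n V δ') (fun q hq => hq.1)).1
  rw [h.image] at h1
  rw [h.image_inner hδ'] at h2
  have h3 : m * (μ V * μ (Metric.closedBall 0 δ')) ≤
      m * (K * K * μ (Metric.closedBall 0 δ) * μ (inner T φ p n V δ')) := by
    calc m * (μ V * μ (Metric.closedBall 0 δ')) = (m * μ V) * μ (Metric.closedBall 0 δ') := by ring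
      _ ≤ (K * μ (Metric.closedBall 0 δ)) * (K * (m * μ (inner T φ p n V δ'))) := by gcongr
      _ = _ := by ring
  rwa [ENNReal.mul_le_mul_iff_right hm0 hm1] at h3

end PreDisk

/-- Points with a definite rate of expansion have arbitrarily small hyperbolic pre-disks, whose
images have a size and a distortion that only depend on the rate. -/
theorem CuAtlas.exists_preDisk [Nontrivial X] [FiniteDimensional ℝ X] [MeasurableSpace X]
    [BorelSpace X] (T : CuAtlas X Y E ι f Λ) (μ : Measure X) [μ.IsAddHaarMeasure]
    (hinv : MapsTo f Λ Λ) (hf : Continuous f) {c₀ s : ℝ} (hc₀ : 0 < c₀) (hs : 0 < s)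
    (hs1 : T.C ^ 2 * s ≤ 1) :
    ∃ δ₀ > 0, ∃ τ : ℝ, 0 < τ ∧ τ < 1 ∧ ∃ K : ℝ≥0∞, K ≠ ⊤ ∧ ∀ δ, 0 < δ → δ ≤ δ₀ →
      ∀ (φ : X → M) (p : X) (N : ℕ), φ p ∈ Λ → (∀ᶠ p' in 𝓝 p, ContinuousAt φ p') →
      (∃ᶠ n : ℕ in atTop, ∑ i ∈ Finset.range n,
        Real.log ‖((T.A (f^[i] (φ p))).symm : X →L[ℝ] X)‖ ≤ -c₀ * n) →
      ∀ (G : X ≃L[ℝ] X) (Z : X →L[ℝ] Y),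
      HasStrictFDerivAt (T.track φ p N) ((G : X →L[ℝ] X).prod Z) p →
      (∀ e, T.nY (f^[N] (φ p)) (Z e) ≤ s / 2 * T.nX (f^[N] (φ p)) (G e)) →
      ∀ U ∈ 𝓝 p, ∀ N', ∃ n ≥ N', N ≤ n ∧ ∃ V ⊆ U,
        PreDisk T μ φ p N n δ τ (T.C ^ 2 * s) K V := by
  have hC := T.one_le
  have hC0 : 0 < T.C := by linarith
  have hlam := T.lam_lt
  have hexp1 : Real.exp (-(c₀ / 4)) < 1 := by rw [Real.exp_lt_one_iff]; linarith
  -- `κ₀` bounds the nonlinearity of one step; it costs at most half of the expansion.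
  obtain ⟨κ₀, hκ₀, hκ1, hκ2, hκ3⟩ : ∃ κ₀ > 0, T.C * κ₀ ≤ 1 / 2 ∧
      4 * T.C ^ 5 * κ₀ ≤ (1 - T.lam) * s ∧ T.C * κ₀ ≤ 1 - Real.exp (-(c₀ / 4)) := by
    have hpos2 : 0 < (1 - T.lam) * s := mul_pos (by linarith) hs
    refine ⟨min (1 / 2 / T.C) (min ((1 - T.lam) * s / (4 * T.C ^ 5))
      ((1 - Real.exp (-(c₀ / 4))) / T.C)), ?_, ?_, ?_, ?_⟩
    · refine lt_min (by positivity) (lt_min (by positivity) (div_pos (by linarith) hC0))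
    · rw [mul_comm, ← le_div_iff₀ hC0]; exact min_le_left _ _
    · rw [mul_comm, ← le_div_iff₀ (by positivity)]
      exact (min_le_right _ _).trans (min_le_left _ _)
    · rw [mul_comm, ← le_div_iff₀ hC0]; exact (min_le_right _ _).trans (min_le_right _ _)
  obtain ⟨δ₀, hδ₀, hδ₀r, hδ₀κ⟩ := T.exists_pos_le hκ₀
  set τ := Real.exp (-(c₀ / 4)) with hτ
  have hτ0 : 0 < τ := Real.exp_pos _
  have hτα0 : 0 ≤ τ ^ T.α := by positivity
  have hτα1 : τ ^ T.α < 1 := Real.rpow_lt_one hτ0.le hexp1 T.α_pos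
  set d := Module.finrank ℝ X
  set K₁ : ℝ≥0∞ := ENNReal.ofReal (Real.exp (2 * d * T.C * (κ₀ * (1 - τ ^ T.α)⁻¹)))
  -- The factors `K₁` and `K₂` bound the distortion from time `N` to time `n` and the distortion of the
  -- parametrization of the initial graph.
  set K₂ : ℝ≥0∞ := ENNReal.ofReal (Real.exp d)
  refine ⟨δ₀, hδ₀, τ, hτ0, hexp1, K₁ * K₂,
    ENNReal.mul_ne_top ENNReal.ofReal_ne_top ENNReal.ofReal_ne_top, ?_⟩
  intro δ hδ0 hδ φ p N hp hφ hnue G Z hd hslope U hU N'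
  set x : ℕ → M := fun j => f^[j] (φ p) with hx
  have hxΛ : ∀ j, x j ∈ Λ := fun j => hinv.iterate j hp
  have hxs : ∀ j, f (x j) = x (j + 1) := fun j => (Function.iterate_succ_apply' f j _).symm
  have hst : ∀ j, DominatedStep (T.A (x j)) (T.D (x j)) (T.nX (x j)) (T.nX (x (j + 1)))
      (T.nY (x j)) (T.nY (x (j + 1))) T.C T.lam := fun j => by
    rw [← hxs]; exact T.step _ (hxΛ j)
  set b : ℕ → ℝ := fun j => ‖((T.A (x j)).symm : X →L[ℝ] X)‖ with hb
  have hb0 : ∀ j, 0 < b j := fun j => by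
    have := (T.A (x j)).symm.norm_pos
    exact this
  have hbC : ∀ j, b j ≤ T.C := fun j => (hst j).norm_symm_le
  -- The initial graph, at time `N`.
  have hsrcN : ∀ᶠ p' in 𝓝 p, f^[N] (φ p') ∈ T.source (T.idx (x N)) := by
    have hc : ContinuousAt (fun p' => f^[N] (φ p')) p :=
      (hf.iterate N).continuousAt.comp hφ.self_of_nhds
    exact hc.preimage_mem_nhds ((T.isOpen_source _).mem_nhds
      (T.dom_subset_source _ (T.mem_dom_idx _ (hxΛ N))))
  set bG := ‖(G.symm : X →L[ℝ] X)‖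
  have hbG0 : 0 ≤ bG := norm_nonneg _
  obtain ⟨ρ₀, hρ₀, V₀, hV₀, hV₀U, Kb, hV₀s, hV₀G, hV₀K, hV₀surj⟩ :=
    exists_graph_nhds (w := T.track φ p N) hd (T.track_self φ p N) hC0.le hs
      (hst N).nX_le (hst N).le_nX (hst N).nY_le hslope (κ := 1 / (2 * (bG + 1))) (by positivity)
      (Filter.inter_mem hU (Filter.inter_mem hφ hsrcN))
  obtain ⟨t, ht0, ht⟩ := Metric.mem_nhds_iff.1 hV₀
  -- A hyperbolic time `n`, so late that the initial radius `ρ 0 ≤ δ * τ ^ (n - N)` is small.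
  have hlarge : ∀ᶠ n : ℕ in atTop, δ * τ ^ (n - N) ≤ ρ₀ ∧ (|Kb| + 1) * (δ * τ ^ (n - N)) < t := by
    have h1 : Tendsto (fun n : ℕ => δ * τ ^ (n - N)) atTop (𝓝 0) := by
      have := (tendsto_pow_atTop_nhds_zero_of_lt_one hτ0.le hexp1).const_mul δ
      rw [mul_zero] at this
      exact this.comp (tendsto_sub_atTop_nat N)
    have h2 : Tendsto (fun n : ℕ => (|Kb| + 1) * (δ * τ ^ (n - N))) atTop (𝓝 0) := by
      simpa using h1.const_mul (|Kb| + 1)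
    exact ((h1.eventually_lt_const hρ₀).mono fun _ h => h.le).and (h2.eventually_lt_const ht0)
  obtain ⟨N₁, hN₁⟩ := eventually_atTop.1 hlarge
  obtain ⟨n, hnN', hNn, hhyp⟩ := exists_hyperbolic_time hc₀ hnue N (max N' N₁)
  obtain ⟨hn1, hn2⟩ := hN₁ n ((le_max_right _ _).trans hnN')
  refine ⟨n, (le_max_left _ _).trans hnN', hNn, ?_⟩
  set n' := n - N with hn'
  have hNn' : N + n' = n := by omega
  -- The radii are obtained by going back from `ρ n' = δ`. Since `n` is a hyperbolic time for the rate
  -- `c₀ / 2`, of which the nonlinearity costs at most `c₀ / 4`, they decay like `τ ^ (n' - i)`.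
  set ex : ℕ → ℝ := fun i => (b (N + i))⁻¹ - κ₀ with hex
  have hex1 : ∀ i, Real.exp (-Real.log (b (N + i)) - c₀ / 4) ≤ ex i := by
    intro i
    have h1 := hb0 (N + i)
    rw [sub_eq_add_neg, Real.exp_add, Real.exp_neg, Real.exp_log h1]
    have h2 : b (N + i) * κ₀ ≤ 1 - Real.exp (-(c₀ / 4)) :=
      (mul_le_mul_of_nonneg_right (hbC _) hκ₀.le).trans hκ3
    have h3 : ex i = (b (N + i))⁻¹ * (1 - b (N + i) * κ₀) := by
      simp only [hex]; field_simp
    rw [h3]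
    gcongr
    linarith
  have hexpos : ∀ i, 0 < ex i := fun i => (Real.exp_pos _).trans_le (hex1 i)
  set ρ : ℕ → ℝ := fun i => δ / ∏ j ∈ Finset.Ico i n', ex j with hρdef
  have hprod : ∀ i, 0 < ∏ j ∈ Finset.Ico i n', ex j := fun i => Finset.prod_pos fun j _ => hexpos j
  have hρpos : ∀ i, 0 < ρ i := fun i => div_pos hδ0 (hprod i)
  have hρn : ρ n' = δ := by simp [hρdef]
  have hρle : ∀ i ≤ n', ρ i ≤ δ * τ ^ (n' - i) := by
    intro i hi
    have h1 : Real.exp (c₀ / 4 * (n' - i : ℕ)) ≤ ∏ j ∈ Finset.Ico i n', ex j := by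
      calc Real.exp (c₀ / 4 * (n' - i : ℕ))
          ≤ Real.exp (∑ j ∈ Finset.Ico i n', (-Real.log (b (N + j)) - c₀ / 4)) := by
            apply Real.exp_le_exp.2
            have h2 := hhyp (N + i) (by omega) (by omega)
            have h3 : ∑ k ∈ Finset.Ico (N + i) n, Real.log (b k) =
                ∑ j ∈ Finset.Ico i n', Real.log (b (N + j)) := by
              rw [← hNn', add_comm N i, add_comm N n', ← Finset.sum_Ico_add' (fun k => Real.log (b k))]
              simp only [add_comm]
            rw [Finset.sum_sub_distrib, Finset.sum_neg_distrib, Finset.sum_const, Nat.card_Ico,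
              nsmul_eq_mul, ← h3]
            have h4 : n - (N + i) = n' - i := by omega
            rw [h4] at h2
            have h2' : ∑ k ∈ Finset.Ico (N + i) n, Real.log (b k) ≤ -(c₀ / 2) * (n' - i : ℕ) := h2
            linarith
        _ = ∏ j ∈ Finset.Ico i n', Real.exp (-Real.log (b (N + j)) - c₀ / 4) := Real.exp_sum _ _
        _ ≤ _ := Finset.prod_le_prod (fun j _ => (Real.exp_pos _).le) fun j _ => hex1 j
    calc ρ i ≤ δ / Real.exp (c₀ / 4 * (n' - i : ℕ)) := by
          exact div_le_div_of_nonneg_left hδ0.le (Real.exp_pos _) h1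
      _ = δ * τ ^ (n' - i) := by
        rw [hτ, ← Real.exp_nat_mul, div_eq_mul_inv, ← Real.exp_neg]
        congr 2; ring
  have hρδ : ∀ i ≤ n', ρ i ≤ δ := fun i hi =>
    (hρle i hi).trans (mul_le_of_le_one_right hδ0.le (pow_le_one₀ hτ0.le hexp1.le))
  have hρsucc : ∀ i < n', ρ (i + 1) = ex i * ρ i := by
    intro i hi
    simp only [hρdef]
    rw [Finset.prod_eq_prod_Ico_succ_bot hi]
    have := (hexpos i).ne'
    have := (hprod (i + 1)).ne'
    field_simp
  set κ : ℕ → ℝ := fun i => T.C ^ 4 * ρ i ^ T.α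
  have hκn : ∀ i, 0 ≤ κ i := fun i => by have := hρpos i; positivity
  -- The nonlinearity decays geometrically away from time `n`, so that its sum is bounded.
  have hκb : ∀ i ≤ n', κ i ≤ κ₀ * (τ ^ T.α) ^ (n' - i) := by
    intro i hi
    calc κ i ≤ T.C ^ 4 * (δ₀ * τ ^ (n' - i)) ^ T.α := by
          have h2 : ρ i ≤ δ₀ * τ ^ (n' - i) := (hρle i hi).trans (by gcongr)
          have := T.α_pos.le
          exact mul_le_mul_of_nonneg_left (Real.rpow_le_rpow (hρpos i).le h2 this) (by positivity)
      _ = T.C ^ 4 * δ₀ ^ T.α * (τ ^ T.α) ^ (n' - i) := by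
        rw [Real.mul_rpow hδ₀.le (by positivity), ← Real.rpow_natCast_mul hτ0.le,
          ← Real.rpow_mul_natCast hτ0.le, mul_comm T.α]
        ring
      _ ≤ _ := by gcongr
  have hκle : ∀ i ≤ n', κ i ≤ κ₀ := fun i hi =>
    (hκb i hi).trans (mul_le_of_le_one_right hκ₀.le (pow_le_one₀ hτα0 hτα1.le))
  set w : ℕ → X → X × Y := fun i => T.track φ p (N + i)
  -- Points whose coordinates are small up to time `i` stay in the domains of the charts.
  have hsrc : ∀ p' ∈ V₀, ∀ i ≤ n', (∀ j < i, ‖w j p'‖ ≤ ρ j) →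
      f^[N + i] (φ p') ∈ T.source (T.idx (x (N + i))) := by
    intro p' hp' i
    induction i with
    | zero => exact fun _ _ => (hV₀U hp').2.2
    | succ i ih =>
      intro hi hj
      have h1 := ih (by omega) fun j hji => hj j (by omega)
      have h2 := T.map_mem_of_coord (c' := T.idx (x (N + i + 1))) (T.mem_dom_idx _ (hxΛ (N + i)))
        (by rw [hxs]; exact T.mem_dom_idx _ (hxΛ _)) (ρ := δ₀) hδ₀r h1
        ((hj i (by omega)).trans ((hρδ i (by omega)).trans hδ))
      rw [← Function.iterate_succ_apply' f] at h2
      exact h2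
  have hgo : GraphOrbit w (fun i => T.A (x (N + i))) (fun i => T.D (x (N + i)))
      (fun i => T.nX (x (N + i))) (fun i => T.nY (x (N + i))) T.C T.lam s κ₀ κ ρ V₀ p n' := by
    refine ⟨fun i _ => hst (N + i), hC, fun i _ => T.le_nY _ (hxΛ _), fun i _ => (hst (N + i)).nX_le,
      hs.le, hs1, fun i _ => hκn i, fun i hi => hκle i hi.le, hκ1, hκ2, fun i _ => (hρpos i).le,
      hρsucc, mem_of_mem_nhds hV₀, fun i _ => T.track_self _ _ _, ?_, hV₀s, ?_⟩
    · intro i hi q hq q' hq' hj hj'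
      have h1 := hsrc q hq i hi.le fun j hji => hj j hji.le
      have h2 := hsrc q' hq' i hi.le fun j hji => hj' j hji.le
      have h3 := T.coord_approx (c' := T.idx (x (N + i + 1))) (T.mem_dom_idx _ (hxΛ (N + i)))
        (by rw [hxs]; exact T.mem_dom_idx _ (hxΛ _)) (ρ := ρ i) (hρpos i).le
        ((mul_le_mul_of_nonneg_left ((hρδ i hi.le).trans hδ) hC0.le).trans hδ₀r) h1 h2
        (hj i le_rfl) (hj' i le_rfl)
      rw [hxs, ← Function.iterate_succ_apply' f, ← Function.iterate_succ_apply' f] at h3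
      exact h3
    · refine (Metric.closedBall_subset_closedBall ?_).trans hV₀surj
      exact (hρle 0 (Nat.zero_le _)).trans (by simpa using hn1)
  set V := trackSet w V₀ ρ n' with hV
  have hwn : w n' = T.track φ p n := by simp only [w, hNn']
  have hVV₀ : V ⊆ V₀ := fun q hq => hq.1
  have hlip : ∀ q ∈ V, ∀ q' ∈ V,
      ‖q - q'‖ ≤ (|Kb| * (ρ 0 / δ)) * ‖(T.track φ p n q).1 - (T.track φ p n q').1‖ := by
    intro q hq q' hq'
    have h1 := hgo.backward_contraction (Nat.zero_le n') le_rfl hq hq'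
    rw [hρn, hwn] at h1
    have h2 : ‖q - q'‖ ≤ |Kb| * ‖(w 0 q).1 - (w 0 q').1‖ :=
      (hV₀K q (hVV₀ hq) q' (hVV₀ hq')).trans
        (mul_le_mul_of_nonneg_right (le_abs_self _) (norm_nonneg _))
    have h3 : ‖(w 0 q).1 - (w 0 q').1‖ ≤
        ρ 0 / δ * ‖(T.track φ p n q).1 - (T.track φ p n q').1‖ := by
      rw [div_mul_eq_mul_div, le_div_iff₀ hδ0]; linarith
    calc _ ≤ |Kb| * ‖(w 0 q).1 - (w 0 q').1‖ := h2
      _ ≤ |Kb| * (ρ 0 / δ * ‖(T.track φ p n q).1 - (T.track φ p n q').1‖) := by gcongr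
      _ = _ := by ring
  have himage : (fun p' => (T.track φ p n p').1) '' V = Metric.closedBall 0 δ := by
    have := hgo.image_eq le_rfl
    rw [hwn, hρn] at this
    exact this
  have hpV : p ∈ V := hgo.base_mem le_rfl
  refine ⟨V, fun q hq => (hV₀U hq.1).1, ?_⟩
  refine ⟨hpV, ?_, ?_, ?_, ?_, himage, ⟨_, hlip⟩, ?_, ?_⟩
  · intro q hq j hNj hjn
    have := hsrc q (hVV₀ hq) (j - N) (by omega) fun i hi => hgo.norm_le le_rfl hq i (by omega)
    rwa [show N + (j - N) = j by omega] at this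
  · intro q hq j hNj hjn
    have := (hgo.norm_le le_rfl hq (j - N) (by omega)).trans (hρδ _ (by omega))
    simpa only [w, show N + (j - N) = j by omega] using this
  · intro q hq q' hq' j hNj hjn
    have := hgo.norm_snd_le_slope (i := j - N) (by omega)
      (trackSet_antitone w V₀ ρ (by omega) hq) (trackSet_antitone w V₀ ρ (by omega) hq')
    simpa only [w, show N + (j - N) = j by omega] using this
  · intro q hq q' hq' j hNj hjn
    have h1 := hgo.norm_sub_eq (i := j - N) (by omega)
      (trackSet_antitone w V₀ ρ (by omega) hq) (trackSet_antitone w V₀ ρ (by omega) hq')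
    have h2 := hgo.backward_contraction (show j - N ≤ n' by omega) le_rfl hq hq'
    rw [hρn, hwn] at h2
    simp only [w, show N + (j - N) = j by omega] at h1 h2
    rw [h1]
    have h3 := hρle (j - N) (by omega)
    rw [show n' - (j - N) = n - j by omega] at h3
    have h4 : δ * ‖(T.track φ p j q).1 - (T.track φ p j q').1‖ ≤
        δ * (τ ^ (n - j) * ‖(T.track φ p n q).1 - (T.track φ p n q').1‖) := by
      refine h2.trans ?_
      rw [← mul_assoc]
      gcongr
    exact le_of_mul_le_mul_left h4 hδ0
  · obtain ⟨m, hm0, hm1, hm⟩ := hgo.distortion μ n' le_rfl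
    have hbκ : bG * (1 / (2 * (bG + 1))) ≤ 1 / 2 := by
      rw [mul_one_div, div_le_div_iff₀ (by positivity) (by norm_num)]; linarith
    set t' := ENNReal.ofReal |LinearMap.det ((G : X ≃L[ℝ] X) : X →ₗ[ℝ] X)|
    refine ⟨m * t', ?_, ENNReal.mul_ne_top hm1 ENNReal.ofReal_ne_top, fun S hS => ?_⟩
    · refine mul_ne_zero hm0 ?_
      simp only [t', ne_eq, ENNReal.ofReal_eq_zero, not_le, abs_pos]
      exact (LinearEquiv.isUnit_det' G.toLinearEquiv).ne_zero
    obtain ⟨h1, h2⟩ := hm S hS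
    obtain ⟨h3, h4⟩ := addHaar_image_near_linear μ S G id (fun q => (w 0 q).1) (C := bG) le_rfl
      (κ := 1 / (2 * (bG + 1))) (by positivity) hbκ
      (fun q hq q' hq' => hV₀G q (hVV₀ (hS hq)) q' (hVV₀ (hS hq')))
    rw [image_id] at h3 h4
    have hsum : ENNReal.ofReal (Real.exp (2 * d * T.C * ∑ j ∈ Finset.range n', κ j)) ≤ K₁ := by
      apply ENNReal.ofReal_le_ofReal
      apply Real.exp_le_exp.2
      have : ∑ j ∈ Finset.range n', κ j ≤ κ₀ * (1 - τ ^ T.α)⁻¹ := by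
        calc ∑ j ∈ Finset.range n', κ j ≤ ∑ j ∈ Finset.range n', κ₀ * (τ ^ T.α) ^ (n' - j) :=
              Finset.sum_le_sum fun j hj => hκb j (Finset.mem_range.1 hj).le
          _ = κ₀ * ∑ j ∈ Finset.range n', (τ ^ T.α) ^ (n' - j) := by rw [Finset.mul_sum]
          _ ≤ _ := by gcongr; exact sum_pow_sub_le hτα0 hτα1 n'
      gcongr
    have hK₂ : ENNReal.ofReal (Real.exp (2 * d * bG * (1 / (2 * (bG + 1))))) ≤ K₂ := by
      apply ENNReal.ofReal_le_ofReal
      apply Real.exp_le_exp.2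
      calc (2 * d * bG * (1 / (2 * (bG + 1)))) = 2 * d * (bG * (1 / (2 * (bG + 1)))) := by ring
        _ ≤ 2 * d * (1 / 2) := by gcongr
        _ = d := by ring
    rw [hwn] at h1 h2
    constructor
    · calc _ ≤ K₁ * (m * μ ((fun q => (w 0 q).1) '' S)) := h1.trans (by gcongr)
        _ ≤ K₁ * (m * (K₂ * (t' * μ S))) := by
          gcongr
          exact h3.trans (by gcongr)
        _ = _ := by ring
    · calc m * t' * μ S = m * (t' * μ S) := by ring
        _ ≤ m * (K₂ * μ ((fun q => (w 0 q).1) '' S)) := by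
          have h5 : t' * μ S ≤ K₂ * μ ((fun q => (w 0 q).1) '' S) := h4.trans (by gcongr)
          gcongr
        _ = K₂ * (m * μ ((fun q => (w 0 q).1) '' S)) := by ring
        _ ≤ K₂ * (K₁ * μ ((fun p' => (T.track φ p n p').1) '' S)) := by
          have h5 : m * μ ((fun q => (w 0 q).1) '' S) ≤
              K₁ * μ ((fun p' => (T.track φ p n p').1) '' S) := h2.trans (by gcongr)
          gcongr
        _ = _ := by ring
  · intro q hq hqδ
    have hV₀q : V₀ ∈ 𝓝 q := by
      refine Filter.mem_of_superset (Metric.isOpen_ball.mem_nhds ?_) ht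
      rw [mem_ball_iff_norm]
      have h1 := hV₀K q (hVV₀ hq) p (mem_of_mem_nhds hV₀)
      rw [T.track_self, Prod.fst_zero, sub_zero] at h1
      have h2 : ‖(T.track φ p N q).1‖ ≤ δ * τ ^ n' := by
        have := (hq.2 0 (Nat.zero_le _)).trans (hρle 0 (Nat.zero_le _))
        simpa [w] using this
      calc ‖q - p‖ ≤ Kb * ‖(T.track φ p N q).1‖ := h1
        _ ≤ (|Kb| + 1) * (δ * τ ^ n') := by
          gcongr
          exact (le_abs_self _).trans (by linarith)
        _ < t := hn2
    -- The conditions on the coordinates which define `V` are strict at a point mapped to the open ball,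
    -- by backward contraction, hence they hold nearby.
    have hlt : ∀ j ≤ n', ∀ᶠ q' in 𝓝 q, ‖(w j q').1‖ ≤ ρ j := by
      intro j hj
      have h1 : ‖(w j q).1‖ < ρ j := by
        have := hgo.backward_contraction hj le_rfl hq hpV
        rw [hρn, hgo.base j hj, hgo.base n' le_rfl, Prod.fst_zero, sub_zero, sub_zero, hwn] at this
        have h2 : ρ j * ‖(T.track φ p n q).1‖ < ρ j * δ := by
          have := hρpos j; gcongr
        have h3 : δ * ‖(w j q).1‖ < δ * ρ j := by linarith
        exact lt_of_mul_lt_mul_left h3 hδ0.le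
      have hs := hsrc q (hVV₀ hq) j hj fun i hi => hgo.norm_le le_rfl hq i (by omega)
      have hc : ContinuousAt (fun q' => (w j q').1) q := by
        have h1 : ContinuousAt (fun q' => f^[N + j] (φ q')) q :=
          (hf.iterate _).continuousAt.comp (hV₀U (hVV₀ hq)).2.1
        have h2 : ContinuousAt (w j) q :=
          ContinuousAt.comp (f := fun q' => f^[N + j] (φ q')) (T.continuousAt_coord _ _ hs) h1
        exact continuous_fst.continuousAt.comp h2
      have := hc.norm.eventually_lt_const h1
      exact this.mono fun _ h => h.le
    have hall : ∀ᶠ q' in 𝓝 q, ∀ j ∈ Finset.range (n' + 1), ‖(w j q').1‖ ≤ ρ j :=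
      (Filter.eventually_all_finset _).2 fun j hj => hlt j (by
        have := Finset.mem_range.1 hj; omega)
    filter_upwards [hV₀q, hall] with q' h1 h2
    exact ⟨h1, fun j hj => h2 j (Finset.mem_range.2 (by omega))⟩

end

/-! ### Density of the invariant set in some of these disks -/

section

variable {M X Y E ι : Type*} [EMetricSpace M] [NormedAddCommGroup X]
    [NormedSpace ℝ X] [NormedAddCommGroup Y] [NormedSpace ℝ Y] [NormedAddCommGroup E]
    [NormedSpace ℝ E] {f : M → M} {Λ : Set M}

/-- If the inner parts of two hyperbolic pre-disks meet, the one with the larger hyperbolic time lies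
inside the other pre-disk: its image at the smaller time is small. -/
theorem CuAtlas.exists_inner_subset [FiniteDimensional ℝ X] [MeasurableSpace X]
    (T : CuAtlas X Y E ι f Λ) (μ : Measure X)
    (hinv : MapsTo f Λ Λ) {φ : X → M} {N : ℕ} {δ τ η : ℝ} {K : ℝ≥0∞} (hδ : 0 < δ)
    (hδr : T.C * δ ≤ T.r) (hτ0 : 0 ≤ τ) (hτ1 : τ ≤ 1) :
    ∃ δ' > 0, δ' ≤ δ ∧ ∀ p q : X, φ p ∈ Λ → φ q ∈ Λ → ∀ n m : ℕ, N ≤ n → n ≤ m → ∀ V W : Set X,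
      PreDisk T μ φ p N n δ τ η K V → PreDisk T μ φ q N m δ τ η K W →
      (PreDisk.inner T φ p n V δ' ∩ PreDisk.inner T φ q m W δ').Nonempty →
      PreDisk.inner T φ q m W δ' ⊆ V := by
  have hC := T.one_le
  have hC0 : 0 < T.C := by linarith
  obtain ⟨ε', hε', hunif⟩ := T.norm_lt_of_edist (δ / (4 * T.C)) (by positivity)
  refine ⟨min (δ / 4) (ε' / (4 * T.C ^ 2)), by positivity,
    (min_le_left _ _).trans (by linarith), ?_⟩
  set δ' := min (δ / 4) (ε' / (4 * T.C ^ 2)) with hδ'def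
  have hδ'0 : 0 < δ' := by positivity
  have hδ'1 : δ' ≤ δ / 4 := min_le_left _ _
  have hδ'2 : T.C * (T.C * (2 * δ')) < ε' := by
    have : δ' ≤ ε' / (4 * T.C ^ 2) := min_le_right _ _
    rw [le_div_iff₀ (by positivity)] at this
    nlinarith
  intro p q hp hq n m hNn hnm V W hV hW hne
  have hδ'δ : δ' ≤ δ := by linarith
  have hpΛ : f^[n] (φ p) ∈ Λ := hinv.iterate n hp
  have hqΛ : f^[n] (φ q) ∈ Λ := hinv.iterate n hq
  obtain ⟨z, hzV, hzW⟩ := hne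
  have hVc : IsClosed V := by
    have := (hV.isCompact_inner le_rfl).isClosed
    rwa [hV.inner_self] at this
  -- At time `n` the iterate of the inner part of `W` has diameter at most `δ / 4`. The two pre-disks use
  -- different charts, which are compared through the distance of `M`.
  have hdist : ∀ y ∈ PreDisk.inner T φ q m W δ', y ∈ V →
      ‖T.track φ p n y - T.track φ p n z‖ ≤ δ / 4 := by
    intro y hy hyV
    have h1 : ‖T.track φ q n y - T.track φ q n z‖ ≤ 2 * δ' := by
      refine (hW.contraction y hy.1 z hzW.1 n hNn hnm).trans ?_
      have h2 : ‖(T.track φ q m y).1 - (T.track φ q m z).1‖ ≤ 2 * δ' := by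
        refine (norm_sub_le _ _).trans ?_
        linarith [hy.2, hzW.2]
      calc τ ^ (m - n) * ‖(T.track φ q m y).1 - (T.track φ q m z).1‖
          ≤ 1 * (2 * δ') := by
            gcongr
            exact pow_le_one₀ hτ0 hτ1
        _ = _ := one_mul _
    have hdom := T.mem_dom_idx _ hqΛ
    have hdomp := T.mem_dom_idx _ hpΛ
    have h3 : edist (f^[n] (φ y)) (f^[n] (φ z)) < ENNReal.ofReal ε' := by
      refine lt_of_le_of_lt (T.edist_le _ _ hdom _ (hW.mem_source y hy.1 n hNn hnm) _
        (hW.mem_source z hzW.1 n hNn hnm) ?_ ?_) ?_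
      · exact (T.norm_chart_sub_self_le hdom (hW.norm_le y hy.1 n hNn hnm)).trans hδr
      · exact (T.norm_chart_sub_self_le hdom (hW.norm_le z hzW.1 n hNn hnm)).trans hδr
      · apply (ENNReal.ofReal_lt_ofReal_iff hε').2
        refine lt_of_le_of_lt ?_ hδ'2
        gcongr
        exact (T.norm_chart_sub_le hdom _ _).trans (by gcongr; exact h1)
    have h4 := hunif _ _ hdomp _ (hV.mem_source y hyV n hNn le_rfl) _
      (hV.mem_source z hzV.1 n hNn le_rfl)
      ((T.norm_chart_sub_self_le hdomp (hV.norm_le y hyV n hNn le_rfl)).trans hδr)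
      ((T.norm_chart_sub_self_le hdomp (hV.norm_le z hzV.1 n hNn le_rfl)).trans hδr) h3
    refine (T.norm_coord_sub_le hdomp _ _).trans ?_
    calc _ ≤ T.C * (δ / (4 * T.C)) := by gcongr
      _ = δ / 4 := by field_simp
  -- So the connected inner part of `W` cannot meet the boundary of `V`.
  have hint : ∀ y ∈ PreDisk.inner T φ q m W δ', y ∈ V → y ∈ interior V := by
    intro y hy hyV
    refine mem_interior_iff_mem_nhds.2 (hV.mem_nhds y hyV ?_)
    have h1 := (norm_fst_le _).trans (hdist y hy hyV)
    rw [Prod.fst_sub] at h1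
    have h2 := norm_sub_norm_le (T.track φ p n y).1 (T.track φ p n z).1
    have h3 := hzV.2
    linarith
  refine Subset.trans ?_ interior_subset
  refine (hW.isPreconnected_inner hδ'δ).subset_of_closure_inter_subset isOpen_interior
    ⟨z, hzW, hint z hzW hzV.1⟩ ?_
  rintro y ⟨hy1, hy2⟩
  exact hint y hy2 (closure_minimal interior_subset hVc hy1)

/-- Vitali covering by hyperbolic pre-disks: there are late hyperbolic pre-disks whose inner part is
filled by `S` up to an arbitrarily small proportion. -/
theorem CuAtlas.exists_preDisk_measure_diff_lt [FiniteDimensional ℝ X] [MeasurableSpace X]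
    [BorelSpace X] (T : CuAtlas X Y E ι f Λ) (μ : Measure X) [μ.IsAddHaarMeasure]
    (hinv : MapsTo f Λ Λ) {φ : X → M} {S A' : Set X} (hS : MeasurableSet S) (hSfin : μ S ≠ ⊤)
    (hA'S : A' ⊆ S) (hA' : μ A' ≠ 0) (hSΛ : ∀ p ∈ S, φ p ∈ Λ) {N : ℕ} {δ τ η : ℝ} {K : ℝ≥0∞}
    (hK : K ≠ ⊤) (hδ : 0 < δ) (hδr : T.C * δ ≤ T.r) (hτ0 : 0 ≤ τ) (hτ1 : τ ≤ 1)
    (hpre : ∀ p ∈ A', ∀ U ∈ 𝓝 p, ∀ N', ∃ n ≥ N', N ≤ n ∧ ∃ V ⊆ U, PreDisk T μ φ p N n δ τ η K V) :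
    ∃ δ' > 0, δ' ≤ δ ∧ ∀ ε : ℝ≥0∞, ε ≠ 0 → ∀ N', ∃ p ∈ A', ∃ n ≥ N', N ≤ n ∧ ∃ V,
      PreDisk T μ φ p N n δ τ η K V ∧
      μ (PreDisk.inner T φ p n V δ' \ S) < ε * μ (PreDisk.inner T φ p n V δ') := by
  obtain ⟨δ', hδ'0, hδ'δ, hsub⟩ := T.exists_inner_subset μ hinv (φ := φ) (N := N) (τ := τ) (η := η)
    (K := K) hδ hδr hτ0 hτ1
  refine ⟨δ', hδ'0, hδ'δ, fun ε hε N' => ?_⟩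
  set B := μ (Metric.closedBall (0 : X) δ) with hB
  set B' := μ (Metric.closedBall (0 : X) δ') with hB'
  have := FiniteDimensional.proper_real X
  have hBtop : B ≠ ⊤ := (isCompact_closedBall _ _).measure_ne_top
  have hB'0 : B' ≠ 0 := (Metric.measure_closedBall_pos μ _ hδ'0).ne'
  have hB'top : B' ≠ ⊤ := (isCompact_closedBall _ _).measure_ne_top
  by_contra! hcon
  -- A neighbourhood of `S` with so little excess volume that it contradicts the lower bound
  obtain ⟨ε₁, hε₁0, hε₁⟩ : ∃ ε₁ : ℝ≥0∞, ε₁ ≠ 0 ∧ K * K * B * ε₁ < ε * (μ A' * B') := by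
    have h1 : ε * (μ A' * B') ≠ 0 := mul_ne_zero hε (mul_ne_zero hA' hB'0)
    obtain ⟨x, hx0, hx⟩ := ENNReal.exists_nnreal_pos_mul_lt
      (ENNReal.mul_ne_top (ENNReal.mul_ne_top hK hK) hBtop) h1
    exact ⟨x, by simpa using hx0.ne', by rwa [mul_comm]⟩
  obtain ⟨O, hSO, hO, -, hOS⟩ := hS.exists_isOpen_sdiff_lt hSfin hε₁0
  have hpre' : ∀ p : A', ∃ n ≥ N', N ≤ n ∧ ∃ V ⊆ O, PreDisk T μ φ p N n δ τ η K V :=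
    fun p => hpre p p.2 O (hO.mem_nhds (hSO (hA'S p.2))) N'
  choose n hnN' hNn V hVO hV using hpre'
  set W : A' → Set X := fun p => PreDisk.inner T φ p (n p) (V p) δ'
  have hpW : ∀ p : A', (p : X) ∈ W p := fun p =>
    ⟨(hV p).mem, by rw [T.track_self]; simpa using hδ'0.le⟩
  -- The size `2 ^ (-n)` is attributed to a pre-disk of hyperbolic time `n`. The Vitali lemma with the
  -- ratio `3 / 2 < 2` covers each inner part by a pre-disk of no larger hyperbolic time.
  obtain ⟨u, -, hdisj, hcov⟩ := Vitali.exists_disjoint_subfamily_covering_enlargement W univ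
    (fun p => (1 / 2 : ℝ) ^ n p) (3 / 2) (by norm_num) (fun _ _ => by positivity) 1
    (fun _ _ => pow_le_one₀ (by norm_num) (by norm_num)) (fun p _ => ⟨p, hpW p⟩)
  have hWmeas : ∀ p, MeasurableSet (W p) := fun p => ((hV p).isCompact_inner hδ'δ).measurableSet
  have hWpos : ∀ p, μ (W p) ≠ 0 := by
    intro p h0
    have h1 := (hV p).measure_mul_le hδ'δ
    have h2 : μ (V p) ≠ 0 := (Measure.measure_pos_of_mem_nhds μ ((hV p).mem_nhds p (hV p).mem
      (by simpa using hδ))).ne'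
    rw [show μ (PreDisk.inner T φ p (n p) (V p) δ') = 0 from h0, mul_zero, nonpos_iff_eq_zero,
      mul_eq_zero] at h1
    exact h1.elim h2 hB'0
  have hu : u.Countable := by
    have h1 := Measure.countable_meas_pos_of_disjoint_iUnion (μ := μ) (As := fun p : u => W p)
      (fun p => hWmeas p) (fun p q hpq => hdisj p.2 q.2 (fun h => hpq (Subtype.ext h)))
    have h2 : {p : u | 0 < μ (W p)} = univ := eq_univ_of_forall fun p => (hWpos p).bot_lt
    rw [h2, countable_univ_iff] at h1
    exact h1
  have hcovA : A' ⊆ ⋃ p ∈ u, V p := by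
    intro p hp
    obtain ⟨b, hb, ⟨z, hz⟩, hle⟩ := hcov ⟨p, hp⟩ (mem_univ _)
    have hnn : n b ≤ n ⟨p, hp⟩ := by
      by_contra! hlt
      have h1 : (1 / 2 : ℝ) ^ n b ≤ (1 / 2) ^ (n ⟨p, hp⟩ + 1) :=
        pow_le_pow_of_le_one (by norm_num) (by norm_num) hlt
      have h2 : (0 : ℝ) < (1 / 2) ^ n ⟨p, hp⟩ := by positivity
      rw [pow_succ] at h1
      linarith
    have h3 := hsub b p (hSΛ _ (hA'S b.2)) (hSΛ _ (hA'S hp)) (n b) (n ⟨p, hp⟩) (hNn b) hnn (V b)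
      (V ⟨p, hp⟩) (hV b) (hV ⟨p, hp⟩) ⟨z, hz.2, hz.1⟩
    exact mem_biUnion hb (h3 (hpW ⟨p, hp⟩))
  -- The pre-disks `V p` cover `A'`, their measure is controlled by that of the disjoint sets `W p`, and
  -- each of these carries a definite proportion outside of `S`: too much for `O \ S`.
  have hlow : ∀ p : A', ε * μ (W p) ≤ μ (W p \ S) := fun p =>
    hcon p p.2 (n p) (hnN' p) (hNn p) (V p) (hV p)
  have hsum : ∑' p : u, μ (W p \ S) ≤ μ (O \ S) := by
    rw [← measure_biUnion hu (fun p hp q hq hpq => (hdisj hp hq hpq).mono sdiff_subset sdiff_subset)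
      (fun p _ => (hWmeas p).diff hS)]
    refine measure_mono (iUnion₂_subset fun p _ q hq => ⟨hVO p hq.1.1, hq.2⟩)
  have hfin : ε * (μ A' * B') ≤ K * K * B * ε₁ := by
    calc ε * (μ A' * B') ≤ ε * ((∑' p : u, μ (V p)) * B') := by
          gcongr
          exact (measure_mono hcovA).trans (measure_biUnion_le μ hu _)
      _ = ∑' p : u, ε * (μ (V p) * B') := by
        rw [← ENNReal.tsum_mul_right, ← ENNReal.tsum_mul_left]
      _ ≤ ∑' p : u, K * K * B * μ (W p \ S) := by
        refine ENNReal.tsum_le_tsum fun p => ?_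
        calc ε * (μ (V p) * B') ≤ ε * (K * K * B * μ (W p)) :=
              mul_le_mul_right ((hV p).measure_mul_le hδ'δ) ε
          _ = K * K * B * (ε * μ (W p)) := by ring
          _ ≤ _ := by gcongr; exact hlow p
      _ = K * K * B * ∑' p : u, μ (W p \ S) := by rw [ENNReal.tsum_mul_left]
      _ ≤ K * K * B * ε₁ := by gcongr; exact hsum.trans hOS.le
  exact absurd hε₁ (not_lt.2 hfin)

/-- If almost all of the inner part of a hyperbolic pre-disk lies in `S`, the image of `S` is dense in
the image disk, on a definite scale. -/
theorem PreDisk.exists_mem_of_measure_diff_lt [FiniteDimensional ℝ X] [MeasurableSpace X]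
    [BorelSpace X] {T : CuAtlas X Y E ι f Λ} {μ : Measure X} [μ.IsAddHaarMeasure] {φ : X → M} {p : X}
    {N n : ℕ} {δ τ η : ℝ} {K : ℝ≥0∞} {V : Set X} (h : PreDisk T μ φ p N n δ τ η K V) {δ' : ℝ}
    (hδ' : δ' ≤ δ) {S : Set X} {ε : ℝ≥0∞}
    (hS : μ (inner T φ p n V δ' \ S) < ε * μ (inner T φ p n V δ')) {t : ℝ}
    (ht' : t ≤ δ' / 2)
    (hε : ε * (K * K * μ (Metric.closedBall 0 δ')) < μ (Metric.ball 0 t)) {v : X}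
    (hv : ‖v‖ ≤ δ' / 2) : ∃ q ∈ V, q ∈ S ∧ ‖(T.track φ p n q).1 - v‖ < t := by
  by_contra! hcon
  obtain ⟨m, hm0, hm1, hm⟩ := h.distortion
  have hWV : inner T φ p n V δ' ⊆ V := fun q hq => hq.1
  have h1 := (hm (inner T φ p n V δ' \ S) (sdiff_subset.trans hWV)).1
  have h2 := (hm (inner T φ p n V δ') hWV).2
  rw [h.image_inner hδ'] at h2
  -- Otherwise a ball of radius `t` around `v` lies in the image of the small set outside of `S`.
  have h3 : Metric.ball v t ⊆
      (fun q => (T.track φ p n q).1) '' (inner T φ p n V δ' \ S) := by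
    intro v' hv'
    rw [mem_ball_iff_norm] at hv'
    have h4 : v' ∈ Metric.closedBall (0 : X) δ' := by
      rw [mem_closedBall_zero_iff]
      have := norm_sub_norm_le v' v
      linarith
    rw [← h.image_inner hδ'] at h4
    obtain ⟨q, hq, rfl⟩ := h4
    exact ⟨q, ⟨hq, fun hqS => not_lt.2 (hcon q hq.1 hqS) hv'⟩, rfl⟩
  have h5 : μ (Metric.ball 0 t) ≤ ε * (K * K * μ (Metric.closedBall 0 δ')) := by
    calc μ (Metric.ball 0 t) = μ (Metric.ball v t) := (Measure.addHaar_ball_center μ v t).symm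
      _ ≤ K * (m * μ (inner T φ p n V δ' \ S)) := (measure_mono h3).trans h1
      _ ≤ K * (m * (ε * μ (inner T φ p n V δ'))) := by gcongr
      _ = ε * (K * (m * μ (inner T φ p n V δ'))) := by ring
      _ ≤ ε * (K * (K * μ (Metric.closedBall 0 δ'))) := by gcongr
      _ = _ := by ring
  exact absurd hε (not_lt.2 h5)

/-- A disk, parametrized by `X`, which is transverse to the centre-stable direction and
non-uniformly expanding at the parameters in `S`. -/
structure TransverseDisk (T : CuAtlas X Y E ι f Λ) (φ : X → M) (S : Set X) : Prop where
  mem : ∀ p ∈ S, φ p ∈ Λ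
  continuousAt : ∀ p ∈ S, ∀ᶠ p' in 𝓝 p, ContinuousAt φ p'
  hasStrictFDerivAt : ∀ p ∈ S, ∃ (G : X ≃L[ℝ] X) (Z : X →L[ℝ] Y),
    HasStrictFDerivAt (fun p' => T.loc (φ p) (φ p')) ((G : X →L[ℝ] X).prod Z) p
  expanding : ∀ p ∈ S, ∃ c > 0, ∃ᶠ n : ℕ in atTop, ∑ i ∈ Finset.range n,
    Real.log ‖((T.A (f^[i] (φ p))).symm : X →L[ℝ] X)‖ ≤ -c * n

/-- There are hyperbolic pre-disks of uniform size in which the iterates of `Λ` are arbitrarily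
dense. -/
theorem TransverseDisk.exists_dense_preDisk [Nontrivial X] [FiniteDimensional ℝ X]
    [MeasurableSpace X] [BorelSpace X] {T : CuAtlas X Y E ι f Λ} (μ : Measure X)
    [μ.IsAddHaarMeasure] (hinv : MapsTo f Λ Λ) (hf : Continuous f) {φ : X → M} {S : Set X}
    (hφ : TransverseDisk T φ S) (hS : MeasurableSet S) (hSfin : μ S ≠ ⊤) (hS0 : μ S ≠ 0)
    {s : ℝ} (hs : 0 < s) (hs1 : T.C ^ 2 * s ≤ 1) {δ₁ : ℝ} (hδ₁ : 0 < δ₁) :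
    ∃ (δ : ℝ) (δ' : ℝ) (τ : ℝ) (N : ℕ) (K : ℝ≥0∞), 0 < δ ∧ δ ≤ δ₁ ∧ 0 < δ' ∧ δ' ≤ δ ∧
      0 < τ ∧ τ < 1 ∧ ∀ t > 0, ∀ N', ∃ p ∈ S, ∃ n ≥ N', N ≤ n ∧ ∃ V,
        PreDisk T μ φ p N n δ τ (T.C ^ 2 * s) K V ∧
        ∀ v, ‖v‖ ≤ δ' / 2 → ∃ q ∈ V, q ∈ S ∧ ‖(T.track φ p n q).1 - v‖ < t := by
  have hC := T.one_le
  have hC0 : 0 < T.C := by linarith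
  -- The rate of expansion and the starting time can be chosen uniformly on a set of positive measure.
  set A : ℕ × ℕ → Set X := fun k => {p ∈ S |
    (∃ᶠ n : ℕ in atTop, ∑ i ∈ Finset.range n,
      Real.log ‖((T.A (f^[i] (φ p))).symm : X →L[ℝ] X)‖ ≤ -(1 / ((k.1 : ℝ) + 1)) * n) ∧
    ∃ (G : X ≃L[ℝ] X) (Z : X →L[ℝ] Y), HasStrictFDerivAt (T.track φ p k.2) ((G : X →L[ℝ] X).prod Z) p
      ∧ ∀ e, T.nY (f^[k.2] (φ p)) (Z e) ≤ s / 2 * T.nX (f^[k.2] (φ p)) (G e)} with hA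
  have hSA : S ⊆ ⋃ k, A k := by
    intro p hp
    obtain ⟨c, hc, hfreq⟩ := hφ.expanding p hp
    obtain ⟨k, hk⟩ := exists_nat_one_div_lt hc
    obtain ⟨G, Z, hd⟩ := hφ.hasStrictFDerivAt p hp
    obtain ⟨s₀, hs₀, hslope⟩ := T.exists_slope_bound (hφ.mem p hp) G Z
    obtain ⟨N, hN⟩ : ∃ N, T.lam ^ N * s₀ ≤ s / 2 := by
      have := (tendsto_pow_atTop_nhds_zero_of_lt_one T.lam_nonneg T.lam_lt).mul_const s₀
      rw [zero_mul] at this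
      obtain ⟨N, hN⟩ := (this.eventually_lt_const (half_pos hs)).exists
      exact ⟨N, hN.le⟩
    obtain ⟨G', Z', hd', hslope'⟩ := T.hasStrictFDerivAt_iterate hinv (hφ.mem p hp) hd
      (hφ.continuousAt p hp).self_of_nhds hf hslope N
    refine mem_iUnion.2 ⟨(k, N), hp, ?_, G', Z', hd', fun e => (hslope' e).trans ?_⟩
    · refine hfreq.mono fun n hn => hn.trans ?_
      have : (0 : ℝ) ≤ n := n.cast_nonneg
      nlinarith
    · exact mul_le_mul_of_nonneg_right hN (apply_nonneg _ _)
  obtain ⟨⟨k, N⟩, hk⟩ : ∃ k, μ (A k) ≠ 0 := by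
    by_contra! hcon
    exact hS0 (measure_mono_null hSA (measure_iUnion_null hcon))
  obtain ⟨δ₀, hδ₀, τ, hτ0, hτ1, K, hK, hpre⟩ := T.exists_preDisk μ hinv hf
    (c₀ := 1 / ((k : ℝ) + 1)) (by positivity) hs hs1
  set δ := min (min δ₀ δ₁) (T.r / T.C) with hδ
  have hδ0 : 0 < δ := lt_min (lt_min hδ₀ hδ₁) (div_pos T.r_pos hC0)
  have hδr : T.C * δ ≤ T.r := by
    rw [mul_comm, ← le_div_iff₀ hC0]; exact min_le_right _ _
  obtain ⟨δ', hδ'0, hδ'δ, hvit⟩ := T.exists_preDisk_measure_diff_lt μ hinv hS hSfin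
    (A' := A (k, N)) (fun p hp => hp.1) hk hφ.mem (N := N) (η := T.C ^ 2 * s) hK hδ0 hδr hτ0.le
    hτ1.le (fun p hp U hU N' => by
      obtain ⟨hpS, hfreq, G, Z, hd, hslope⟩ := hp
      exact hpre δ hδ0 ((min_le_left _ _).trans (min_le_left _ _)) φ p N (hφ.mem p hpS)
        (hφ.continuousAt p hpS) hfreq G Z hd hslope U hU N')
  refine ⟨δ, δ', τ, N, K, hδ0, (min_le_left _ _).trans (min_le_right _ _), hδ'0, hδ'δ, hτ0, hτ1, ?_⟩
  intro t ht N'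
  have := FiniteDimensional.proper_real X
  set t' := min t (δ' / 2)
  have ht'0 : 0 < t' := lt_min ht (half_pos hδ'0)
  obtain ⟨ε, hε0, hε⟩ := ENNReal.exists_nnreal_pos_mul_lt
    (ENNReal.mul_ne_top (ENNReal.mul_ne_top hK hK)
      (IsCompact.measure_ne_top (μ := μ) (isCompact_closedBall (0 : X) δ')))
    (Metric.measure_ball_pos μ (0 : X) ht'0).ne'
  obtain ⟨p, hp, n, hnN', hNn, V, hV, hVS⟩ := hvit ε (by simpa using hε0.ne') N'
  refine ⟨p, hp.1, n, hnN', hNn, V, hV, fun v hv => ?_⟩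
  obtain ⟨q, hqV, hqS, hq⟩ := hV.exists_mem_of_measure_diff_lt hδ'δ hVS (min_le_right _ _) hε hv
  exact ⟨q, hqV, hqS, hq.trans_le (min_le_left _ _)⟩

end

/-! ### Secants of the invariant set along the disks -/

section

variable {M X Y E ι : Type*} [EMetricSpace M] [NormedAddCommGroup X]
    [NormedSpace ℝ X] [NormedAddCommGroup Y] [NormedSpace ℝ Y] [NormedAddCommGroup E]
    [NormedSpace ℝ E] {f : M → M} {Λ : Set M}

namespace CuAtlas

/-- The projection onto the centre-unstable space along the centre-stable space at `q`, read in the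
chart `c`. -/
def proj (T : CuAtlas X Y E ι f Λ) (c : ι) (q : M) : E →L[ℝ] E :=
  ((T.frame c q : X × Y →L[ℝ] E) ∘L ((ContinuousLinearMap.inl ℝ X Y) ∘L
      (ContinuousLinearMap.fst ℝ X Y))) ∘L ((T.frame c q).symm : E →L[ℝ] X × Y)

variable (T : CuAtlas X Y E ι f Λ)

theorem proj_apply (c : ι) (q : M) (ξ : E) :
    T.proj c q ξ = T.frame c q (((T.frame c q).symm ξ).1, 0) := rfl

theorem sub_proj_apply (c : ι) (q : M) (ξ : E) :
    ξ - T.proj c q ξ = T.frame c q (0, ((T.frame c q).symm ξ).2) := by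
  rw [proj_apply]
  nth_rewrite 1 [← (T.frame c q).apply_symm_apply ξ]
  rw [← map_sub]
  congr 1
  ext <;> simp

theorem norm_sub_proj_le {c : ι} {q : M} (hq : q ∈ T.dom c) (ξ : E) :
    ‖ξ - T.proj c q ξ‖ ≤ T.C * ‖((T.frame c q).symm ξ).2‖ := by
  rw [sub_proj_apply]
  refine (T.frame_le c q hq _).trans (le_of_eq ?_)
  simp [Prod.norm_def]

theorem norm_snd_symm_le {c : ι} {q : M} (hq : q ∈ T.dom c) (ξ : E) :
    ‖((T.frame c q).symm ξ).2‖ ≤ T.C * ‖ξ - T.proj c q ξ‖ := by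
  have h := T.symm_frame_le c q hq (ξ - T.proj c q ξ)
  refine le_trans (le_of_eq ?_) ((norm_snd_le _).trans h)
  rw [sub_proj_apply, ContinuousLinearEquiv.symm_apply_apply]

/-- Uniform continuity of the splitting on `Λ`. -/
theorem exists_norm_proj_sub_le [Finite ι] {ε₀ : ℝ} (hε₀ : 0 < ε₀) :
    ∃ δ > 0, ∀ c, ∀ q ∈ T.dom c, ∀ q' ∈ T.dom c, ‖T.chart c q' - T.chart c q‖ ≤ δ →
      ‖T.proj c q' - T.proj c q‖ ≤ ε₀ := by
  have hC := T.one_le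
  have h1 : ∀ c, ∃ δ > 0, ∀ q ∈ T.dom c, ∀ q' ∈ T.dom c, ‖T.chart c q' - T.chart c q‖ ≤ δ →
      ‖T.proj c q' - T.proj c q‖ ≤ ε₀ := by
    intro c
    have h2 := (T.isCompact_dom c).uniformContinuousOn_of_continuous (T.continuousOn_proj c)
    obtain ⟨ε, hε, h3⟩ := EMetric.uniformContinuousOn_iff.1 h2 (ENNReal.ofReal ε₀)
      (ENNReal.ofReal_pos.2 hε₀)
    obtain ⟨ε', hε', hε'ε⟩ : ∃ ε' > 0, ENNReal.ofReal (T.C * ε') < ε := by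
      have : Tendsto (fun x : ℝ => ENNReal.ofReal (T.C * x)) (𝓝[>] 0) (𝓝 0) := by
        have h : Continuous (fun x : ℝ => ENNReal.ofReal (T.C * x)) :=
          ENNReal.continuous_ofReal.comp (by fun_prop)
        simpa using (h.tendsto 0).mono_left nhdsWithin_le_nhds
      obtain ⟨x, hx, hx0⟩ := ((this.eventually_lt_const hε).and self_mem_nhdsWithin).exists
      exact ⟨x, hx0, hx⟩
    refine ⟨min ε' T.r, lt_min hε' T.r_pos, fun q hq q' hq' hqq' => ?_⟩
    have h4 : edist q' q < ε := by
      refine lt_of_le_of_lt (T.edist_le c q hq q' (T.dom_subset_source c hq') q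
        (T.dom_subset_source c hq) (hqq'.trans (min_le_right _ _)) (by simpa using T.r_pos.le)) ?_
      refine lt_of_le_of_lt (ENNReal.ofReal_le_ofReal ?_) hε'ε
      gcongr
      exact hqq'.trans (min_le_left _ _)
    have h5 := h3 hq' hq h4
    rw [edist_eq_enorm_sub, ← ofReal_norm, ENNReal.ofReal_lt_ofReal_iff hε₀] at h5
    exact h5.le
  choose δ hδ h using h1
  cases nonempty_fintype ι
  rcases isEmpty_or_nonempty ι with hι | hι
  · exact ⟨1, one_pos, fun c => hι.elim c⟩
  refine ⟨Finset.univ.inf' Finset.univ_nonempty δ, (Finset.lt_inf'_iff _).2 fun c _ => hδ c,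
    fun c q hq q' hq' hqq' => h c q hq q' hq' (hqq'.trans (Finset.inf'_le _ (Finset.mem_univ c)))⟩

/-- A pair of points on a graph of small slope with respect to the splitting at `q` stays in the cone
of slope `1` with respect to the splitting at a nearby point `q'`. -/
theorem norm_snd_le_norm_fst {c : ι} {q q' : M} (hq : q ∈ T.dom c) (hq' : q' ∈ T.dom c) {η : ℝ}
    (hη0 : 0 ≤ η) (hη1 : η ≤ 1) (hη : T.C ^ 4 * η ≤ 1 / 4)
    (hproj : ‖T.proj c q' - T.proj c q‖ ≤ 1 / (4 * T.C ^ 4)) {y y' : M}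
    (hslope : ‖(T.coord c q y).2 - (T.coord c q y').2‖ ≤
      η * ‖(T.coord c q y).1 - (T.coord c q y').1‖) :
    ‖(T.coord c q' y).2 - (T.coord c q' y').2‖ ≤ ‖(T.coord c q' y).1 - (T.coord c q' y').1‖ := by
  have hC := T.one_le
  have hC0 : 0 < T.C := by linarith
  set ξ := T.chart c y - T.chart c y' with hξ
  have hsymm : ∀ q, (T.frame c q).symm ξ = T.coord c q y - T.coord c q y' := by
    intro q; simp [coord, map_sub, hξ]
  have h1 : ((T.frame c q).symm ξ).1 = (T.coord c q y).1 - (T.coord c q y').1 := by rw [hsymm]; rfl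
  have h2 : ((T.frame c q).symm ξ).2 = (T.coord c q y).2 - (T.coord c q y').2 := by rw [hsymm]; rfl
  have h1' : ((T.frame c q').symm ξ).1 = (T.coord c q' y).1 - (T.coord c q' y').1 := by
    rw [hsymm]; rfl
  have h2' : ((T.frame c q').symm ξ).2 = (T.coord c q' y).2 - (T.coord c q' y').2 := by
    rw [hsymm]; rfl
  rw [← h1, ← h2] at hslope
  rw [← h1', ← h2']
  set u := ((T.frame c q).symm ξ).1
  set z := ((T.frame c q).symm ξ).2
  set u' := ((T.frame c q').symm ξ).1 with hu'
  set z' := ((T.frame c q').symm ξ).2 with hz'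
  have hzu : ‖z‖ ≤ ‖u‖ := hslope.trans (mul_le_of_le_one_left (norm_nonneg _) hη1)
  have hsn : ‖(T.frame c q).symm ξ‖ = ‖u‖ := by rw [Prod.norm_def, max_eq_left hzu]
  have hξu : ‖ξ‖ ≤ T.C * ‖u‖ := by
    have := T.frame_le c q hq ((T.frame c q).symm ξ)
    rwa [ContinuousLinearEquiv.apply_symm_apply, hsn] at this
  have huξ : ‖u‖ ≤ T.C * ‖ξ‖ := by
    have := T.symm_frame_le c q hq ξ
    rwa [hsn] at this
  by_contra! hlt
  -- If `z'` were larger than `u'` it would control `ξ`; but the slope `η` and the change of the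
  -- projection from `q` to `q'` bound `z'` by a small multiple of `ξ`.
  have hξz' : ‖ξ‖ ≤ T.C * ‖z'‖ := by
    have := T.frame_le c q' hq' ((T.frame c q').symm ξ)
    rwa [ContinuousLinearEquiv.apply_symm_apply, Prod.norm_def, ← hu', ← hz',
      max_eq_right hlt.le] at this
  have h3 : ‖z'‖ ≤ T.C * ‖ξ - T.proj c q' ξ‖ := T.norm_snd_symm_le hq' ξ
  have h4 : ‖ξ - T.proj c q' ξ‖ ≤ T.C * ‖z‖ + 1 / (4 * T.C ^ 4) * ‖ξ‖ := by
    have h5 : ξ - T.proj c q' ξ = (ξ - T.proj c q ξ) - (T.proj c q' - T.proj c q) ξ := by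
      simp
    rw [h5]
    refine (norm_sub_le _ _).trans (add_le_add (T.norm_sub_proj_le hq ξ) ?_)
    exact (ContinuousLinearMap.le_opNorm _ _).trans (by gcongr)
  have h6 : ‖z'‖ ≤ 1 / 2 * ‖z'‖ := by
    calc ‖z'‖ ≤ T.C * (T.C * (η * (T.C * (T.C * ‖z'‖))) +
          1 / (4 * T.C ^ 4) * (T.C * ‖z'‖)) := by
            refine h3.trans ?_
            gcongr
            refine h4.trans ?_
            gcongr
            refine hslope.trans ?_
            gcongr
            exact huξ.trans (by gcongr)
      _ = (T.C ^ 4 * η + T.C ^ 2 / (4 * T.C ^ 4)) * ‖z'‖ := by ring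
      _ ≤ (1 / 4 + 1 / 4) * ‖z'‖ := by
        have h8 : T.C ^ 2 / (4 * T.C ^ 4) ≤ 1 / 4 := by
          rw [div_le_div_iff₀ (by positivity) (by norm_num)]
          have : T.C ^ 2 ≤ T.C ^ 4 := pow_le_pow_right₀ hC (by norm_num)
          linarith
        exact mul_le_mul_of_nonneg_right (add_le_add hη h8) (norm_nonneg _)
      _ = _ := by ring
  have h7 : 0 < ‖z'‖ := (norm_nonneg _).trans_lt hlt
  linarith

/-- Two orbits, one of them in `Λ`, which stay close and in the centre-unstable cone: domination
forces them to become tangent to the centre-unstable direction, up to a power of their maximal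
distance. -/
theorem slope_le_of_orbit {y y' : ℕ → M} {c : ℕ → ι} {n : ℕ} {ρ : ℝ}
    (hy : ∀ i < n, f (y i) = y (i + 1)) (hy' : ∀ i < n, f (y' i) = y' (i + 1))
    (hdom : ∀ i ≤ n, y' i ∈ T.dom (c i)) (hsrc : ∀ i ≤ n, y i ∈ T.source (c i))
    (hρ0 : 0 ≤ ρ) (hρ : ∀ i ≤ n, ‖T.coord (c i) (y' i) (y i)‖ ≤ ρ) (hρr : T.C * ρ ≤ T.r)
    (hρκ : T.C * (T.C ^ 4 * ρ ^ T.α) ≤ 1 / 2)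
    (hcone : ∀ i ≤ n, ‖(T.coord (c i) (y' i) (y i)).2‖ ≤ ‖(T.coord (c i) (y' i) (y i)).1‖) :
    T.nY (y' n) (T.coord (c n) (y' n) (y n)).2 ≤
      (T.lam ^ n * T.C ^ 2 + 4 * T.C ^ 5 * (T.C ^ 4 * ρ ^ T.α) / (1 - T.lam)) *
        T.nX (y' n) (T.coord (c n) (y' n) (y n)).1 := by
  have hC := T.one_le
  have hC0 : 0 < T.C := by linarith
  have hlam := T.lam_lt
  have hlam0 := T.lam_nonneg
  set κ := T.C ^ 4 * ρ ^ T.α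
  have hκ0 : 0 ≤ κ := by positivity
  induction n with
  | zero =>
    have hst := T.step (y' 0) (T.dom_subset _ (hdom 0 le_rfl))
    have h0 : 0 ≤ 4 * T.C ^ 5 * κ / (1 - T.lam) := div_nonneg (by positivity) (by linarith)
    calc T.nY (y' 0) (T.coord (c 0) (y' 0) (y 0)).2
        ≤ T.C * ‖(T.coord (c 0) (y' 0) (y 0)).2‖ := hst.nY_le _
      _ ≤ T.C * (T.C * T.nX (y' 0) (T.coord (c 0) (y' 0) (y 0)).1) := by
        gcongr
        exact (hcone 0 le_rfl).trans (hst.le_nX _)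
      _ = T.C ^ 2 * T.nX (y' 0) (T.coord (c 0) (y' 0) (y 0)).1 := by ring
      _ ≤ _ := by
        refine mul_le_mul_of_nonneg_right ?_ (apply_nonneg _ _)
        simpa using h0
  | succ n ih =>
    have ih := ih (fun i hi => hy i (by omega)) (fun i hi => hy' i (by omega))
      (fun i hi => hdom i (by omega)) (fun i hi => hsrc i (by omega))
      (fun i hi => hρ i (by omega)) (fun i hi => hcone i (by omega))
    have hst := T.step (y' n) (T.dom_subset _ (hdom n (by omega)))
    rw [hy' n (by omega)] at hst
    have happ := T.coord_approx (c' := c (n + 1)) (hdom n (by omega))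
      (by rw [hy' n (by omega)]; exact hdom (n + 1) le_rfl) hρ0 hρr (hsrc n (by omega))
      (T.dom_subset_source _ (hdom n (by omega))) (hρ n (by omega)) (by simpa using hρ0)
    rw [hy n (by omega), hy' n (by omega)] at happ
    simp only [coord_self, sub_zero, Prod.fst_zero, Prod.snd_zero] at happ
    have hcn := hcone n (by omega)
    have hnorm : ‖T.coord (c n) (y' n) (y n)‖ = ‖(T.coord (c n) (y' n) (y n)).1‖ := by
      rw [Prod.norm_def, max_eq_left hcn]
    rw [hnorm] at happ
    have h0 : 0 ≤ 4 * T.C ^ 5 * κ / (1 - T.lam) := div_nonneg (by positivity) (by linarith)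
    have := hst.slope_le hκ0 hρκ (by positivity) ((norm_fst_le _).trans happ)
      ((norm_snd_le _).trans happ) hcn ih
    refine this.trans (mul_le_mul_of_nonneg_right (le_of_eq ?_) (apply_nonneg _ _))
    have h1 : 1 - T.lam ≠ 0 := by linarith
    field_simp
    ring

end CuAtlas

/-- At a point of `Λ`, a hyperbolic pre-disk is tangent to the centre-unstable direction, up to an
error that decreases with the time `n`, and with a uniform Hölder estimate for the secants. -/
theorem CuAtlas.exists_secant_le [Finite ι] [MeasurableSpace X] (T : CuAtlas X Y E ι f Λ)
    (μ : Measure X) (hinv : MapsTo f Λ Λ) :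
    ∃ δ₁ > 0, ∃ s > 0, T.C ^ 2 * s ≤ 1 ∧ ∃ K' : ℝ, ∀ (φ : X → M) (p : X) (N n : ℕ) (δ τ : ℝ)
      (K : ℝ≥0∞) (V : Set X), 0 < δ → δ ≤ δ₁ → 0 ≤ τ → τ ≤ 1 → N ≤ n → φ p ∈ Λ →
      PreDisk T μ φ p N n δ τ (T.C ^ 2 * s) K V → ∀ q ∈ V, φ q ∈ Λ → ∀ q' ∈ V,
      ‖(T.chart (T.idx (f^[n] (φ p))) (f^[n] (φ q')) - T.chart (T.idx (f^[n] (φ p))) (f^[n] (φ q))) -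
        T.proj (T.idx (f^[n] (φ p))) (f^[n] (φ q)) (T.chart (T.idx (f^[n] (φ p))) (f^[n] (φ q')) -
          T.chart (T.idx (f^[n] (φ p))) (f^[n] (φ q)))‖ ≤
      K' * (T.lam ^ (n - N) + ‖(T.track φ p n q').1 - (T.track φ p n q).1‖ ^ T.α) *
        ‖(T.track φ p n q').1 - (T.track φ p n q).1‖ := by
  have hC := T.one_le
  have hC0 : 0 < T.C := by linarith
  have hlam := T.lam_lt
  have hlam0 := T.lam_nonneg
  obtain ⟨δ₂, hδ₂, hproj⟩ := T.exists_norm_proj_sub_le (ε₀ := 1 / (4 * T.C ^ 4)) (by positivity)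
  obtain ⟨δ₁, hδ₁, hδ₁2, hδ₁r, hδ₁r', hδ₁κ⟩ : ∃ δ₁ > 0, T.C * δ₁ ≤ δ₂ ∧ T.C * δ₁ ≤ T.r ∧
      T.C * (T.C ^ 2 * (2 * δ₁)) ≤ T.r ∧
      T.C * (T.C ^ 4 * (T.C ^ 2 * (2 * δ₁)) ^ T.α) ≤ 1 / 2 := by
    have h1 : Tendsto (fun ρ : ℝ => T.C * ρ) (𝓝[>] 0) (𝓝 0) := by
      have : Continuous (fun ρ : ℝ => T.C * ρ) := by fun_prop
      simpa using (this.tendsto 0).mono_left nhdsWithin_le_nhds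
    have h2 : Tendsto (fun ρ : ℝ => T.C * (T.C ^ 2 * (2 * ρ))) (𝓝[>] 0) (𝓝 0) := by
      have : Continuous (fun ρ : ℝ => T.C * (T.C ^ 2 * (2 * ρ))) := by fun_prop
      simpa using (this.tendsto 0).mono_left nhdsWithin_le_nhds
    have h3 : Tendsto (fun ρ : ℝ => T.C * (T.C ^ 4 * (T.C ^ 2 * (2 * ρ)) ^ T.α)) (𝓝[>] 0)
        (𝓝 0) := by
      have : Continuous (fun ρ : ℝ => T.C * (T.C ^ 4 * (T.C ^ 2 * (2 * ρ)) ^ T.α)) := by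
        have h4 : Continuous (fun x : ℝ => x ^ T.α) :=
          continuous_iff_continuousAt.2 fun x => Real.continuousAt_rpow_const x T.α
            (Or.inr T.α_pos.le)
        have h5 : Continuous (fun ρ : ℝ => (T.C ^ 2 * (2 * ρ)) ^ T.α) := h4.comp (by fun_prop)
        fun_prop
      simpa [Real.zero_rpow T.α_pos.ne'] using (this.tendsto 0).mono_left nhdsWithin_le_nhds
    obtain ⟨δ₁, h5, h6, h7, h8, h9⟩ := ((h1.eventually_lt_const hδ₂).and
      ((h1.eventually_lt_const T.r_pos).and ((h2.eventually_lt_const T.r_pos).and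
      ((h3.eventually_lt_const (show (0 : ℝ) < 1 / 2 by norm_num)).and self_mem_nhdsWithin)))).exists
    exact ⟨δ₁, h9, h5.le, h6.le, h7.le, h8.le⟩
  -- The slope is measured at the centre `φ p`. The bound on `s` and the uniform continuity of the
  -- splitting keep the graph in the cone of slope `1` with respect to the splitting at `φ q`.
  set s : ℝ := 1 / (4 * T.C ^ 6) with hs
  have hsη : T.C ^ 4 * (T.C ^ 2 * s) ≤ 1 / 4 := by
    rw [hs]; apply le_of_eq; field_simp
  have hs1 : T.C ^ 2 * s ≤ 1 := by
    have h1 : 1 ≤ T.C ^ 4 := one_le_pow₀ hC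
    have h0 : 0 ≤ T.C ^ 2 * s := by positivity
    nlinarith
  set K₀ : ℝ := T.C ^ 2 + 4 * T.C ^ 5 * (T.C ^ 4 * T.C ^ 2) / (1 - T.lam) with hK₀
  have hK₀0 : 0 ≤ K₀ := add_nonneg (by positivity) (div_nonneg (by positivity) (by linarith))
  refine ⟨δ₁, hδ₁, s, by positivity, hs1, T.C * (T.C * (K₀ * (T.C * T.C ^ 2))), ?_⟩
  intro φ p N n δ τ K V hδ0 hδ hτ0 hτ1 hNn hp hV q hq hqΛ q' hq'
  set Δ := ‖(T.track φ p n q').1 - (T.track φ p n q).1‖ with hΔ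
  have hpi : ∀ i, f^[i] (φ p) ∈ Λ := fun i => hinv.iterate i hp
  have hqi : ∀ i, f^[i] (φ q) ∈ Λ := fun i => hinv.iterate i hqΛ
  have hdp : ∀ i, f^[i] (φ p) ∈ T.dom (T.idx (f^[i] (φ p))) := fun i => T.mem_dom_idx _ (hpi i)
  have hchart : ∀ v ∈ V, ∀ i, N ≤ i → i ≤ n → ‖T.chart (T.idx (f^[i] (φ p))) (f^[i] (φ v)) -
      T.chart (T.idx (f^[i] (φ p))) (f^[i] (φ p))‖ ≤ T.C * δ := fun v hv i hNi hin =>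
    T.norm_chart_sub_self_le (hdp i) (hV.norm_le v hv i hNi hin)
  have hdq : ∀ i, N ≤ i → i ≤ n → f^[i] (φ q) ∈ T.dom (T.idx (f^[i] (φ p))) := fun i hNi hin =>
    T.mem_dom _ (hpi i) _ (hV.mem_source q hq i hNi hin) ((hchart q hq i hNi hin).trans
      ((mul_le_mul_of_nonneg_left hδ hC0.le).trans hδ₁r)) (hqi i)
  have hcontr : ∀ i, N ≤ i → i ≤ n →
      ‖T.coord (T.idx (f^[i] (φ p))) (f^[i] (φ q)) (f^[i] (φ q'))‖ ≤ T.C ^ 2 * Δ := by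
    intro i hNi hin
    have h1 := T.norm_coord_sub_le (hdq i hNi hin) (f^[i] (φ q')) (f^[i] (φ q))
    rw [T.coord_self, sub_zero] at h1
    have h2 := T.norm_chart_sub_le (hdp i) (f^[i] (φ q')) (f^[i] (φ q))
    have h3 := hV.contraction q' hq' q hq i hNi hin
    have h4 : τ ^ (n - i) * Δ ≤ 1 * Δ := by
      gcongr
      exact pow_le_one₀ hτ0 hτ1
    calc _ ≤ T.C * (T.C * ‖T.track φ p i q' - T.track φ p i q‖) :=
          h1.trans (mul_le_mul_of_nonneg_left h2 hC0.le)
      _ ≤ T.C * (T.C * Δ) := by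
        gcongr
        linarith
      _ = _ := by ring
  have hΔ0 : 0 ≤ Δ := norm_nonneg _
  have hΔδ : Δ ≤ 2 * δ₁ := by
    have h1 := (norm_fst_le _).trans (hV.norm_le q hq n hNn le_rfl)
    have h2 := (norm_fst_le _).trans (hV.norm_le q' hq' n hNn le_rfl)
    have h3 := norm_sub_le (T.track φ p n q').1 (T.track φ p n q).1
    linarith
  have hcone : ∀ i, N ≤ i → i ≤ n →
      ‖(T.coord (T.idx (f^[i] (φ p))) (f^[i] (φ q)) (f^[i] (φ q'))).2‖ ≤
      ‖(T.coord (T.idx (f^[i] (φ p))) (f^[i] (φ q)) (f^[i] (φ q'))).1‖ := by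
    intro i hNi hin
    have h1 := T.norm_snd_le_norm_fst (hdp i) (hdq i hNi hin) (η := T.C ^ 2 * s) (by positivity) hs1
      hsη (hproj _ _ (hdp i) _ (hdq i hNi hin) ((hchart q hq i hNi hin).trans
        ((mul_le_mul_of_nonneg_left hδ hC0.le).trans hδ₁2))) (hV.slope q' hq' q hq i hNi hin)
    simpa using h1
  have hmain := T.slope_le_of_orbit (y := fun i => f^[N + i] (φ q'))
    (y' := fun i => f^[N + i] (φ q)) (c := fun i => T.idx (f^[N + i] (φ p))) (n := n - N)
    (ρ := T.C ^ 2 * Δ) (fun i _ => (Function.iterate_succ_apply' f _ _).symm)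
    (fun i _ => (Function.iterate_succ_apply' f _ _).symm)
    (fun i hi => hdq _ (by omega) (by omega))
    (fun i hi => hV.mem_source q' hq' _ (by omega) (by omega)) (by positivity)
    (fun i hi => hcontr _ (by omega) (by omega))
    (le_trans (by gcongr) hδ₁r')
    (le_trans (by
      have := T.α_pos.le
      gcongr) hδ₁κ)
    (fun i hi => hcone _ (by omega) (by omega))
  simp only [show N + (n - N) = n by omega] at hmain
  set c := T.idx (f^[n] (φ p))
  set w := T.coord c (f^[n] (φ q)) (f^[n] (φ q'))
  have hst := T.step _ (hqi n)
  have hw1 : ‖w.1‖ ≤ T.C ^ 2 * Δ := (norm_fst_le _).trans (hcontr n hNn le_rfl)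
  have hpow : (T.C ^ 2 * Δ) ^ T.α ≤ T.C ^ 2 * Δ ^ T.α := by
    rw [Real.mul_rpow (by positivity) hΔ0]
    gcongr
    calc (T.C ^ 2) ^ T.α ≤ (T.C ^ 2) ^ (1 : ℝ) :=
          Real.rpow_le_rpow_of_exponent_le (one_le_pow₀ hC) T.α_le
      _ = T.C ^ 2 := Real.rpow_one _
  have hcoef : T.lam ^ (n - N) * T.C ^ 2 +
      4 * T.C ^ 5 * (T.C ^ 4 * (T.C ^ 2 * Δ) ^ T.α) / (1 - T.lam) ≤
      K₀ * (T.lam ^ (n - N) + Δ ^ T.α) := by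
    have h1 : 4 * T.C ^ 5 * (T.C ^ 4 * (T.C ^ 2 * Δ) ^ T.α) / (1 - T.lam) ≤
        4 * T.C ^ 5 * (T.C ^ 4 * (T.C ^ 2 * Δ ^ T.α)) / (1 - T.lam) := by
      have : 0 ≤ 1 - T.lam := by linarith
      gcongr
    have h2 : 4 * T.C ^ 5 * (T.C ^ 4 * (T.C ^ 2 * Δ ^ T.α)) / (1 - T.lam) =
        4 * T.C ^ 5 * (T.C ^ 4 * T.C ^ 2) / (1 - T.lam) * Δ ^ T.α := by ring
    have h3 : 0 ≤ 4 * T.C ^ 5 * (T.C ^ 4 * T.C ^ 2) / (1 - T.lam) :=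
      div_nonneg (by positivity) (by linarith)
    have h4 : 0 ≤ T.lam ^ (n - N) := by positivity
    have h5 : 0 ≤ Δ ^ T.α := by positivity
    rw [h2] at h1
    rw [hK₀]
    nlinarith [mul_nonneg h3 h4, mul_nonneg (sq_nonneg T.C) h5]
  set R := T.lam ^ (n - N) + Δ ^ T.α
  have hR0 : 0 ≤ R := by positivity
  have hnX0 : 0 ≤ T.nX (f^[n] (φ q)) w.1 := apply_nonneg _ _
  calc _ ≤ T.C * ‖w.2‖ := T.norm_sub_proj_le (hdq n hNn le_rfl) _
    _ ≤ T.C * (T.C * T.nY (f^[n] (φ q)) w.2) := by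
      gcongr; exact T.le_nY _ (hqi n) _
    _ ≤ T.C * (T.C * (K₀ * R * T.nX (f^[n] (φ q)) w.1)) := by
      gcongr
      exact hmain.trans (mul_le_mul_of_nonneg_right hcoef hnX0)
    _ ≤ T.C * (T.C * (K₀ * R * (T.C * (T.C ^ 2 * Δ)))) := by
      gcongr
      exact (hst.nX_le _).trans (by gcongr)
    _ = _ := by ring

end

/-! ### The limit disk -/

section

/-- A function whose increments are, up to a Hölder error, in the kernel of a continuous family of
linear maps `S v + R v`, with `R v` close to the identity, is of class `C^1`. -/
theorem contDiffOn_one_of_secant {X Y : Type*} [NormedAddCommGroup X] [NormedSpace ℝ X]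
    [NormedAddCommGroup Y] [NormedSpace ℝ Y] [CompleteSpace Y] {h : X → Y} {B : Set X}
    (hB : IsOpen B) {S : X → X →L[ℝ] Y} {R : X → Y →L[ℝ] Y} (hS : ContinuousOn S B)
    (hR : ContinuousOn R B) (hR1 : ∀ v ∈ B, ‖R v - 1‖ ≤ 1 / 2) {K α : ℝ} (hα : 0 < α)
    (hsec : ∀ v ∈ B, ∀ v' ∈ B,
      ‖S v (v' - v) + R v (h v' - h v)‖ ≤ K * ‖v' - v‖ ^ α * ‖v' - v‖) :
    ContDiffOn ℝ 1 h B := by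
  have hunit : ∀ v ∈ B, IsUnit (R v) := by
    intro v hv
    have h1 : ‖1 - R v‖ < 1 := by
      rw [norm_sub_rev]; exact (hR1 v hv).trans_lt (by norm_num)
    simpa using isUnit_one_sub_of_norm_lt_one h1
  have hderiv : ∀ v ∈ B, HasFDerivAt h (-(Ring.inverse (R v) ∘L S v)) v := by
    intro v hv
    rw [hasFDerivAt_iff_isLittleO]
    set I := Ring.inverse (R v)
    have hI : ∀ z, I (R v z) = z := fun z => by
      have := Ring.inverse_mul_cancel _ (hunit v hv)
      exact congrArg (fun A : Y →L[ℝ] Y => A z) this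
    have hrpow : Tendsto (fun v' => ‖I‖ * (K * ‖v' - v‖ ^ α)) (𝓝 v) (𝓝 0) := by
      have h1 : ContinuousAt (fun v' => ‖v' - v‖ ^ α) v :=
        ContinuousAt.rpow_const (by fun_prop) (Or.inr hα.le)
      have h2 : ContinuousAt (fun v' => ‖I‖ * (K * ‖v' - v‖ ^ α)) v := by fun_prop
      simpa [ContinuousAt, Real.zero_rpow hα.ne'] using h2
    rw [Asymptotics.isLittleO_iff]
    intro ε hε
    filter_upwards [hrpow.eventually_lt_const hε, hB.mem_nhds hv] with v' h1 hv'
    have h2 : h v' - h v - (-(I ∘L S v)) (v' - v) =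
        I (S v (v' - v) + R v (h v' - h v)) := by
      rw [map_add, hI]
      simp only [neg_apply, ContinuousLinearMap.comp_apply, sub_neg_eq_add]
      abel
    rw [h2]
    calc _ ≤ ‖I‖ * (K * ‖v' - v‖ ^ α * ‖v' - v‖) :=
          (I.le_opNorm _).trans (mul_le_mul_of_nonneg_left (hsec v hv v' hv') (norm_nonneg _))
      _ = ‖I‖ * (K * ‖v' - v‖ ^ α) * ‖v' - v‖ := by ring
      _ ≤ _ := mul_le_mul_of_nonneg_right h1.le (norm_nonneg _)
  rw [show (1 : WithTop ℕ∞) = 0 + 1 from (zero_add _).symm, contDiffOn_succ_iff_fderiv_of_isOpen hB,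
    contDiffOn_zero]
  refine ⟨fun v hv => (hderiv v hv).differentiableAt.differentiableWithinAt, by simp, ?_⟩
  have hc : ContinuousOn (fun v => -(Ring.inverse (R v) ∘L S v)) B := by
    intro v hv
    obtain ⟨u, hu⟩ := hunit v hv
    have h1 : ContinuousAt Ring.inverse (R v) := by
      rw [← hu]; exact NormedRing.inverse_continuousAt u
    exact ((h1.comp_continuousWithinAt (hR v hv)).clm_comp (hS v hv)).neg
  exact hc.congr fun v hv => (hderiv v hv).fderiv

theorem tendsto_clm_apply {β F G : Type*} [NormedAddCommGroup F] [NormedSpace ℝ F]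
    [NormedAddCommGroup G] [NormedSpace ℝ G] {l : Filter β} {u : β → F →L[ℝ] G} {u₀ : F →L[ℝ] G}
    {v : β → F} {v₀ : F} (hu : Tendsto u l (𝓝 u₀)) (hv : Tendsto v l (𝓝 v₀)) :
    Tendsto (fun k => u k (v k)) l (𝓝 (u₀ v₀)) :=
  (isBoundedBilinearMap_apply.continuous.tendsto (u₀, v₀)).comp (hu.prodMk_nhds hv)

theorem tendsto_clm_comp {β F G H : Type*} [NormedAddCommGroup F] [NormedSpace ℝ F]
    [NormedAddCommGroup G] [NormedSpace ℝ G] [NormedAddCommGroup H] [NormedSpace ℝ H]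
    {l : Filter β} {u : β → G →L[ℝ] H} {u₀ : G →L[ℝ] H} {v : β → F →L[ℝ] G} {v₀ : F →L[ℝ] G}
    (hu : Tendsto u l (𝓝 u₀)) (hv : Tendsto v l (𝓝 v₀)) :
    Tendsto (fun k => u k ∘L v k) l (𝓝 (u₀ ∘L v₀)) :=
  ((isBoundedBilinearMap_comp (𝕜 := ℝ)).continuous.tendsto (u₀, v₀)).comp (hu.prodMk_nhds hv)

/-- Bounded sequences in a proper space converge along ultrafilters. This is used in place of repeated
extraction of subsequences. -/
theorem _root_.Ultrafilter.exists_tendsto_of_norm_le {β F : Type*} [NormedAddCommGroup F]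
    [ProperSpace F] (𝒰 : Ultrafilter β) {u : β → F} {B : ℝ} (hu : ∀ᶠ k in 𝒰, ‖u k‖ ≤ B) :
    ∃ a, ‖a‖ ≤ B ∧ Tendsto u 𝒰 (𝓝 a) := by
  have h1 : Metric.closedBall (0 : F) B ∈ 𝒰.map u := by
    rw [Ultrafilter.mem_map]
    exact hu.mono fun k hk => mem_closedBall_zero_iff.2 hk
  obtain ⟨a, ha, h2⟩ := (isCompact_closedBall (0 : F) B).ultrafilter_le_nhds' _ h1
  exact ⟨a, by simpa using ha, h2⟩

variable {M X Y E ι : Type*} [EMetricSpace M] [NormedAddCommGroup X]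
    [NormedSpace ℝ X] [NormedAddCommGroup Y] [NormedSpace ℝ Y] [NormedAddCommGroup E]
    [NormedSpace ℝ E] {f : M → M} {Λ : Set M}

/-- A disk through `x ∈ Λ`, a Lipschitz graph over the ball of radius `δ` in the coordinates at `x`,
which is contracted at the rate `τ` by the first `m` backward iterates of `f` and contains many
points of `Λ`, where it is almost tangent to the centre-unstable direction. -/
structure ApproxDisk (T : CuAtlas X Y E ι f Λ) (finv : M → M) (δ δ' τ K t : ℝ) (m : ℕ) (x : M)
    (y : X → M) (h : X → Y) : Prop where
  mem : x ∈ Λ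
  mem_source : ∀ v, ‖v‖ ≤ δ → y v ∈ T.source (T.idx x)
  loc_eq : ∀ v, ‖v‖ ≤ δ → T.loc x (y v) = (v, h v)
  norm_le : ∀ v, ‖v‖ ≤ δ → ‖h v‖ ≤ δ
  lipschitz : ∀ v v', ‖v‖ ≤ δ → ‖v'‖ ≤ δ → ‖h v - h v'‖ ≤ ‖v - v'‖
  contraction : ∀ v v', ‖v‖ ≤ δ → ‖v'‖ ≤ δ → ∀ j ≤ m,
    edist (finv^[j] (y v)) (finv^[j] (y v')) ≤ ENNReal.ofReal (T.C ^ 2 * (τ ^ j * ‖v - v'‖))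
  dense : ∀ v, ‖v‖ ≤ δ' → ∃ v'', ‖v''‖ ≤ δ ∧ ‖v'' - v‖ ≤ t ∧ y v'' ∈ Λ ∧ ∀ v', ‖v'‖ ≤ δ →
    ‖(T.chart (T.idx x) (y v') - T.chart (T.idx x) (y v'')) -
      T.proj (T.idx x) (y v'') (T.chart (T.idx x) (y v') - T.chart (T.idx x) (y v''))‖ ≤
    K * (t + ‖v' - v''‖ ^ T.α) * ‖v' - v''‖

/-- Approximate disks with `m → ∞` and `t → 0` accumulate on a `C^1` disk in `Λ`. -/
theorem CuAtlas.exists_limit_disk [Finite ι] [FiniteDimensional ℝ X] [FiniteDimensional ℝ Y]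
    [FiniteDimensional ℝ E] (T : CuAtlas X Y E ι f Λ) {finv : M → M} (hfinv : Continuous finv)
    {δ δ' τ K : ℝ} (hδ : 0 < δ) (hδ' : δ' ≤ δ) (hδr : 2 * (T.C * δ) ≤ T.r)
    (hproj : ∀ c, ∀ q ∈ T.dom c, ∀ q' ∈ T.dom c, ‖T.chart c q' - T.chart c q‖ ≤ T.C * δ →
      ‖T.proj c q' - T.proj c q‖ ≤ 1 / (2 * T.C ^ 2))
    {t : ℕ → ℝ} (ht : Tendsto t atTop (𝓝 0)) {m : ℕ → ℕ} (hm : Tendsto m atTop atTop)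
    {x : ℕ → M} {y : ℕ → X → M} {h : ℕ → X → Y}
    (hd : ∀ k, ApproxDisk T finv δ δ' τ K (t k) (m k) (x k) (y k) (h k)) :
    ∃ c, ∃ z ∈ T.dom c, ∃ (Θ : (X × Y) ≃L[ℝ] E) (H : X → Y), ContDiffOn ℝ 1 H (Metric.ball 0 δ') ∧
      (∀ v, ‖v‖ < δ' → ‖Θ (v, H v)‖ ≤ T.r ∧ T.par c (T.chart c z + Θ (v, H v)) ∈ Λ) ∧
      ∀ v v', ‖v‖ < δ' → ‖v'‖ < δ' → ∀ n,
        edist (finv^[n] (T.par c (T.chart c z + Θ (v, H v))))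
          (finv^[n] (T.par c (T.chart c z + Θ (v', H v')))) ≤
        ENNReal.ofReal (T.C ^ 2 * (τ ^ n * ‖v - v'‖)) := by
  have hC := T.one_le
  have hC0 : 0 < T.C := by linarith
  have hXp := FiniteDimensional.proper_real X
  have hYp := FiniteDimensional.proper_real Y
  have hp1 := FiniteDimensional.proper_real (X × Y →L[ℝ] E)
  have hp2 := FiniteDimensional.proper_real (E →L[ℝ] X × Y)
  set 𝒰 : Ultrafilter ℕ := hyperfilter ℕ
  have h𝒰 : (𝒰 : Filter ℕ) ≤ atTop := Nat.hyperfilter_le_atTop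
  -- The charts are eventually constant along the ultrafilter.
  obtain ⟨c, hc⟩ : ∃ c, ∀ᶠ k in 𝒰, T.idx (x k) = c := by
    obtain ⟨c, hc⟩ := Ultrafilter.eq_pure_of_finite (𝒰.map fun k => T.idx (x k))
    refine ⟨c, ?_⟩
    have : {c} ∈ 𝒰.map fun k => T.idx (x k) := by rw [hc]; exact mem_pure.2 rfl
    exact this
  have hxc : ∀ᶠ k in 𝒰, x k ∈ T.dom c := hc.mono fun k hk => hk ▸ T.mem_dom_idx _ (hd k).mem
  obtain ⟨z, hz, hxz⟩ : ∃ z ∈ T.dom c, Tendsto x 𝒰 (𝓝 z) :=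
    (T.isCompact_dom c).ultrafilter_le_nhds' (𝒰.map x) hxc
  obtain ⟨Θ₁, -, hΘ₁⟩ := 𝒰.exists_tendsto_of_norm_le
    (u := fun k => (T.frame c (x k) : X × Y →L[ℝ] E)) (B := T.C)
    (hxc.mono fun k hk => ContinuousLinearMap.opNorm_le_bound _ hC0.le (T.frame_le c _ hk))
  obtain ⟨Θ₂, hΘ₂n, hΘ₂⟩ := 𝒰.exists_tendsto_of_norm_le
    (u := fun k => ((T.frame c (x k)).symm : E →L[ℝ] X × Y)) (B := T.C)
    (hxc.mono fun k hk => ContinuousLinearMap.opNorm_le_bound _ hC0.le (T.symm_frame_le c _ hk))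
  have hΘ₁n : ∀ w, ‖Θ₁ w‖ ≤ T.C * ‖w‖ := fun w =>
    le_of_tendsto (tendsto_clm_apply hΘ₁ tendsto_const_nhds).norm (hxc.mono fun k hk => T.frame_le c _ hk w)
  -- The limit of the frames is invertible since the inverses converge as well. It need not be the frame
  -- at `z`, but it defines the same projection.
  have h21 : ∀ w, Θ₂ (Θ₁ w) = w := fun w =>
    tendsto_nhds_unique (tendsto_clm_apply hΘ₂ (tendsto_clm_apply hΘ₁ tendsto_const_nhds))
      (tendsto_const_nhds.congr fun k => ((T.frame c (x k)).symm_apply_apply w).symm)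
  have h12 : ∀ e, Θ₁ (Θ₂ e) = e := fun e =>
    tendsto_nhds_unique (tendsto_clm_apply hΘ₁ (tendsto_clm_apply hΘ₂ tendsto_const_nhds))
      (tendsto_const_nhds.congr fun k => ((T.frame c (x k)).apply_symm_apply e).symm)
  set Θ : (X × Y) ≃L[ℝ] E := ContinuousLinearEquiv.equivOfInverse Θ₁ Θ₂ h21 h12
  have hprojz : T.proj c z = (Θ₁ ∘L ((ContinuousLinearMap.inl ℝ X Y) ∘L
      (ContinuousLinearMap.fst ℝ X Y))) ∘L Θ₂ := by
    have h1 : Tendsto (fun k => T.proj c (x k)) 𝒰 (𝓝 (T.proj c z)) :=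
      ((T.continuousOn_proj c) z hz).tendsto.comp
        (tendsto_nhdsWithin_iff.2 ⟨hxz, hxc⟩)
    exact tendsto_nhds_unique h1 (tendsto_clm_comp (tendsto_clm_comp hΘ₁ tendsto_const_nhds) hΘ₂)
  have hH : ∀ v, ∃ w, ‖v‖ ≤ δ → ‖w‖ ≤ δ ∧ Tendsto (fun k => h k v) 𝒰 (𝓝 w) := by
    intro v
    by_cases hv : ‖v‖ ≤ δ
    · obtain ⟨w, hw⟩ := 𝒰.exists_tendsto_of_norm_le (u := fun k => h k v) (B := δ)
        (Eventually.of_forall fun k => (hd k).norm_le v hv)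
      exact ⟨w, fun _ => hw⟩
    · exact ⟨0, fun hv' => absurd hv' hv⟩
  choose H hH using hH
  -- convergence of the disks along convergent sequences of parameters
  have hHt : ∀ (u : ℕ → X) v, ‖v‖ ≤ δ → (∀ k, ‖u k‖ ≤ δ) → Tendsto u 𝒰 (𝓝 v) →
      Tendsto (fun k => h k (u k)) 𝒰 (𝓝 (H v)) := by
    intro u v hv hu huv
    have h1 := (hH v hv).2
    have h2 : Tendsto (fun k => h k (u k) - h k v) 𝒰 (𝓝 0) := by
      refine squeeze_zero_norm (fun k => (hd k).lipschitz _ _ (hu k) hv) ?_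
      simpa using (huv.sub_const v).norm
    simpa using h2.add h1
  set ξ : X → E := fun v => T.chart c z + Θ (v, H v)
  have hchart : ∀ᶠ k in 𝒰, ∀ v, ‖v‖ ≤ δ →
      T.chart c (y k v) = T.chart c (x k) + T.frame c (x k) (v, h k v) := by
    filter_upwards [hc] with k hk v hv
    have h1 := (hd k).loc_eq v hv
    rw [CuAtlas.loc, hk] at h1
    rw [← h1, T.frame_coord]
    abel
  have hξt : ∀ (u : ℕ → X) v, ‖v‖ ≤ δ → (∀ k, ‖u k‖ ≤ δ) → Tendsto u 𝒰 (𝓝 v) →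
      Tendsto (fun k => T.chart c (y k (u k))) 𝒰 (𝓝 (ξ v)) := by
    intro u v hv hu huv
    have h1 : Tendsto (fun k => T.chart c (x k)) 𝒰 (𝓝 (T.chart c z)) :=
      (((T.continuousOn_chart c).continuousAt ((T.isOpen_source c).mem_nhds
        (T.dom_subset_source c hz))).tendsto).comp hxz
    have h2 := h1.add (tendsto_clm_apply hΘ₁ (huv.prodMk_nhds (hHt u v hv hu huv)))
    refine h2.congr' ?_
    filter_upwards [hchart] with k hk
    exact (hk _ (hu k)).symm
  have hΘδ : ∀ v, ‖v‖ ≤ δ → ‖Θ (v, H v)‖ ≤ T.C * δ := fun v hv =>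
    (hΘ₁n _).trans (mul_le_mul_of_nonneg_left (max_le hv (hH v hv).1) hC0.le)
  have hCδ : 0 < T.C * δ := by positivity
  have hξr : ∀ v, ‖v‖ ≤ δ → ‖ξ v - T.chart c z‖ ≤ T.C * δ := fun v hv => by
    simpa [ξ] using hΘδ v hv
  set ψ : X → M := fun v => T.par c (ξ v)
  have hψ : ∀ v, ‖v‖ ≤ δ → ψ v ∈ T.source c ∧ T.chart c (ψ v) = ξ v := fun v hv =>
    T.par_mem c z hz _ ((hξr v hv).trans (by linarith))
  have hyt : ∀ (u : ℕ → X) v, ‖v‖ ≤ δ → (∀ k, ‖u k‖ ≤ δ) → Tendsto u 𝒰 (𝓝 v) →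
      Tendsto (fun k => y k (u k)) 𝒰 (𝓝 (ψ v)) := by
    intro u v hv hu huv
    have h1 := hξt u v hv hu huv
    rw [tendsto_iff_edist_tendsto_0]
    have h2 : Tendsto (fun k => ENNReal.ofReal (T.C * ‖T.chart c (y k (u k)) - ξ v‖)) 𝒰 (𝓝 0) := by
      have h3 := ((h1.sub_const (ξ v)).norm.const_mul T.C)
      rw [sub_self, norm_zero, mul_zero] at h3
      rw [← ENNReal.ofReal_zero]
      exact (ENNReal.continuous_ofReal.tendsto 0).comp h3
    refine tendsto_of_tendsto_of_tendsto_of_le_of_le' tendsto_const_nhds h2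
      (Eventually.of_forall fun k => zero_le) ?_
    have h4 : ∀ᶠ k in 𝒰, ‖T.chart c (y k (u k)) - T.chart c z‖ < T.r :=
      (h1.sub_const (T.chart c z)).norm.eventually_lt_const
        (lt_of_le_of_lt (hξr v hv) (by linarith))
    filter_upwards [h4, hc] with k hk hkc
    have h5 := T.edist_le c z hz (y k (u k)) (hkc ▸ (hd k).mem_source _ (hu k)) (ψ v) (hψ v hv).1
      hk.le (by rw [(hψ v hv).2]; exact (hξr v hv).trans (by linarith))
    rwa [(hψ v hv).2] at h5
  have hcontr : ∀ v v', ‖v‖ ≤ δ → ‖v'‖ ≤ δ → ∀ n, edist (finv^[n] (ψ v)) (finv^[n] (ψ v')) ≤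
      ENNReal.ofReal (T.C ^ 2 * (τ ^ n * ‖v - v'‖)) := by
    intro v v' hv hv' n
    have h1 := ((hfinv.iterate n).tendsto (ψ v)).comp
      (hyt (fun _ => v) v hv (fun _ => hv) tendsto_const_nhds)
    have h2 := ((hfinv.iterate n).tendsto (ψ v')).comp
      (hyt (fun _ => v') v' hv' (fun _ => hv') tendsto_const_nhds)
    refine le_of_tendsto (h1.edist h2) ?_
    filter_upwards [h𝒰 (hm.eventually_ge_atTop n)] with k hk
    exact (hd k).contraction v v' hv hv' n hk
  have hψc : ContinuousOn ψ (Metric.closedBall 0 δ) := by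
    intro v hv
    rw [mem_closedBall_zero_iff] at hv
    rw [ContinuousWithinAt, tendsto_iff_edist_tendsto_0]
    have h2 : Tendsto (fun v' => ENNReal.ofReal (T.C ^ 2 * (τ ^ 0 * ‖v' - v‖)))
        (𝓝[Metric.closedBall 0 δ] v) (𝓝 0) := by
      have h3 : Continuous (fun v' => ENNReal.ofReal (T.C ^ 2 * (τ ^ 0 * ‖v' - v‖))) :=
        ENNReal.continuous_ofReal.comp (by fun_prop)
      simpa using (h3.tendsto v).mono_left nhdsWithin_le_nhds
    refine tendsto_of_tendsto_of_tendsto_of_le_of_le' tendsto_const_nhds h2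
      (Eventually.of_forall fun k => zero_le) ?_
    filter_upwards [self_mem_nhdsWithin] with v' hv'
    rw [mem_closedBall_zero_iff] at hv'
    exact hcontr v' v hv' hv 0
  -- The limit disk is in `Λ` and tangent to the centre-unstable direction.
  have hlim : ∀ v, ‖v‖ ≤ δ' → ψ v ∈ T.dom c ∧ ∀ v', ‖v'‖ ≤ δ →
      ‖(ξ v' - ξ v) - T.proj c (ψ v) (ξ v' - ξ v)‖ ≤ K * ‖v' - v‖ ^ T.α * ‖v' - v‖ := by
    intro v hv
    have hvδ := hv.trans hδ'
    choose u hu1 hu2 hu3 hu4 using fun k => (hd k).dense v hv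
    have huv : Tendsto u 𝒰 (𝓝 v) := by
      rw [tendsto_iff_norm_sub_tendsto_zero]
      exact squeeze_zero (fun k => norm_nonneg _) hu2 (ht.mono_left h𝒰)
    have hyu := hyt u v hvδ hu1 huv
    have hdomu : ∀ᶠ k in 𝒰, y k (u k) ∈ T.dom c := by
      filter_upwards [hc, hchart, hxc] with k hk hk' hxk
      have h1 := T.mem_dom (x k) (hd k).mem (y k (u k)) ((hd k).mem_source _ (hu1 k))
      rw [hk] at h1
      refine h1 ?_ (hu3 k)
      rw [hk' _ (hu1 k), add_sub_cancel_left]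
      refine ((T.frame_le c _ hxk _).trans (mul_le_mul_of_nonneg_left
        (max_le (hu1 k) ((hd k).norm_le _ (hu1 k))) hC0.le)).trans (by linarith)
    have hψd : ψ v ∈ T.dom c := (T.isCompact_dom c).isClosed.mem_of_tendsto hyu hdomu
    refine ⟨hψd, fun v' hv' => ?_⟩
    have h1 : Tendsto (fun k => T.proj c (y k (u k))) 𝒰 (𝓝 (T.proj c (ψ v))) :=
      ((T.continuousOn_proj c) _ hψd).tendsto.comp (tendsto_nhdsWithin_iff.2 ⟨hyu, hdomu⟩)
    have h2 := (hξt (fun _ => v') v' hv' (fun _ => hv') tendsto_const_nhds).sub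
      (hξt u v hvδ hu1 huv)
    have h3 := (h2.sub (tendsto_clm_apply h1 h2)).norm
    have h4 : Tendsto (fun k => ‖v' - u k‖) 𝒰 (𝓝 ‖v' - v‖) := (tendsto_const_nhds.sub huv).norm
    have h5 : Tendsto (fun k => K * (t k + ‖v' - u k‖ ^ T.α) * ‖v' - u k‖) 𝒰
        (𝓝 (K * (0 + ‖v' - v‖ ^ T.α) * ‖v' - v‖)) :=
      (((ht.mono_left h𝒰).add (h4.rpow_const (Or.inr T.α_pos.le))).const_mul K).mul h4
    rw [zero_add] at h5
    refine le_of_tendsto_of_tendsto h3 h5 ?_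
    filter_upwards [hc] with k hk
    have h6 := hu4 k v' hv'
    rwa [hk] at h6
  refine ⟨c, z, hz, Θ, H, ?_, fun v hv => ⟨(hΘδ v (hv.le.trans hδ')).trans (by linarith),
    T.dom_subset c (hlim v hv.le).1⟩,
    fun v v' hv hv' => hcontr v v' (hv.le.trans hδ') (hv'.le.trans hδ')⟩
  -- The limit graph is of class `C^1`. The second coordinate of a secant minus its projection is a linear
  -- function `W v` of the increments of the graph.
  set W : X → (X × Y →L[ℝ] Y) := fun v => (ContinuousLinearMap.snd ℝ X Y) ∘L
    (Θ₂ ∘L ((1 - T.proj c (ψ v)) ∘L Θ₁)) with hW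
  have hWc : ContinuousOn W (Metric.ball 0 δ') := by
    have h1 : ContinuousOn (fun v => T.proj c (ψ v)) (Metric.ball 0 δ') := by
      refine (T.continuousOn_proj c).comp (hψc.mono fun v hv => ?_) fun v hv => ?_
      · rw [mem_ball_zero_iff] at hv; rw [mem_closedBall_zero_iff]; exact hv.le.trans hδ'
      · rw [mem_ball_zero_iff] at hv; exact (hlim v hv.le).1
    exact continuousOn_const.clm_comp (continuousOn_const.clm_comp
      ((continuousOn_const.sub h1).clm_comp continuousOn_const))
  refine contDiffOn_one_of_secant Metric.isOpen_ball
    (S := fun v => W v ∘L ContinuousLinearMap.inl ℝ X Y)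
    (R := fun v => W v ∘L ContinuousLinearMap.inr ℝ X Y) (hWc.clm_comp continuousOn_const)
    (hWc.clm_comp continuousOn_const) ?_ (K := T.C * K) T.α_pos ?_
  · intro v hv
    rw [mem_ball_zero_iff] at hv
    have hvδ := hv.le.trans hδ'
    have h1 : ‖T.proj c (ψ v) - T.proj c z‖ ≤ 1 / (2 * T.C ^ 2) :=
      hproj c z hz _ (hlim v hv.le).1 (by rw [(hψ v hvδ).2]; exact hξr v hvδ)
    refine ContinuousLinearMap.opNorm_le_bound _ (by norm_num) fun w => ?_
    have h2 : (W v ∘L ContinuousLinearMap.inr ℝ X Y - 1) w =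
        -(Θ₂ ((T.proj c (ψ v) - T.proj c z) (Θ₁ (0, w)))).2 := by
      rw [hprojz]
      simp [hW, h21]
    rw [h2, norm_neg]
    calc _ ≤ ‖Θ₂ ((T.proj c (ψ v) - T.proj c z) (Θ₁ (0, w)))‖ := norm_snd_le _
      _ ≤ T.C * (1 / (2 * T.C ^ 2) * (T.C * ‖((0 : X), w)‖)) := by
        refine (Θ₂.le_of_opNorm_le hΘ₂n _).trans ?_
        gcongr
        refine ((T.proj c (ψ v) - T.proj c z).le_of_opNorm_le h1 _).trans ?_
        gcongr
        exact hΘ₁n _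
      _ = 1 / 2 * ‖w‖ := by
        rw [show ‖((0 : X), w)‖ = ‖w‖ by simp [Prod.norm_def]]
        field_simp
  · intro v hv v' hv'
    rw [mem_ball_zero_iff] at hv hv'
    have h1 := (hlim v hv.le).2 v' (hv'.le.trans hδ')
    have h2 : ξ v' - ξ v = Θ₁ (v' - v, H v' - H v) := by
      have : ξ v' - ξ v = Θ (v', H v') - Θ (v, H v) := by simp [ξ]
      rw [this, ← map_sub]; rfl
    have h3 : (W v ∘L ContinuousLinearMap.inl ℝ X Y) (v' - v) +
        (W v ∘L ContinuousLinearMap.inr ℝ X Y) (H v' - H v) =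
        (Θ₂ ((ξ v' - ξ v) - T.proj c (ψ v) (ξ v' - ξ v))).2 := by
      have h4 : (W v ∘L ContinuousLinearMap.inl ℝ X Y) (v' - v) +
          (W v ∘L ContinuousLinearMap.inr ℝ X Y) (H v' - H v) = W v (v' - v, H v' - H v) := by
        rw [ContinuousLinearMap.comp_apply (W v), ContinuousLinearMap.comp_apply (W v),
          ← map_add (W v)]
        simp
      rw [h4, h2]
      rfl
    rw [h3]
    calc _ ≤ ‖Θ₂ ((ξ v' - ξ v) - T.proj c (ψ v) (ξ v' - ξ v))‖ := norm_snd_le _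
      _ ≤ T.C * (K * ‖v' - v‖ ^ T.α * ‖v' - v‖) := (Θ₂.le_of_opNorm_le hΘ₂n _).trans
        (mul_le_mul_of_nonneg_left h1 hC0.le)
      _ = _ := by ring

/-- A disk transverse to the centre-stable direction which meets `Λ` in a set of positive measure of
expanding points: its iterates accumulate on a `C^1` disk contained in `Λ`. -/
theorem TransverseDisk.exists_unstable_graph [Finite ι] [Nontrivial X] [FiniteDimensional ℝ X]
    [FiniteDimensional ℝ Y] [FiniteDimensional ℝ E]
    [MeasurableSpace X] [BorelSpace X] {T : CuAtlas X Y E ι f Λ} (μ : Measure X)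
    [μ.IsAddHaarMeasure] (hinv : MapsTo f Λ Λ) (hf : Continuous f) {finv : M → M}
    (hfinv : Continuous finv) (hff : Function.LeftInverse finv f) {φ : X → M} {S : Set X}
    (hφ : TransverseDisk T φ S) (hS : MeasurableSet S) (hSfin : μ S ≠ ⊤) (hS0 : μ S ≠ 0) :
    ∃ δ > 0, ∃ τ, 0 < τ ∧ τ < 1 ∧
    ∃ c, ∃ z ∈ T.dom c, ∃ (Θ : (X × Y) ≃L[ℝ] E) (H : X → Y), ContDiffOn ℝ 1 H (Metric.ball 0 δ) ∧
      (∀ v, ‖v‖ < δ → ‖Θ (v, H v)‖ ≤ T.r ∧ T.par c (T.chart c z + Θ (v, H v)) ∈ Λ) ∧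
      ∀ v v', ‖v‖ < δ → ‖v'‖ < δ → ∀ n,
        edist (finv^[n] (T.par c (T.chart c z + Θ (v, H v))))
          (finv^[n] (T.par c (T.chart c z + Θ (v', H v')))) ≤
        ENNReal.ofReal (T.C ^ 2 * (τ ^ n * ‖v - v'‖)) := by
  have hC := T.one_le
  have hC0 : 0 < T.C := by linarith
  obtain ⟨δ₂, hδ₂, hproj⟩ := T.exists_norm_proj_sub_le (ε₀ := 1 / (2 * T.C ^ 2)) (by positivity)
  obtain ⟨δ₁, hδ₁, s, hs, hs1, K', hsec⟩ := T.exists_secant_le μ hinv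
  have hr := T.r_pos
  obtain ⟨δ, δ', τ, N, K, hδ, hδ1, hδ', hδ'δ, hτ0, hτ1, hdense⟩ :=
    hφ.exists_dense_preDisk μ hinv hf hS hSfin hS0 hs hs1
      (δ₁ := min δ₁ (min (δ₂ / T.C) (T.r / (2 * T.C)))) (by positivity)
  have hδδ₁ : δ ≤ δ₁ := hδ1.trans (min_le_left _ _)
  have hδδ₂ : T.C * δ ≤ δ₂ := by
    have := hδ1.trans ((min_le_right _ _).trans (min_le_left _ _))
    rwa [le_div_iff₀ hC0, mul_comm] at this
  have hδr : 2 * (T.C * δ) ≤ T.r := by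
    have := hδ1.trans ((min_le_right _ _).trans (min_le_right _ _))
    rw [le_div_iff₀ (by positivity)] at this
    linarith
  have happ : ∀ k : ℕ, ∃ (x : M) (y : X → M) (h : X → Y), ApproxDisk T finv δ (δ' / 2) τ |K'|
      (1 / ((k : ℝ) + 1) + T.lam ^ k) k x y h := by
    intro k
    obtain ⟨p, hpS, n, hnk, hNn, V, hV, hVd⟩ := hdense (1 / ((k : ℝ) + 1)) (by positivity) (N + k)
    obtain ⟨g, -, hg, hg'⟩ := hV.exists_inverse
    simp only [mem_closedBall_zero_iff] at hg
    have hlam : T.lam ^ (n - N) ≤ T.lam ^ k :=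
      pow_le_pow_of_le_one T.lam_nonneg T.lam_lt.le (by omega)
    have hpn : f^[n] (φ p) ∈ Λ := hinv.iterate n (hφ.mem p hpS)
    have hsn : ∀ v, ‖v‖ ≤ δ → T.track φ p n (g v) = (v, (T.track φ p n (g v)).2) := fun v hv =>
      Prod.ext (hg v hv).2 rfl
    refine ⟨f^[n] (φ p), fun v => f^[n] (φ (g v)), fun v => (T.track φ p n (g v)).2, hpn,
      fun v hv => hV.mem_source _ (hg v hv).1 n hNn le_rfl, hsn,
      fun v hv => (norm_snd_le _).trans (hV.norm_le _ (hg v hv).1 n hNn le_rfl), ?_, ?_, ?_⟩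
    · intro v v' hv hv'
      have h1 := hV.slope _ (hg v hv).1 _ (hg v' hv').1 n hNn le_rfl
      rw [(hg v hv).2, (hg v' hv').2] at h1
      exact h1.trans (mul_le_of_le_one_left (norm_nonneg _) hs1)
    · intro v v' hv hv' j hj
      have hjn : n - j ≤ n := Nat.sub_le _ _
      have hback : ∀ w, finv^[j] (f^[n] w) = f^[n - j] w := by
        intro w
        have : f^[n] w = f^[j] (f^[n - j] w) := by
          rw [← Function.iterate_add_apply]; congr 2; omega
        rw [this, hff.iterate j]
      have h1 := hV.contraction _ (hg v hv).1 _ (hg v' hv').1 (n - j) (by omega) hjn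
      rw [(hg v hv).2, (hg v' hv').2, show n - (n - j) = j by omega] at h1
      set q := f^[n - j] (φ p)
      have hq : q ∈ T.dom (T.idx q) := T.mem_dom_idx _ (hinv.iterate _ (hφ.mem p hpS))
      have h2 : ∀ v, ‖v‖ ≤ δ → ‖T.chart (T.idx q) (f^[n - j] (φ (g v))) - T.chart (T.idx q) q‖ ≤ T.r :=
        fun v hv => (T.norm_chart_sub_self_le hq
          (hV.norm_le _ (hg v hv).1 (n - j) (by omega) hjn)).trans (by
            have : 0 < T.C * δ := by positivity
            linarith)
      rw [hback, hback]
      refine (T.edist_le (T.idx q) q hq _ (hV.mem_source _ (hg v hv).1 _ (by omega) hjn) _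
        (hV.mem_source _ (hg v' hv').1 _ (by omega) hjn) (h2 v hv) (h2 v' hv')).trans
        (ENNReal.ofReal_le_ofReal ?_)
      calc _ ≤ T.C * (T.C * ‖T.track φ p (n - j) (g v) - T.track φ p (n - j) (g v')‖) :=
            mul_le_mul_of_nonneg_left (T.norm_chart_sub_le hq _ _) hC0.le
        _ ≤ T.C * (T.C * (τ ^ j * ‖v - v'‖)) := by gcongr
        _ = _ := by ring
    · intro v hv
      obtain ⟨q, hqV, hqS, hq⟩ := hVd v hv
      set u := (T.track φ p n q).1
      have hu : ‖u‖ ≤ δ := (norm_fst_le _).trans (hV.norm_le q hqV n hNn le_rfl)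
      have hgu : g u = q := hg' q hqV
      have ht0 : 0 ≤ T.lam ^ k := pow_nonneg T.lam_nonneg k
      refine ⟨u, hu, by linarith, ?_, fun v' hv' => ?_⟩
      · simp only [hgu]; exact hinv.iterate n (hφ.mem q hqS)
      · have h1 := hsec φ p N n δ τ K V hδ hδδ₁ hτ0.le hτ1.le hNn (hφ.mem p hpS) hV q hqV
          (hφ.mem q hqS) (g v') (hg v' hv').1
        rw [(hg v' hv').2] at h1
        simp only [hgu]
        refine h1.trans (mul_le_mul_of_nonneg_right ?_ (norm_nonneg _))
        have h2 : 0 ≤ T.lam ^ (n - N) + ‖v' - u‖ ^ T.α :=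
          add_nonneg (pow_nonneg T.lam_nonneg _) (by positivity)
        have h3 : 0 < 1 / ((k : ℝ) + 1) := by positivity
        refine mul_le_mul (le_abs_self K') ?_ h2 (abs_nonneg _)
        change T.lam ^ (n - N) + ‖v' - u‖ ^ T.α ≤ _ + ‖v' - u‖ ^ T.α
        linarith
  choose x y h hd using happ
  have ht : Tendsto (fun k : ℕ => 1 / ((k : ℝ) + 1) + T.lam ^ k) atTop (𝓝 0) := by
    simpa using tendsto_one_div_add_atTop_nhds_zero_nat.add
      (tendsto_pow_atTop_nhds_zero_of_lt_one T.lam_nonneg T.lam_lt)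
  obtain ⟨c, z, hz, Θ, H, hH⟩ := T.exists_limit_disk hfinv hδ
    (by linarith) hδr (fun c q hq q' hq' hqq' => hproj c q hq q' hq' (hqq'.trans hδδ₂)) ht
    tendsto_id hd
  exact ⟨δ' / 2, half_pos hδ', τ, hτ0, hτ1, c, z, hz, Θ, H, hH⟩

end

/-! ### Centre-unstable atlases from local data -/

section

/-- A local property with two constants, monotone in them, holds with uniform constants on a compact
set. -/
theorem _root_.IsCompact.exists_uniform_constants {M : Type*} [TopologicalSpace M] {K : Set M}
    (hK : IsCompact K) {P : ℝ → ℝ → M → Prop}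
    (hmono : ∀ C C' r r' q, C ≤ C' → r' ≤ r → P C r q → P C' r' q)
    (hloc : ∀ q ∈ K, ∃ C, ∃ r > 0, ∀ᶠ q' in 𝓝[K] q, P C r q') :
    ∃ C, ∃ r > 0, ∀ q ∈ K, P C r q := by
  refine hK.induction_on (p := fun s => ∃ C, ∃ r > 0, ∀ q ∈ s, P C r q)
    ⟨0, 1, one_pos, fun q hq => hq.elim⟩ ?_ ?_ ?_
  · rintro s t hst ⟨C, r, hr, h⟩
    exact ⟨C, r, hr, fun q hq => h q (hst hq)⟩
  · rintro s t ⟨C, r, hr, h⟩ ⟨C', r', hr', h'⟩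
    refine ⟨max C C', min r r', lt_min hr hr', ?_⟩
    rintro q (hq | hq)
    · exact hmono _ _ _ _ q (le_max_left _ _) (min_le_left _ _) (h q hq)
    · exact hmono _ _ _ _ q (le_max_right _ _) (min_le_right _ _) (h' q hq)
  · intro q hq
    obtain ⟨C, r, hr, h⟩ := hloc q hq
    exact ⟨{q' | P C r q'}, h, C, r, hr, fun _ h => h⟩

/-- The analogue of `IsCompact.exists_uniform_constants` for a finite family. -/
theorem exists_uniform_constants_of_finite {ι : Type*} [Finite ι] {P : ℝ → ℝ → ι → Prop}
    (hmono : ∀ C C' r r' i, C ≤ C' → r' ≤ r → P C r i → P C' r' i)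
    (h : ∀ i, ∃ C, ∃ r > 0, P C r i) : ∃ C, ∃ r > 0, ∀ i, P C r i := by
  let _ : TopologicalSpace ι := ⊥
  have : DiscreteTopology ι := ⟨rfl⟩
  have := (finite_univ (α := ι)).isCompact.exists_uniform_constants hmono fun i _ => by
    obtain ⟨C, r, hr, h⟩ := h i
    refine ⟨C, r, hr, ?_⟩
    rw [nhdsWithin_univ, nhds_discrete]
    exact h
  simpa using this

theorem DominatedStep.mono {X Y : Type*} [NormedAddCommGroup X] [NormedSpace ℝ X]
    [NormedAddCommGroup Y] [NormedSpace ℝ Y] {A : X ≃L[ℝ] X} {D : Y →L[ℝ] Y} {nX nX' : Seminorm ℝ X}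
    {nY nY' : Seminorm ℝ Y} {C C' lam : ℝ} (h : DominatedStep A D nX nX' nY nY' C lam)
    (hC : C ≤ C') : DominatedStep A D nX nX' nY nY' C' lam where
  one_le := h.one_le.trans hC
  lam_nonneg := h.lam_nonneg
  lam_le_one := h.lam_le_one
  norm_symm_le := h.norm_symm_le.trans hC
  nX_le u := (h.nX_le u).trans (by gcongr)
  le_nX u := (h.le_nX u).trans (mul_le_mul_of_nonneg_right hC (apply_nonneg _ _))
  nX'_le u := (h.nX'_le u).trans (by gcongr)
  le_nX' u := (h.le_nX' u).trans (mul_le_mul_of_nonneg_right hC (apply_nonneg _ _))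
  nY_le u := (h.nY_le u).trans (by gcongr)
  nY'_le u := (h.nY'_le u).trans (by gcongr)
  dominated := h.dominated

/-- The local data from which the charts of `CuAtlas` are obtained by compactness: a chart `e c` at
each point `c`, the frames of the splitting read in these charts, and local versions of the
estimates. -/
structure LocalCuData {M : Type*} [EMetricSpace M] (X Y E : Type*) [NormedAddCommGroup X]
    [NormedSpace ℝ X] [NormedAddCommGroup Y] [NormedSpace ℝ Y] [NormedAddCommGroup E]
    [NormedSpace ℝ E] (f : M → M) (Λ : Set M) where
  e : M → OpenPartialHomeomorph M E
  frame : M → M → (X × Y) ≃L[ℝ] E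
  A : M → X ≃L[ℝ] X
  D : M → Y →L[ℝ] Y
  nX : M → Seminorm ℝ X
  nY : M → Seminorm ℝ Y
  α : ℝ
  lam : ℝ
  α_pos : 0 < α
  α_le : α ≤ 1
  lam_nonneg : 0 ≤ lam
  lam_lt : lam < 1
  mem_source : ∀ x, x ∈ (e x).source
  edist_le : ∀ c ∈ Λ, ∃ C : ℝ, ∃ N ∈ 𝓝 (e c c), ∀ ξ ∈ N, ∀ ξ' ∈ N,
    edist ((e c).symm ξ) ((e c).symm ξ') ≤ ENNReal.ofReal (C * ‖ξ - ξ'‖)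
  approx : ∀ c c', ∀ q₀ ∈ Λ, q₀ ∈ (e c).source → f q₀ ∈ (e c').source → ∃ C, ∃ r > 0,
    ∀ᶠ q in 𝓝[Λ] q₀, ∀ ρ ≤ r, ∀ ξ ξ', ‖ξ - e c q‖ ≤ ρ → ‖ξ' - e c q‖ ≤ ρ →
      ‖e c' (f ((e c).symm ξ)) - e c' (f ((e c).symm ξ')) - frame c' (f q)
        ((A q : X →L[ℝ] X).prodMap (D q) ((frame c q).symm (ξ - ξ')))‖ ≤ C * ρ ^ α * ‖ξ - ξ'‖
  frame_le : ∀ c ∈ Λ, ∃ C, ∀ᶠ q in 𝓝[Λ] c, (∀ w, ‖frame c q w‖ ≤ C * ‖w‖) ∧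
    ∀ ξ, ‖(frame c q).symm ξ‖ ≤ C * ‖ξ‖
  step : ∃ C, ∀ q ∈ Λ, DominatedStep (A q) (D q) (nX q) (nX (f q)) (nY q) (nY (f q)) C lam ∧
    ∀ z, ‖z‖ ≤ C * nY q z
  continuousAt_proj : ∀ c ∈ Λ, ∀ᶠ q₀ in 𝓝[Λ] c, ContinuousWithinAt (fun q =>
    ((frame c q : X × Y →L[ℝ] E) ∘L ((ContinuousLinearMap.inl ℝ X Y) ∘L
      (ContinuousLinearMap.fst ℝ X Y))) ∘L ((frame c q).symm : E →L[ℝ] X × Y)) Λ q₀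

namespace LocalCuData

variable {M X Y E : Type*} [EMetricSpace M] [NormedAddCommGroup X]
    [NormedSpace ℝ X] [NormedAddCommGroup Y] [NormedSpace ℝ Y] [NormedAddCommGroup E]
    [NormedSpace ℝ E] {f : M → M} {Λ : Set M} (L : LocalCuData X Y E f Λ)

/-- A radius on which all the local data around one chart are uniform. -/
theorem exists_radius {c : M} (hc : c ∈ Λ) : ∃ C, ∃ R > 0,
    Metric.closedBall (L.e c c) (4 * R) ⊆ (L.e c).target ∧
    (∀ ξ ∈ Metric.closedBall (L.e c c) (4 * R), ∀ ξ' ∈ Metric.closedBall (L.e c c) (4 * R),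
      edist ((L.e c).symm ξ) ((L.e c).symm ξ') ≤ ENNReal.ofReal (C * ‖ξ - ξ'‖)) ∧
    ∀ ξ ∈ Metric.closedBall (L.e c c) (4 * R), (L.e c).symm ξ ∈ Λ →
      (∀ w, ‖L.frame c ((L.e c).symm ξ) w‖ ≤ C * ‖w‖) ∧
      (∀ η, ‖(L.frame c ((L.e c).symm ξ)).symm η‖ ≤ C * ‖η‖) ∧
      ContinuousWithinAt (fun q =>
        ((L.frame c q : X × Y →L[ℝ] E) ∘L ((ContinuousLinearMap.inl ℝ X Y) ∘L
        (ContinuousLinearMap.fst ℝ X Y))) ∘L ((L.frame c q).symm : E →L[ℝ] X × Y)) Λ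
        ((L.e c).symm ξ) := by
  obtain ⟨C₁, N, hN, hC₁⟩ := L.edist_le c hc
  obtain ⟨C₂, hC₂⟩ := L.frame_le c hc
  have h1 := hC₂.and (L.continuousAt_proj c hc)
  rw [eventually_nhdsWithin_iff, ← (L.e c).symm_map_nhds_eq (L.mem_source c), eventually_map] at h1
  have h2 : (L.e c).target ∈ 𝓝 (L.e c c) :=
    (L.e c).open_target.mem_nhds ((L.e c).map_source (L.mem_source c))
  obtain ⟨t, ht, hts⟩ := Metric.nhds_basis_closedBall.mem_iff.1 (inter_mem (inter_mem hN h2) h1)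
  refine ⟨max C₁ C₂, t / 4, by positivity, ?_⟩
  rw [show 4 * (t / 4) = t by ring]
  refine ⟨fun ξ hξ => (hts hξ).1.2, fun ξ hξ ξ' hξ' => ?_, fun ξ hξ hξΛ => ?_⟩
  · refine (hC₁ ξ (hts hξ).1.1 ξ' (hts hξ').1.1).trans (ENNReal.ofReal_le_ofReal ?_)
    exact mul_le_mul_of_nonneg_right (le_max_left _ _) (norm_nonneg _)
  · obtain ⟨⟨h3, h4⟩, h5⟩ := (hts hξ).2 hξΛ
    exact ⟨fun w => (h3 w).trans (mul_le_mul_of_nonneg_right (le_max_right _ _) (norm_nonneg _)),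
      fun w => (h4 w).trans (mul_le_mul_of_nonneg_right (le_max_right _ _) (norm_nonneg _)), h5⟩

/-- Finitely many charts of the local data cover the compact set `Λ` and form an atlas. -/
theorem exists_cuAtlas [ProperSpace E] (hΛ : IsCompact Λ) (hne : Λ.Nonempty) (hf : Continuous f) :
    ∃ (t : Finset M) (T : CuAtlas X Y E t f Λ),
      (∀ c : t, T.chart c = L.e c) ∧ (∀ c : t, T.par c = (L.e c).symm) ∧
      (∀ c : t, T.source c = (L.e c).source) ∧ (∀ c : t, ∀ ξ, ∀ q ∈ T.dom c,
        ‖ξ - L.e c q‖ ≤ T.r → ξ ∈ (L.e c).target) ∧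
      (∀ c : t, T.frame c = L.frame c) ∧ T.A = L.A := by
  classical
  choose! C₀ R hR htarget hedist hframe using fun c hc => L.exists_radius (c := c) hc
  obtain ⟨t, htΛ, hcover⟩ := hΛ.elim_nhds_subcover
    (fun c => (L.e c).source ∩ L.e c ⁻¹' Metric.ball (L.e c c) (R c)) fun c hc =>
      ((L.e c).isOpen_inter_preimage Metric.isOpen_ball).mem_nhds
        ⟨L.mem_source c, Metric.mem_ball_self (hR c hc)⟩
  have hidx : ∀ q, ∃ c : t, q ∈ Λ → q ∈ (L.e c).source ∧ ‖L.e c q - L.e c c‖ < R c := by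
    intro q
    obtain ⟨q₀, hq₀⟩ := hne
    by_cases hq : q ∈ Λ
    · obtain ⟨c, hc, hqc⟩ := mem_iUnion₂.1 (hcover hq)
      exact ⟨⟨c, hc⟩, fun _ => ⟨hqc.1, by simpa [dist_eq_norm] using hqc.2⟩⟩
    · obtain ⟨c, hc, -⟩ := mem_iUnion₂.1 (hcover hq₀)
      exact ⟨⟨c, hc⟩, fun h => absurd h hq⟩
  choose idx hidx using hidx
  -- The balls of radius `R` around the centres of the charts cover `Λ`. The points of `Λ` in the ball of
  -- radius `2 * R` form `dom`; their `r`-neighbourhoods lie in the ball of radius `3 * R`, and the local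
  -- data are valid on the ball of radius `4 * R`.
  set ball : t → ℝ → Set E := fun c k => Metric.closedBall (L.e c c) (k * R c)
  set dom : t → Set M := fun c => Λ ∩ (L.e c).symm '' ball c 2
  have hRc : ∀ c : t, 0 < R c := fun c => hR c (htΛ c c.2)
  have hball : ∀ (c : t) k, k ≤ 4 → ball c k ⊆ (L.e c).target := fun c k hk =>
    (Metric.closedBall_subset_closedBall
      (mul_le_mul_of_nonneg_right hk (hRc c).le)).trans (htarget c (htΛ c c.2))
  have hmemball : ∀ (c : t) k ξ, ξ ∈ ball c k ↔ ‖ξ - L.e c c‖ ≤ k * R c := fun c k ξ => by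
    simp [ball, dist_eq_norm]
  have hcompact : ∀ (c : t) k, k ≤ 4 → IsCompact ((L.e c).symm '' ball c k) := fun c k hk =>
    (isCompact_closedBall _ _).image_of_continuousOn ((L.e c).continuousOn_symm.mono (hball c k hk))
  have hdomc : ∀ c, IsCompact (dom c) := fun c =>
    (hcompact c 2 (by norm_num)).inter_left hΛ.isClosed
  have hdom : ∀ (c : t), ∀ q ∈ dom c, q ∈ Λ ∧ q ∈ (L.e c).source ∧ L.e c q ∈ ball c 2 ∧
      (L.e c).symm (L.e c q) = q := by
    rintro c q ⟨hq, ξ, hξ, rfl⟩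
    have h1 := hball c 2 (by norm_num) hξ
    refine ⟨hq, (L.e c).map_target h1, ?_, ?_⟩
    · rw [(L.e c).right_inv h1]; exact hξ
    · rw [(L.e c).right_inv h1]
  have hnear : ∀ (c : t), ∀ q ∈ dom c, ∀ ξ, ‖ξ - L.e c q‖ ≤ R c → ξ ∈ ball c 3 := by
    intro c q hq ξ hξ
    have h1 := (hmemball c 2 _).1 (hdom c q hq).2.2.1
    rw [hmemball]
    have := norm_sub_le_norm_sub_add_norm_sub ξ (L.e c q) (L.e c c)
    linarith
  have hball34 : ∀ (c : t) k, k ≤ 4 → ball c k ⊆ Metric.closedBall (L.e c c) (4 * R c) :=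
    fun c k hk => Metric.closedBall_subset_closedBall (mul_le_mul_of_nonneg_right hk (hRc c).le)
  -- Uniform constants.
  obtain ⟨C₁, hC₁⟩ := L.step
  obtain ⟨C₂, r₂, hr₂, h₂⟩ : ∃ C, ∃ r > 0, ∀ c : t, C₀ c ≤ C ∧ r ≤ R c := by
    refine exists_uniform_constants_of_finite (P := fun C r (c : t) => C₀ c ≤ C ∧ r ≤ R c)
      (fun C C' r r' i hC hr h => ⟨h.1.trans hC, hr.trans h.2⟩) fun c => ⟨C₀ c, R c, hRc c, le_rfl, le_rfl⟩
  obtain ⟨C₃, r₃, hr₃, h₃⟩ : ∃ C, ∃ r > 0, ∀ c : t × t, ∀ q ∈ dom c.1, f q ∈ dom c.2 →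
      (∀ ξ, ‖ξ - L.e c.1 q‖ ≤ r → f ((L.e c.1).symm ξ) ∈ (L.e c.2).source) ∧
      ∀ ρ ≤ r, ∀ ξ ξ', ‖ξ - L.e c.1 q‖ ≤ ρ → ‖ξ' - L.e c.1 q‖ ≤ ρ →
      ‖L.e c.2 (f ((L.e c.1).symm ξ)) - L.e c.2 (f ((L.e c.1).symm ξ')) - L.frame c.2 (f q)
        ((L.A q : X →L[ℝ] X).prodMap (L.D q) ((L.frame c.1 q).symm (ξ - ξ')))‖ ≤
        C * ρ ^ L.α * ‖ξ - ξ'‖ := by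
    refine exists_uniform_constants_of_finite (P := fun C r (c : t × t) =>
      ∀ q ∈ dom c.1, f q ∈ dom c.2 →
      (∀ ξ, ‖ξ - L.e c.1 q‖ ≤ r → f ((L.e c.1).symm ξ) ∈ (L.e c.2).source) ∧
      ∀ ρ ≤ r, ∀ ξ ξ', ‖ξ - L.e c.1 q‖ ≤ ρ → ‖ξ' - L.e c.1 q‖ ≤ ρ →
      ‖L.e c.2 (f ((L.e c.1).symm ξ)) - L.e c.2 (f ((L.e c.1).symm ξ')) - L.frame c.2 (f q)
        ((L.A q : X →L[ℝ] X).prodMap (L.D q) ((L.frame c.1 q).symm (ξ - ξ')))‖ ≤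
        C * ρ ^ L.α * ‖ξ - ξ'‖) ?_ ?_
    · intro C C' r r' c hC hr h q hq hfq
      refine ⟨fun ξ hξ => (h q hq hfq).1 ξ (hξ.trans hr), fun ρ hρ ξ ξ' hξ hξ' =>
        ((h q hq hfq).2 ρ (hρ.trans hr) ξ ξ' hξ hξ').trans ?_⟩
      have hρ0 : 0 ≤ ρ := (norm_nonneg _).trans hξ
      gcongr
    · rintro ⟨c, c'⟩
      have hK : IsCompact (dom c ∩ f ⁻¹' dom c') :=
        (hdomc c).inter_right ((hdomc c').isClosed.preimage hf)
      refine Exists.imp (fun C ⟨r, hr, h⟩ => ⟨r, hr, fun q hq hfq => h q ⟨hq, hfq⟩⟩)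
        (hK.exists_uniform_constants (P := fun C r q =>
        (∀ ξ, ‖ξ - L.e c q‖ ≤ r → f ((L.e c).symm ξ) ∈ (L.e c').source) ∧
        ∀ ρ ≤ r, ∀ ξ ξ', ‖ξ - L.e c q‖ ≤ ρ → ‖ξ' - L.e c q‖ ≤ ρ →
        ‖L.e c' (f ((L.e c).symm ξ)) - L.e c' (f ((L.e c).symm ξ')) - L.frame c' (f q)
          ((L.A q : X →L[ℝ] X).prodMap (L.D q) ((L.frame c q).symm (ξ - ξ')))‖ ≤
          C * ρ ^ L.α * ‖ξ - ξ'‖) ?_ ?_)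
      · intro C C' r r' q hC hr h
        refine ⟨fun ξ hξ => h.1 ξ (hξ.trans hr), fun ρ hρ ξ ξ' hξ hξ' =>
          (h.2 ρ (hρ.trans hr) ξ ξ' hξ hξ').trans ?_⟩
        have hρ0 : 0 ≤ ρ := (norm_nonneg _).trans hξ
        gcongr
      · rintro q₀ ⟨hq₀, hfq₀⟩
        obtain ⟨hq₀Λ, hq₀s, -, hq₀e⟩ := hdom c q₀ hq₀
        obtain ⟨C, r, hr, h⟩ := L.approx c c' q₀ hq₀Λ hq₀s (hdom c' _ hfq₀).2.1
        have h1 : ContinuousAt (fun ξ => f ((L.e c).symm ξ)) (L.e c q₀) :=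
          hf.continuousAt.comp ((L.e c).continuousAt_symm ((L.e c).map_source hq₀s))
        have h2 : (fun ξ => f ((L.e c).symm ξ)) ⁻¹' (L.e c').source ∈ 𝓝 (L.e c q₀) := by
          refine h1.preimage_mem_nhds ((L.e c').open_source.mem_nhds ?_)
          rw [hq₀e]; exact (hdom c' _ hfq₀).2.1
        obtain ⟨s, hs, hsub⟩ := Metric.nhds_basis_ball.mem_iff.1 h2
        refine ⟨C, min r (s / 2), lt_min hr (half_pos hs), ?_⟩
        have h3 : ∀ᶠ q in 𝓝 q₀, ‖L.e c q - L.e c q₀‖ < s / 2 := by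
          have h4 := (((L.e c).continuousAt hq₀s).tendsto.sub_const (L.e c q₀)).norm
          rw [sub_self, norm_zero] at h4
          exact h4.eventually_lt_const (half_pos hs)
        have h5 := nhdsWithin_mono q₀ (fun q (hq : q ∈ dom c ∩ f ⁻¹' dom c') => hq.1.1) h
        filter_upwards [h5, mem_nhdsWithin_of_mem_nhds h3] with q hq hq3
        refine ⟨fun ξ hξ => hsub ?_, fun ρ hρ => hq ρ (hρ.trans (min_le_left _ _))⟩
        rw [Metric.mem_ball, dist_eq_norm]
        have := norm_sub_le_norm_sub_add_norm_sub ξ (L.e c q) (L.e c q₀)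
        have := hξ.trans (min_le_right _ _)
        linarith
  set C : ℝ := max 1 (max C₁ (max C₂ C₃))
  have hC1 : C₁ ≤ C := (le_max_left _ _).trans (le_max_right _ _)
  have hC2 : ∀ c : t, C₀ c ≤ C := fun c => (h₂ c).1.trans
    (((le_max_left _ _).trans (le_max_right _ _)).trans (le_max_right _ _))
  have hC3 : C₃ ≤ C := ((le_max_right _ _).trans (le_max_right _ _)).trans (le_max_right _ _)
  set r : ℝ := min r₂ r₃
  have hrR : ∀ c : t, r ≤ R c := fun c => (min_le_left _ _).trans (h₂ c).2
  have hnearr : ∀ (c : t), ∀ q ∈ dom c, ∀ y ∈ (L.e c).source, ‖L.e c y - L.e c q‖ ≤ r →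
      L.e c y ∈ ball c 3 := fun c q hq y hy h => hnear c q hq _ (h.trans (hrR c))
  refine ⟨t,
    { source := fun c => (L.e c).source
      chart := fun c => L.e c
      par := fun c => (L.e c).symm
      idx := idx
      dom := dom
      frame := fun c => L.frame c
      A := L.A
      D := L.D
      nX := L.nX
      nY := L.nY
      r := r
      C := C
      α := L.α
      lam := L.lam
      r_pos := lt_min hr₂ hr₃
      one_le := le_max_left _ _
      α_pos := L.α_pos
      α_le := L.α_le
      lam_nonneg := L.lam_nonneg
      lam_lt := L.lam_lt
      isOpen_source := fun c => (L.e c).open_source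
      continuousOn_chart := fun c => (L.e c).continuousOn
      mem_dom_idx := ?_
      isCompact_dom := hdomc
      dom_subset := fun c q hq => hq.1
      dom_subset_source := fun c q hq => (hdom c q hq).2.1
      mem_dom := ?_
      par_mem := ?_
      edist_le := ?_
      norm_lt_of_edist := ?_
      map_mem := ?_
      approx := ?_
      frame_le := ?_
      symm_frame_le := ?_
      step := fun q hq => (hC₁ q hq).1.mono hC1
      le_nY := fun q hq z => ((hC₁ q hq).2 z).trans
        (mul_le_mul_of_nonneg_right hC1 (apply_nonneg _ _))
      continuousOn_proj := ?_ }, fun _ => rfl, fun _ => rfl, fun _ => rfl, ?_, fun _ => rfl, rfl⟩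
  · intro q hq
    obtain ⟨h1, h2⟩ := hidx q hq
    refine ⟨hq, L.e (idx q) q, (hmemball _ _ _).2 ?_, (L.e (idx q)).left_inv h1⟩
    have := hRc (idx q)
    linarith
  · intro q hq y hy hyq hyΛ
    obtain ⟨h1, h2⟩ := hidx q hq
    refine ⟨hyΛ, L.e (idx q) y, (hmemball _ _ _).2 ?_, (L.e (idx q)).left_inv hy⟩
    have := norm_sub_le_norm_sub_add_norm_sub (L.e (idx q) y) (L.e (idx q) q)
      (L.e (idx q) (idx q))
    have := hrR (idx q)
    linarith
  · intro c q hq ξ hξ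
    have h1 := hball c 3 (by norm_num) (hnear c q hq ξ (hξ.trans (hrR c)))
    exact ⟨(L.e c).map_target h1, (L.e c).right_inv h1⟩
  · intro c q hq y hy y' hy' hyq hyq'
    have h1 := hedist c (htΛ c c.2) (L.e c y) (hball34 c 3 (by norm_num) (hnearr c q hq y hy hyq))
      (L.e c y') (hball34 c 3 (by norm_num) (hnearr c q hq y' hy' hyq'))
    rw [(L.e c).left_inv hy, (L.e c).left_inv hy'] at h1
    refine h1.trans (ENNReal.ofReal_le_ofReal ?_)
    exact mul_le_mul_of_nonneg_right (hC2 c) (norm_nonneg _)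
  · intro ε hε
    obtain ⟨-, ε', hε', h⟩ := exists_uniform_constants_of_finite (P := fun _ ε' (c : t) =>
      ∀ y ∈ (L.e c).symm '' ball c 3, ∀ y' ∈ (L.e c).symm '' ball c 3,
        edist y y' < ENNReal.ofReal ε' → ‖L.e c y - L.e c y'‖ < ε)
      (fun C C' r r' c _ hr h y hy y' hy' hyy' =>
        h y hy y' hy' (hyy'.trans_le (ENNReal.ofReal_le_ofReal hr))) (fun c => by
        have h1 : ContinuousOn (L.e c) ((L.e c).symm '' ball c 3) := by
          refine (L.e c).continuousOn.mono ?_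
          rintro _ ⟨ξ, hξ, rfl⟩
          exact (L.e c).map_target (hball c 3 (by norm_num) hξ)
        have h2 := (hcompact c 3 (by norm_num)).uniformContinuousOn_of_continuous h1
        obtain ⟨s, hs, h3⟩ := EMetric.uniformContinuousOn_iff.1 h2 (ENNReal.ofReal ε)
          (ENNReal.ofReal_pos.2 hε)
        obtain ⟨s', hs', hs's⟩ : ∃ s' > 0, ENNReal.ofReal s' ≤ s := by
          rcases eq_or_ne s ⊤ with rfl | hst
          · exact ⟨1, one_pos, le_top⟩
          · exact ⟨s.toReal, ENNReal.toReal_pos hs.ne' hst, ENNReal.ofReal_toReal_le⟩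
        refine ⟨0, s', hs', fun y hy y' hy' hyy' => ?_⟩
        have h4 := h3 hy hy' (hyy'.trans_le hs's)
        rwa [edist_eq_enorm_sub, ← ofReal_norm, ENNReal.ofReal_lt_ofReal_iff hε] at h4)
    exact ⟨ε', hε', fun c q hq y hy y' hy' hyq hyq' hyy' => h c y
      ⟨_, hnearr c q hq y hy hyq, (L.e c).left_inv hy⟩ y'
      ⟨_, hnearr c q hq y' hy' hyq', (L.e c).left_inv hy'⟩ hyy'⟩
  · intro c c' q hq hfq y hy hyq
    have h1 := (h₃ (c, c') q hq hfq).1 (L.e c y) (hyq.trans (min_le_right _ _))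
    rwa [(L.e c).left_inv hy] at h1
  · intro c c' q hq hfq ρ hρ y hy y' hy' hyq hyq'
    have h1 := (h₃ (c, c') q hq hfq).2 ρ (hρ.trans (min_le_right _ _)) (L.e c y) (L.e c y') hyq hyq'
    rw [(L.e c).left_inv hy, (L.e c).left_inv hy'] at h1
    refine h1.trans ?_
    have hρ0 : 0 ≤ ρ := (norm_nonneg _).trans hyq
    gcongr
  · intro c q hq w
    obtain ⟨h1, h2, h3, h4⟩ := hdom c q hq
    have h5 := (hframe c (htΛ c c.2) _ (hball34 c 2 (by norm_num) h3) (by rwa [h4])).1 w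
    rw [h4] at h5
    exact h5.trans (mul_le_mul_of_nonneg_right (hC2 c) (norm_nonneg _))
  · intro c q hq w
    obtain ⟨h1, h2, h3, h4⟩ := hdom c q hq
    have h5 := (hframe c (htΛ c c.2) _ (hball34 c 2 (by norm_num) h3) (by rwa [h4])).2.1 w
    rw [h4] at h5
    exact h5.trans (mul_le_mul_of_nonneg_right (hC2 c) (norm_nonneg _))
  · intro c q hq
    obtain ⟨h1, h2, h3, h4⟩ := hdom c q hq
    have h5 := (hframe c (htΛ c c.2) _ (hball34 c 2 (by norm_num) h3) (by rwa [h4])).2.2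
    rw [h4] at h5
    exact h5.mono fun _ h => h.1
  · intro c ξ q hq hξ
    exact hball c 3 (by norm_num) (hnear c q hq ξ (hξ.trans (hrR c)))

end LocalCuData

end

/-! ### Maps with Hölder derivative and isometric frames -/

section

section HolderStrict

variable {E G H : Type*} [NormedAddCommGroup E] [NormedSpace ℝ E] [NormedAddCommGroup G]
  [NormedSpace ℝ G] [NormedAddCommGroup H] [NormedSpace ℝ H]

/-- `F` is differentiable near `a₀`, and on a ball of radius `ρ` around any point `a` close to `a₀`
it differs from its derivative at `a` by a map of Lipschitz constant `O(ρ ^ α)`. This form of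
`C^{1+α}` regularity is stable under composition. -/
def HolderStrictAt (α : ℝ) (F : E → G) (a₀ : E) : Prop :=
  ∃ C, ∃ r > 0, ∀ᶠ a in 𝓝 a₀, DifferentiableAt ℝ F a ∧ ‖fderiv ℝ F a‖ ≤ C ∧
    ∀ ρ ≤ r, ∀ ξ ξ', ‖ξ - a‖ ≤ ρ → ‖ξ' - a‖ ≤ ρ →
      ‖F ξ - F ξ' - fderiv ℝ F a (ξ - ξ')‖ ≤ C * ρ ^ α * ‖ξ - ξ'‖

/-- A map with `α`-Hölder derivative satisfies `HolderStrictAt`, by the mean value inequality. -/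
theorem holderStrictAt_of_fderiv {α : ℝ} (hα : 0 < α) {F : E → G} {a₀ : E} {V : Set E}
    (hV : V ∈ 𝓝 a₀) (hd : ∀ a ∈ V, DifferentiableAt ℝ F a) {K : ℝ}
    (hK : ∀ a ∈ V, ∀ b ∈ V, ‖fderiv ℝ F a - fderiv ℝ F b‖ ≤ K * ‖a - b‖ ^ α) :
    HolderStrictAt α F a₀ := by
  obtain ⟨s, hs, hsV⟩ := Metric.nhds_basis_ball.mem_iff.1 hV
  refine ⟨max |K| (‖fderiv ℝ F a₀‖ + |K| * s ^ α), s / 2, half_pos hs, ?_⟩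
  filter_upwards [Metric.ball_mem_nhds a₀ (half_pos hs)] with a ha
  have hae : ‖a - a₀‖ < s / 2 := by rwa [Metric.mem_ball, dist_eq_norm] at ha
  have haV : a ∈ V := hsV (Metric.ball_subset_ball (by linarith) ha)
  have ha₀V : a₀ ∈ V := hsV (Metric.mem_ball_self hs)
  refine ⟨hd a haV, le_trans ?_ (le_max_right _ _), fun ρ hρ ξ ξ' hξ hξ' => ?_⟩
  · have h1 := hK a haV a₀ ha₀V
    have h2 := norm_sub_norm_le (fderiv ℝ F a) (fderiv ℝ F a₀)
    have h3 : K * ‖a - a₀‖ ^ α ≤ |K| * s ^ α :=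
      mul_le_mul (le_abs_self K) (Real.rpow_le_rpow (norm_nonneg _) (by linarith) hα.le)
        (by positivity) (abs_nonneg _)
    linarith
  · have hρ0 : 0 ≤ ρ := (norm_nonneg _).trans hξ
    have hsub : Metric.closedBall a ρ ⊆ V := by
      intro x hx
      rw [Metric.mem_closedBall, dist_eq_norm] at hx
      refine hsV ?_
      rw [Metric.mem_ball, dist_eq_norm]
      have := norm_sub_le_norm_sub_add_norm_sub x a a₀
      linarith
    have h1 : ∀ x ∈ Metric.closedBall a ρ, ‖fderiv ℝ F x - fderiv ℝ F a‖ ≤ |K| * ρ ^ α := by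
      intro x hx
      have hx' : ‖x - a‖ ≤ ρ := by rwa [Metric.mem_closedBall, dist_eq_norm] at hx
      exact (hK x (hsub hx) a haV).trans (mul_le_mul (le_abs_self K)
        (Real.rpow_le_rpow (norm_nonneg _) hx' hα.le) (by positivity) (abs_nonneg _))
    have h2 := (convex_closedBall a ρ).norm_image_sub_le_of_norm_fderiv_le'
      (fun x hx => hd x (hsub hx)) h1 (x := ξ') (y := ξ) (by simpa [dist_eq_norm] using hξ')
      (by simpa [dist_eq_norm] using hξ)
    refine h2.trans ?_
    gcongr
    exact le_max_left _ _

/-- Maps of class `C^2`, such as changes of charts, satisfy `HolderStrictAt` for all `α ≤ 1`. -/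
theorem holderStrictAt_of_contDiffAt {α : ℝ} (hα : 0 < α) (hα1 : α ≤ 1) {F : E → G} {a₀ : E}
    (hF : ContDiffAt ℝ 2 F a₀) : HolderStrictAt α F a₀ := by
  obtain ⟨K, V, hV, hK⟩ := (hF.fderiv_right (m := 1) (by norm_num)).exists_lipschitzOnWith
  have hd : ∀ᶠ a in 𝓝 a₀, DifferentiableAt ℝ F a := by
    filter_upwards [hF.eventually (by simp)] with a ha using ha.differentiableAt (by simp)
  refine holderStrictAt_of_fderiv hα (inter_mem (inter_mem hV hd)
    (Metric.ball_mem_nhds a₀ (show (0 : ℝ) < 1 / 2 by norm_num))) (fun a ha => ha.1.2) (K := K)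
    fun a ha b hb => ?_
  have h1 := hK.dist_le_mul a ha.1.1 b hb.1.1
  rw [dist_eq_norm, dist_eq_norm] at h1
  refine h1.trans (mul_le_mul_of_nonneg_left ?_ K.2)
  have h2 : ‖a - b‖ ≤ 1 := by
    have h3 := ha.2
    have h4 := hb.2
    rw [Metric.mem_ball] at h3 h4
    rw [← dist_eq_norm]
    have := dist_triangle_right a b a₀
    linarith
  calc ‖a - b‖ = ‖a - b‖ ^ (1 : ℝ) := (Real.rpow_one _).symm
    _ ≤ ‖a - b‖ ^ α := Real.rpow_le_rpow_of_exponent_ge' (norm_nonneg _) h2 hα.le hα1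

theorem HolderStrictAt.congr {α : ℝ} {F F₁ : E → G} {a₀ : E} (h : HolderStrictAt α F a₀)
    (hF : F₁ =ᶠ[𝓝 a₀] F) : HolderStrictAt α F₁ a₀ := by
  obtain ⟨C, r, hr, hC⟩ := h
  obtain ⟨s, hs, hsF⟩ := Metric.nhds_basis_ball.mem_iff.1 hF
  refine ⟨C, min r (s / 2), lt_min hr (half_pos hs), ?_⟩
  filter_upwards [hC, hF.eventuallyEq_nhds, Metric.ball_mem_nhds a₀ (half_pos hs)] with a ha h1 h2
  rw [Metric.mem_ball, dist_eq_norm] at h2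
  have h3 : ∀ ξ, ‖ξ - a‖ ≤ s / 2 → F₁ ξ = F ξ := fun ξ hξ => hsF (by
    rw [Metric.mem_ball, dist_eq_norm]
    have := norm_sub_le_norm_sub_add_norm_sub ξ a a₀
    linarith)
  refine ⟨ha.1.congr_of_eventuallyEq h1, by rw [h1.fderiv_eq]; exact ha.2.1, ?_⟩
  intro ρ hρ ξ ξ' hξ hξ'
  rw [h1.fderiv_eq, h3 ξ (hξ.trans (hρ.trans (min_le_right _ _))),
    h3 ξ' (hξ'.trans (hρ.trans (min_le_right _ _)))]
  exact ha.2.2 ρ (hρ.trans (min_le_left _ _)) ξ ξ' hξ hξ'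

theorem HolderStrictAt.continuousAt {α : ℝ} {F : E → G} {a₀ : E} (h : HolderStrictAt α F a₀) :
    ContinuousAt F a₀ := by
  obtain ⟨C, r, hr, hC⟩ := h
  exact hC.self_of_nhds.1.continuousAt

theorem HolderStrictAt.comp {α : ℝ} (hα : 0 < α) (hα1 : α ≤ 1) {g : G → H} {F : E → G} {a₀ : E}
    (hg : HolderStrictAt α g (F a₀)) (hF : HolderStrictAt α F a₀) :
    HolderStrictAt α (fun a => g (F a)) a₀ := by
  have hFc := hF.continuousAt
  obtain ⟨C, r, hr, hC⟩ := hF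
  obtain ⟨C', r', hr', hC'⟩ := hg
  have hC0 : 0 ≤ C := (norm_nonneg _).trans hC.self_of_nhds.2.1
  have hC'0 : 0 ≤ C' := (norm_nonneg _).trans hC'.self_of_nhds.2.1
  refine ⟨C' * C + C' * (2 * C + 1) * (2 * C), min (min r 1) (r' / (2 * C + 1)), by positivity, ?_⟩
  filter_upwards [hC, hFc.eventually hC'] with a ha ha'
  have hder : fderiv ℝ (fun a => g (F a)) a = fderiv ℝ g (F a) ∘L fderiv ℝ F a :=
    fderiv_comp a ha'.1 ha.1
  have h0 : 0 ≤ C' * (2 * C + 1) * (2 * C) := by positivity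
  refine ⟨ha'.1.comp a ha.1, ?_, fun ρ hρ ξ ξ' hξ hξ' => ?_⟩
  · rw [hder]
    refine (ContinuousLinearMap.opNorm_comp_le _ _).trans ?_
    have := mul_le_mul ha'.2.1 ha.2.1 (norm_nonneg _) hC'0
    linarith
  · have hρ0 : 0 ≤ ρ := (norm_nonneg _).trans hξ
    have hρr : ρ ≤ r := hρ.trans ((min_le_left _ _).trans (min_le_left _ _))
    have hρ1 : ρ ≤ 1 := hρ.trans ((min_le_left _ _).trans (min_le_right _ _))
    have hρr' : (2 * C + 1) * ρ ≤ r' := by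
      have := hρ.trans (min_le_right _ _)
      rwa [le_div_iff₀ (by positivity), mul_comm] at this
    have hρα : ρ ^ α ≤ 1 := Real.rpow_le_one hρ0 hρ1 hα.le
    -- `F` is Lipschitz near `a`, so that it maps balls of radius `ρ` into balls of comparable radius.
    have hlip : ∀ ξ ξ', ‖ξ - a‖ ≤ ρ → ‖ξ' - a‖ ≤ ρ → ‖F ξ - F ξ'‖ ≤ 2 * C * ‖ξ - ξ'‖ := by
      intro ξ ξ' hξ hξ'
      have h1 := ha.2.2 ρ hρr ξ ξ' hξ hξ'
      have h2 : ‖fderiv ℝ F a (ξ - ξ')‖ ≤ C * ‖ξ - ξ'‖ :=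
        (fderiv ℝ F a).le_of_opNorm_le ha.2.1 _
      have h3 := norm_sub_norm_le (F ξ - F ξ') (fderiv ℝ F a (ξ - ξ'))
      have h4 : C * ρ ^ α * ‖ξ - ξ'‖ ≤ C * 1 * ‖ξ - ξ'‖ := by gcongr
      linarith
    have hball : ∀ ξ, ‖ξ - a‖ ≤ ρ → ‖F ξ - F a‖ ≤ (2 * C + 1) * ρ := by
      intro ξ hξ
      have h1 := hlip ξ a hξ (by simpa using hρ0)
      have h2 : 2 * C * ‖ξ - a‖ ≤ 2 * C * ρ := by gcongr
      linarith
    have h1 := ha'.2.2 _ hρr' (F ξ) (F ξ') (hball ξ hξ) (hball ξ' hξ')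
    have h2 := ha.2.2 ρ hρr ξ ξ' hξ hξ'
    have h3 : ((2 * C + 1) * ρ) ^ α ≤ (2 * C + 1) * ρ ^ α := by
      rw [Real.mul_rpow (by positivity) hρ0]
      gcongr
      calc (2 * C + 1) ^ α ≤ (2 * C + 1) ^ (1 : ℝ) :=
            Real.rpow_le_rpow_of_exponent_le (by linarith) hα1
        _ = _ := Real.rpow_one _
    rw [hder]
    have h4 : g (F ξ) - g (F ξ') - (fderiv ℝ g (F a) ∘L fderiv ℝ F a) (ξ - ξ') =
        (g (F ξ) - g (F ξ') - fderiv ℝ g (F a) (F ξ - F ξ')) +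
        fderiv ℝ g (F a) (F ξ - F ξ' - fderiv ℝ F a (ξ - ξ')) := by
      rw [map_sub (fderiv ℝ g (F a)) (F ξ - F ξ')]
      simp only [ContinuousLinearMap.comp_apply]
      abel
    rw [h4]
    refine (norm_add_le _ _).trans ?_
    calc _ ≤ C' * ((2 * C + 1) * ρ ^ α) * (2 * C * ‖ξ - ξ'‖) +
          C' * (C * ρ ^ α * ‖ξ - ξ'‖) := by
          gcongr
          · refine h1.trans ?_
            gcongr
            exact hlip ξ ξ' hξ hξ'
          · exact ((fderiv ℝ g (F a)).le_of_opNorm_le ha'.2.1 _).trans (by gcongr)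
      _ = _ := by ring

end HolderStrict

/-- A splitting of a Euclidean space, with orthonormal coordinates on each summand. -/
theorem exists_isometric_frame {V : Type*} [NormedAddCommGroup V] [InnerProductSpace ℝ V]
    [FiniteDimensional ℝ V] {P Q : Submodule ℝ V} (h : IsCompl P Q) {d m : ℕ}
    (hP : Module.finrank ℝ P = d) (hQ : Module.finrank ℝ Q = m) :
    ∃ W : (EuclideanSpace ℝ (Fin d) × EuclideanSpace ℝ (Fin m)) ≃L[ℝ] V,
      (∀ u, W (u, 0) ∈ P ∧ ‖W (u, 0)‖ = ‖u‖) ∧ (∀ z, W (0, z) ∈ Q ∧ ‖W (0, z)‖ = ‖z‖) := by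
  set a := (stdOrthonormalBasis ℝ P).reindex (finCongr hP)
  set b := (stdOrthonormalBasis ℝ Q).reindex (finCongr hQ)
  set W₀ : (EuclideanSpace ℝ (Fin d) × EuclideanSpace ℝ (Fin m)) ≃ₗ[ℝ] V :=
    (a.repr.symm.toLinearEquiv.prodCongr b.repr.symm.toLinearEquiv).trans
      (Submodule.prodEquivOfIsCompl P Q h)
  have hW : ∀ u z, W₀ (u, z) = (a.repr.symm u : V) + (b.repr.symm z : V) := fun u z => by
    simp [W₀]
  refine ⟨W₀.toContinuousLinearEquiv, fun u => ?_, fun z => ?_⟩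
  · have : W₀.toContinuousLinearEquiv (u, 0) = (a.repr.symm u : V) := by
      simpa using hW u 0
    rw [this]
    exact ⟨(a.repr.symm u).2, by rw [← Submodule.coe_norm, LinearIsometryEquiv.norm_map]⟩
  · have : W₀.toContinuousLinearEquiv (0, z) = (b.repr.symm z : V) := by
      simpa using hW 0 z
    rw [this]
    exact ⟨(b.repr.symm z).2, by rw [← Submodule.coe_norm, LinearIsometryEquiv.norm_map]⟩

end

/-! ### Derivatives of charts -/

section

attribute [local instance 2000] chartedSpaceSelf

section Charts

variable {E : Type*} [NormedAddCommGroup E] [NormedSpace ℝ E] {M : Type*} [TopologicalSpace M]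
  [ChartedSpace E M] [IsManifold 𝓘(ℝ, E) 1 M]

/-- The derivative at `q` of the chart at `c`, with values in the model space. -/
noncomputable def chartDeriv (c q : M) : TangentSpace 𝓘(ℝ, E) q →L[ℝ] E :=
  (trivializationAt E (TangentSpace 𝓘(ℝ, E)) c).continuousLinearMapAt ℝ q

theorem hasMFDerivAt_chartAt {c q : M} (hq : q ∈ (chartAt E c).source) :
    HasMFDerivAt 𝓘(ℝ, E) 𝓘(ℝ, E) (chartAt E c) q (chartDeriv c q) := by
  have h := (mdifferentiableAt_extChartAt (I := 𝓘(ℝ, E)) hq).hasMFDerivAt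
  rw [← TangentBundle.continuousLinearMapAt_trivializationAt hq] at h
  exact h

/-- The inverse of `chartDeriv`. -/
noncomputable def chartDerivSymm (c q : M) : E →L[ℝ] TangentSpace 𝓘(ℝ, E) q :=
  (trivializationAt E (TangentSpace 𝓘(ℝ, E)) c).symmL ℝ q

theorem chartDerivSymm_chartDeriv {c q : M} (hq : q ∈ (chartAt E c).source)
    (v : TangentSpace 𝓘(ℝ, E) q) : chartDerivSymm c q (chartDeriv c q v) = v :=
  (trivializationAt E (TangentSpace 𝓘(ℝ, E)) c).symmL_continuousLinearMapAt (R := ℝ)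
    (by simpa using hq) v

theorem chartDeriv_chartDerivSymm {c q : M} (hq : q ∈ (chartAt E c).source) (ξ : E) :
    chartDeriv c q (chartDerivSymm c q ξ) = ξ :=
  (trivializationAt E (TangentSpace 𝓘(ℝ, E)) c).continuousLinearMapAt_symmL (R := ℝ)
    (by simpa using hq) ξ

theorem hasFDerivAt_chartAt_comp {P : Type*} [NormedAddCommGroup P] [NormedSpace ℝ P] {φ : P → M}
    {p : P} {φ' : TangentSpace 𝓘(ℝ, P) p →L[ℝ] TangentSpace 𝓘(ℝ, E) (φ p)}
    (hφ : HasMFDerivAt 𝓘(ℝ, P) 𝓘(ℝ, E) φ p φ') {c : M}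
    (hp : φ p ∈ (chartAt E c).source) :
    HasFDerivAt (fun x => chartAt E c (φ x)) ((chartDeriv c (φ p)).comp φ' : P →L[ℝ] E) p :=
  hasMFDerivAt_iff_hasFDerivAt.1 ((hasMFDerivAt_chartAt hp).comp p hφ)

theorem mdifferentiableAt_chartAt_symm {c : M} {ξ : E} (hξ : ξ ∈ (chartAt E c).target) :
    MDifferentiableAt 𝓘(ℝ, E) 𝓘(ℝ, E) (chartAt E c).symm ξ :=
  mdifferentiableAt_atlas_symm (chart_mem_atlas E c) hξ

/-- The derivative of a map read in charts. -/
theorem fderiv_chart_chartDeriv {h : M → M} {c c' q : M} (hq : q ∈ (chartAt E c).source)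
    (hq' : h q ∈ (chartAt E c').source) (hh : MDifferentiableAt 𝓘(ℝ, E) 𝓘(ℝ, E) h q)
    (v : TangentSpace 𝓘(ℝ, E) q) :
    fderiv ℝ (fun ξ => chartAt E c' (h ((chartAt E c).symm ξ))) (chartAt E c q)
      (chartDeriv c q v) = chartDeriv c' (h q) (mfderiv 𝓘(ℝ, E) 𝓘(ℝ, E) h q v) := by
  set F : E → E := fun ξ => chartAt E c' (h ((chartAt E c).symm ξ))
  have hF : DifferentiableAt ℝ F (chartAt E c q) := by
    have h1 := mdifferentiableAt_chartAt_symm ((chartAt E c).map_source hq)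
    have h2 : MDifferentiableAt 𝓘(ℝ, E) 𝓘(ℝ, E) h ((chartAt E c).symm (chartAt E c q)) := by
      rwa [(chartAt E c).left_inv hq]
    have h3 := (h2.comp (chartAt E c q) h1)
    have h4 : h ((chartAt E c).symm (chartAt E c q)) ∈ (chartAt E c').source := by
      rwa [(chartAt E c).left_inv hq]
    exact (hasFDerivAt_chartAt_comp h3.hasMFDerivAt h4).differentiableAt
  have h1 : HasMFDerivAt 𝓘(ℝ, E) 𝓘(ℝ, E) (F ∘ chartAt E c) q
      ((fderiv ℝ F (chartAt E c q)).comp (chartDeriv c q)) :=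
    (hasMFDerivAt_iff_hasFDerivAt.2 hF.hasFDerivAt).comp q (hasMFDerivAt_chartAt hq)
  have h2 : HasMFDerivAt 𝓘(ℝ, E) 𝓘(ℝ, E) (chartAt E c' ∘ h) q
      ((chartDeriv (E := E) c' (h q)).comp (mfderiv 𝓘(ℝ, E) 𝓘(ℝ, E) h q)) :=
    (hasMFDerivAt_chartAt hq').comp q hh.hasMFDerivAt
  have h3 : F ∘ chartAt E c =ᶠ[𝓝 q] chartAt E c' ∘ h := by
    filter_upwards [(chartAt E c).open_source.mem_nhds hq] with y hy
    simp [F, (chartAt E c).left_inv hy]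
  have h4 := hasMFDerivAt_unique h1 (h2.congr_of_eventuallyEq h3)
  exact congrArg (fun L : TangentSpace 𝓘(ℝ, E) q →L[ℝ] E => L v) h4

section Metric

variable [RiemannianBundle (fun x : M => TangentSpace 𝓘(ℝ, E) x)]
  [IsContinuousRiemannianBundle E (fun x : M => TangentSpace 𝓘(ℝ, E) x)]

/-- Near `c`, a continuous Riemannian metric is comparable with the norm of the model space in the
chart at `c`. -/
theorem exists_norm_chartDeriv_le (c : M) : ∃ C > 0, ∀ᶠ q in 𝓝 c, ∀ v : TangentSpace 𝓘(ℝ, E) q,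
    ‖chartDeriv c q v‖ ≤ C * ‖v‖ ∧ ‖v‖ ≤ C * ‖chartDeriv c q v‖ := by
  obtain ⟨C₁, hC₁, h₁⟩ := eventually_norm_trivializationAt_lt E
    (fun x : M => TangentSpace 𝓘(ℝ, E) x) c
  obtain ⟨C₂, hC₂, h₂⟩ := eventually_norm_symmL_trivializationAt_lt E
    (fun x : M => TangentSpace 𝓘(ℝ, E) x) c
  refine ⟨max C₁ C₂, lt_max_of_lt_left hC₁, ?_⟩
  filter_upwards [h₁, h₂, (chartAt E c).open_source.mem_nhds (mem_chart_source E c)] with q h1 h2 hq v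
  refine ⟨(ContinuousLinearMap.le_of_opNorm_le _ h1.le v).trans
    (mul_le_mul_of_nonneg_right (le_max_left _ _) (norm_nonneg _)), ?_⟩
  have h3 := ContinuousLinearMap.le_of_opNorm_le _ h2.le (chartDeriv c q v)
  have h4 := chartDerivSymm_chartDeriv hq v
  rw [chartDerivSymm] at h4
  rw [h4] at h3
  exact h3.trans (mul_le_mul_of_nonneg_right (le_max_right _ _) (norm_nonneg _))

end Metric

/-- Near `c`, a Riemannian metric is comparable with the norm of the model space in the
chart at `c`. -/
theorem exists_metricNorm_chartDeriv_le [IsManifold 𝓘(ℝ, E) ∞ M]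
    (g : ContMDiffRiemannianMetric 𝓘(ℝ, E) ∞ E (fun x : M => TangentSpace 𝓘(ℝ, E) x)) (c : M) :
    ∃ C > 0, ∀ᶠ q in 𝓝 c, ∀ v : TangentSpace 𝓘(ℝ, E) q,
    ‖chartDeriv c q v‖ ≤ C * metricNorm g v ∧ metricNorm g v ≤ C * ‖chartDeriv c q v‖ := by
  let _ : RiemannianBundle (fun x : M => TangentSpace 𝓘(ℝ, E) x) := ⟨g.toRiemannianMetric⟩
  have : IsContinuousRiemannianBundle E (fun x : M => TangentSpace 𝓘(ℝ, E) x) :=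
    ⟨⟨g.inner, g.contMDiff.continuous, fun x v w => rfl⟩⟩
  obtain ⟨C, hC, h⟩ := exists_norm_chartDeriv_le (E := E) c
  have hn : ∀ q, ∀ v : TangentSpace 𝓘(ℝ, E) q, metricNorm g v = ‖v‖ := fun q v => by
    rw [norm_eq_sqrt_real_inner]; rfl
  simp only [hn]
  exact ⟨C, hC, h⟩

/-- The length for a Riemannian metric is a seminorm on each tangent space. -/
theorem exists_seminorm_metricNorm [IsManifold 𝓘(ℝ, E) ∞ M]
    (g : ContMDiffRiemannianMetric 𝓘(ℝ, E) ∞ E (fun x : M => TangentSpace 𝓘(ℝ, E) x)) (q : M) :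
    ∃ p : Seminorm ℝ (TangentSpace 𝓘(ℝ, E) q), ∀ v, p v = metricNorm g v := by
  let _ : RiemannianBundle (fun x : M => TangentSpace 𝓘(ℝ, E) x) := ⟨g.toRiemannianMetric⟩
  exact ⟨normSeminorm ℝ _, fun v => by
    rw [coe_normSeminorm, norm_eq_sqrt_real_inner]; rfl⟩

/-- The derivative of a `C^1` map is locally bounded in charts. -/
theorem exists_norm_chartDeriv_mfderiv_le {h : M → M} (c : M)
    (hh : ContMDiff 𝓘(ℝ, E) 𝓘(ℝ, E) 1 h) : ∃ C, ∀ᶠ q in 𝓝 c, ∀ v : TangentSpace 𝓘(ℝ, E) q,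
    ‖chartDeriv (h c) (h q) (mfderiv 𝓘(ℝ, E) 𝓘(ℝ, E) h q v)‖ ≤ C * ‖chartDeriv c q v‖ := by
  set F : E → E := fun ξ => chartAt E (h c) (h ((chartAt E c).symm ξ)) with hF
  have h1 : ContDiffAt ℝ 1 F (chartAt E c c) := by
    have h2 := (contMDiffAt_iff.1 (hh c)).2
    have h3 : F = chartAt E (h c) ∘ h ∘ (chartAt E c).symm := rfl
    rw [h3]
    simpa [contDiffWithinAt_univ] using h2
  have h2 : ContinuousAt (fderiv ℝ F) (chartAt E c c) :=
    (h1.fderiv_right (m := 0) (by simp)).continuousAt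
  have h3 : ContinuousAt (chartAt E c) c := (chartAt E c).continuousAt (mem_chart_source E c)
  have h4 : ∀ᶠ q in 𝓝 c, ‖fderiv ℝ F (chartAt E c q)‖ < ‖fderiv ℝ F (chartAt E c c)‖ + 1 :=
    (ContinuousAt.comp (f := chartAt E c) (x := c) h2 h3).norm.eventually_lt_const (lt_add_one _)
  refine ⟨‖fderiv ℝ F (chartAt E c c)‖ + 1, ?_⟩
  filter_upwards [h4, (chartAt E c).open_source.mem_nhds (mem_chart_source E c),
    hh.continuous.continuousAt.preimage_mem_nhds ((chartAt E (h c)).open_source.mem_nhds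
      (mem_chart_source E (h c)))] with q hq hqc hqc' v
  rw [← fderiv_chart_chartDeriv hqc hqc' (hh.mdifferentiable (by simp) q)]
  exact ContinuousLinearMap.le_of_opNorm_le _ hq.le _

end Charts

end

/-! ### The diffeomorphism and the subbundles in charts -/

section

attribute [local instance 2000] chartedSpaceSelf

/-- The inverse of a chart of a Riemannian manifold is locally Lipschitz. -/
theorem exists_edist_chart_symm_le {E : Type*} [NormedAddCommGroup E] [NormedSpace ℝ E] {M : Type*}
    [EMetricSpace M] [ChartedSpace E M] [IsManifold 𝓘(ℝ, E) 1 M]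
    [RiemannianBundle (fun x : M => TangentSpace 𝓘(ℝ, E) x)]
    [IsContinuousRiemannianBundle E (fun x : M => TangentSpace 𝓘(ℝ, E) x)]
    [IsRiemannianManifold 𝓘(ℝ, E) M] (c : M) :
    ∃ C : ℝ, ∃ N ∈ 𝓝 (chartAt E c c), ∀ ξ ∈ N, ∀ ξ' ∈ N,
      edist ((chartAt E c).symm ξ) ((chartAt E c).symm ξ') ≤ ENNReal.ofReal (C * ‖ξ - ξ'‖) := by
  obtain ⟨C, hC0, hC⟩ := exists_norm_chartDeriv_le (E := E) c
  rw [← (chartAt E c).symm_map_nhds_eq (mem_chart_source E c), eventually_map] at hC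
  obtain ⟨s, hs, hsub⟩ := Metric.nhds_basis_ball.mem_iff.1 (inter_mem hC
    ((chartAt E c).open_target.mem_nhds ((chartAt E c).map_source (mem_chart_source E c))))
  refine ⟨C, _, Metric.ball_mem_nhds _ hs, fun ξ hξ ξ' hξ' => ?_⟩
  -- The distance is at most the length of the segment read in the chart.
  set η : ℝ → E := fun t => ξ + t • (ξ' - ξ) with hη
  set γ : ℝ → M := fun t => (chartAt E c).symm (η t) with hγ
  have hηball : ∀ t ∈ Icc (0 : ℝ) 1, η t ∈ Metric.ball (chartAt E c c) s := fun t ht =>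
    (convex_ball _ s).add_smul_sub_mem hξ hξ' ht
  have hηd : ∀ t, HasFDerivAt η ((1 : ℝ →L[ℝ] ℝ).smulRight (ξ' - ξ)) t := fun t =>
    ((hasFDerivAt_id t).smul_const (ξ' - ξ)).const_add ξ
  have hηc : ContDiff ℝ 1 η := by fun_prop
  have hγd : ∀ t ∈ Icc (0 : ℝ) 1, ContMDiffAt 𝓘(ℝ, ℝ) 𝓘(ℝ, E) 1 γ t := fun t ht =>
    ((contMDiffOn_chart_symm (I := 𝓘(ℝ, E)) (n := 1) (x := c)).contMDiffAt
      ((chartAt E c).open_target.mem_nhds (hsub (hηball t ht)).2)).comp t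
      hηc.contDiffAt.contMDiffAt
  rw [IsRiemannianManifold.out (I := 𝓘(ℝ, E))]
  refine (riemannianEDist_le_pathELength (I := 𝓘(ℝ, E)) (γ := γ) (a := 0) (b := 1)
    (fun t ht => (hγd t ht).contMDiffWithinAt) (by simp [hγ, hη]) (by simp [hγ, hη])
    zero_le_one).trans ?_
  rw [pathELength_eq_lintegral_mfderiv_Ioo]
  have hbound : ∀ t ∈ Ioo (0 : ℝ) 1, ‖mfderiv 𝓘(ℝ, ℝ) 𝓘(ℝ, E) γ t (1 : ℝ)‖ₑ ≤
      ENNReal.ofReal (C * ‖ξ - ξ'‖) := by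
    intro t ht
    have ht' := Ioo_subset_Icc_self ht
    have h1 := ((hγd t ht').mdifferentiableAt (by simp)).hasMFDerivAt
    have hsrc : γ t ∈ (chartAt E c).source := (chartAt E c).map_target (hsub (hηball t ht')).2
    have h2 := hasFDerivAt_chartAt_comp h1 hsrc
    have h3 : (fun x => chartAt E c (γ x)) =ᶠ[𝓝 t] η := by
      filter_upwards [hηc.continuous.continuousAt.preimage_mem_nhds
        (Metric.isOpen_ball.mem_nhds (hηball t ht'))] with x hx
      exact (chartAt E c).right_inv (hsub hx).2
    have h4 := h2.unique ((hηd t).congr_of_eventuallyEq h3)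
    have h5 : chartDeriv c (γ t) (mfderiv 𝓘(ℝ, ℝ) 𝓘(ℝ, E) γ t (1 : ℝ)) = ξ' - ξ := by
      have h7 : ((1 : ℝ →L[ℝ] ℝ).smulRight (ξ' - ξ)) 1 = ξ' - ξ := by simp
      rw [← h7]
      exact congrArg (fun L : ℝ →L[ℝ] E => L 1) h4
    have h6 := ((hsub (hηball t ht')).1 (mfderiv 𝓘(ℝ, ℝ) 𝓘(ℝ, E) γ t (1 : ℝ))).2
    rw [← ofReal_norm]
    refine ENNReal.ofReal_le_ofReal (h6.trans ?_)
    change C * ‖chartDeriv c (γ t) (mfderiv 𝓘(ℝ, ℝ) 𝓘(ℝ, E) γ t (1 : ℝ))‖ ≤ _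
    rw [h5, norm_sub_rev]
  refine (setLIntegral_mono measurable_const hbound).trans (le_of_eq ?_)
  simp

/-- A `C^{1+α}` diffeomorphism read in arbitrary charts. -/
theorem IsC1Holder.holderStrictAt {E : Type*} [NormedAddCommGroup E] [NormedSpace ℝ E] {M : Type*}
    [TopologicalSpace M] [ChartedSpace E M] [IsManifold 𝓘(ℝ, E) ∞ M] {α : ℝ≥0} (hα : 0 < α)
    (hα1 : α ≤ 1) {f : M ≃ₘ^1⟮𝓘(ℝ, E), 𝓘(ℝ, E)⟯ M} (hf : IsC1Holder α f) {c c' q : M}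
    (hq : q ∈ (chartAt E c).source) (hq' : f q ∈ (chartAt E c').source) :
    HolderStrictAt α (fun ξ => chartAt E c' (f ((chartAt E c).symm ξ))) (chartAt E c q) := by
  have hα0 : (0 : ℝ) < α := hα
  have hα1' : (α : ℝ) ≤ 1 := hα1
  have htrans : ∀ a b y : M, y ∈ (chartAt E a).source → y ∈ (chartAt E b).source →
      HolderStrictAt α (fun ξ => chartAt E b ((chartAt E a).symm ξ)) (chartAt E a y) := by
    intro a b y ha hb
    have h1 : ContMDiffAt 𝓘(ℝ, E) 𝓘(ℝ, E) ∞ (chartAt E a).symm (chartAt E a y) :=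
      (contMDiffOn_chart_symm (I := 𝓘(ℝ, E)) (n := ∞) (x := a)).contMDiffAt
        ((chartAt E a).open_target.mem_nhds ((chartAt E a).map_source ha))
    have h2 : ContMDiffAt 𝓘(ℝ, E) 𝓘(ℝ, E) ∞ (chartAt E b)
        ((chartAt E a).symm (chartAt E a y)) := by
      rw [(chartAt E a).left_inv ha]
      exact (contMDiffOn_chart (I := 𝓘(ℝ, E)) (n := ∞) (x := b)).contMDiffAt
        ((chartAt E b).open_source.mem_nhds hb)
    have h3 := contMDiffAt_iff_contDiffAt.1 (h2.comp (chartAt E a y) h1)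
    exact holderStrictAt_of_contDiffAt hα0 hα1' (h3.of_le ENat.LEInfty.out)
  -- The hypothesis concerns the charts at `q` and `f q`; other charts differ by changes of charts.
  have hfq : HolderStrictAt α (fun ξ => chartAt E (f q) (f ((chartAt E q).symm ξ)))
      (chartAt E q q) := by
    obtain ⟨V, hV, C, hC⟩ := hf q
    have h1 : ContDiffAt ℝ 1 (fun ξ => chartAt E (f q) (f ((chartAt E q).symm ξ)))
        (chartAt E q q) := by
      have h2 := (contMDiffAt_iff.1 (f.contMDiff q)).2
      have h3 : (fun ξ => chartAt E (f q) (f ((chartAt E q).symm ξ))) =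
        chartAt E (f q) ∘ f ∘ (chartAt E q).symm := rfl
      rw [h3]
      simpa [contDiffWithinAt_univ] using h2
    have hd : ∀ᶠ ξ in 𝓝 (chartAt E q q), DifferentiableAt ℝ
        (fun ξ => chartAt E (f q) (f ((chartAt E q).symm ξ))) ξ := by
      filter_upwards [h1.eventually (by simp)] with a ha using ha.differentiableAt (by simp)
    have hV' : V ∈ 𝓝 (chartAt E q q) := hV
    refine holderStrictAt_of_fderiv hα0 (inter_mem hV' hd) (fun a ha => ha.2) (K := C)
      fun a ha b hb => ?_
    have h2 := hC.dist_le ha.1 hb.1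
    rw [dist_eq_norm, dist_eq_norm] at h2
    exact h2
  have e1 : chartAt E q ((chartAt E c).symm (chartAt E c q)) = chartAt E q q := by
    rw [(chartAt E c).left_inv hq]
  have e2 : chartAt E (f q) (f ((chartAt E q).symm (chartAt E q q))) = chartAt E (f q) (f q) := by
    rw [(chartAt E q).left_inv (mem_chart_source E q)]
  have h1 := HolderStrictAt.comp (g := fun ξ => chartAt E (f q) (f ((chartAt E q).symm ξ)))
    (F := fun ξ => chartAt E q ((chartAt E c).symm ξ)) hα0 hα1' (by rw [e1]; exact hfq)
    (htrans c q q hq (mem_chart_source E q))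
  have h2 := HolderStrictAt.comp (g := fun ξ => chartAt E c' ((chartAt E (f q)).symm ξ))
    (F := fun ξ => chartAt E (f q) (f ((chartAt E q).symm
      (chartAt E q ((chartAt E c).symm ξ))))) hα0 hα1'
    (by rw [e1, e2]; exact htrans (f q) c' (f q) (mem_chart_source E (f q)) hq') h1
  refine h2.congr ?_
  have hc1 : ContinuousAt (chartAt E c).symm (chartAt E c q) :=
    (chartAt E c).continuousAt_symm ((chartAt E c).map_source hq)
  have hc2 : ContinuousAt (fun ξ => f ((chartAt E c).symm ξ)) (chartAt E c q) :=
    f.continuous.continuousAt.comp hc1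
  have m1 : (chartAt E q).source ∈ 𝓝 ((chartAt E c).symm (chartAt E c q)) := by
    rw [(chartAt E c).left_inv hq]
    exact (chartAt E q).open_source.mem_nhds (mem_chart_source E q)
  have m2 : (chartAt E (f q)).source ∈ 𝓝 (f ((chartAt E c).symm (chartAt E c q))) := by
    rw [(chartAt E c).left_inv hq]
    exact (chartAt E (f q)).open_source.mem_nhds (mem_chart_source E (f q))
  filter_upwards [hc1.preimage_mem_nhds m1, hc2.preimage_mem_nhds m2] with ξ hξ1 hξ2
  simp only [(chartAt E q).left_inv hξ1, (chartAt E (f q)).left_inv hξ2]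

/-- A continuous subbundle, read in a chart, is the range of a continuous family of injective linear
maps. -/
theorem IsContinuousSubbundleOn.exists_frame {E : Type*} [NormedAddCommGroup E] [NormedSpace ℝ E]
    {M : Type*} [TopologicalSpace M] [ChartedSpace E M] [IsManifold 𝓘(ℝ, E) 1 M]
    {F : ∀ x : M, Submodule ℝ (TangentSpace 𝓘(ℝ, E) x)} {S : Set M}
    (hF : IsContinuousSubbundleOn F S) {c q₀ : M} (hq₀ : q₀ ∈ S) (hc : q₀ ∈ (chartAt E c).source) :
    ∃ (k : ℕ) (s : M → (Fin k → ℝ) →L[ℝ] E), ContinuousWithinAt s S q₀ ∧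
      ∀ᶠ q in 𝓝[S] q₀, Module.finrank ℝ (F q) = k ∧ Function.Injective (s q) ∧
        (∀ a, ∃ v ∈ F q, s q a = chartDeriv c q v) ∧ ∀ v ∈ F q, ∃ a, s q a = chartDeriv c q v := by
  obtain ⟨V, hV, k, s, hs, hspan⟩ := hF q₀ hq₀
  have hsrc : (chartAt E c).source ∈ 𝓝 q₀ := (chartAt E c).open_source.mem_nhds hc
  have hcont : ∀ i, ContinuousWithinAt (fun q => chartDeriv c q (s i q)) S q₀ := by
    intro i
    have h1 : ContinuousWithinAt (fun x => (⟨x, s i x⟩ : TangentBundle 𝓘(ℝ, E) M)) S q₀ :=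
      (hs i q₀ (mem_of_mem_nhdsWithin hq₀ hV)).mono_of_mem_nhdsWithin hV
    set e := trivializationAt E (TangentSpace 𝓘(ℝ, E)) c
    have h2 : ContinuousAt e (⟨q₀, s i q₀⟩ : TangentBundle 𝓘(ℝ, E) M) :=
      e.continuousAt (by rw [e.mem_source]; simpa [e] using hc)
    have h3 : ContinuousWithinAt (fun x => (e (⟨x, s i x⟩ : TangentBundle 𝓘(ℝ, E) M)).2) S q₀ :=
      (ContinuousAt.comp_continuousWithinAt (f := fun x => (⟨x, s i x⟩ : TangentBundle 𝓘(ℝ, E) M))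
        h2 h1).snd
    have h4 : ∀ q ∈ (chartAt E c).source,
        chartDeriv c q (s i q) = (e (⟨q, s i q⟩ : TangentBundle 𝓘(ℝ, E) M)).2 := by
      intro q hq
      have hb : q ∈ e.baseSet := by simpa [e] using hq
      exact congrFun (e.coe_linearMapAt_of_mem (R := ℝ) hb) (s i q)
    refine h3.congr_of_eventuallyEq ?_ (h4 q₀ hc)
    filter_upwards [mem_nhdsWithin_of_mem_nhds hsrc] with q hq using h4 q hq
  refine ⟨k, fun q => ∑ i, (ContinuousLinearMap.proj i : (Fin k → ℝ) →L[ℝ] ℝ).smulRight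
    (chartDeriv c q (s i q)), ?_, ?_⟩
  · refine tendsto_finsetSum _ fun i _ => ?_
    exact ((ContinuousLinearMap.smulRightL ℝ (Fin k → ℝ) E
      (ContinuousLinearMap.proj i)).continuous.tendsto _).comp (hcont i)
  · filter_upwards [hV, mem_nhdsWithin_of_mem_nhds hsrc] with q hqV hqs
    obtain ⟨hli, hsp⟩ := hspan q hqV
    have heq : ∀ a : Fin k → ℝ, (∑ i, (ContinuousLinearMap.proj i : (Fin k → ℝ) →L[ℝ] ℝ).smulRight
        (chartDeriv c q (s i q))) a = chartDeriv c q (∑ i, a i • s i q) := fun a => by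
      simp [map_sum]
    have hmem : ∀ v, v ∈ F q ↔ ∃ a : Fin k → ℝ, ∑ i, a i • s i q = v := fun v => by
      rw [← hsp, Submodule.mem_span_range_iff_exists_fun]
    refine ⟨?_, ?_, fun a => ⟨_, (hmem _).2 ⟨a, rfl⟩, heq a⟩, fun v hv => ?_⟩
    · rw [← hsp, finrank_span_eq_card hli, Fintype.card_fin]
    · rw [injective_iff_map_eq_zero]
      intro a ha
      rw [heq] at ha
      have h1 : ∑ i, a i • s i q = 0 := by
        rw [← chartDerivSymm_chartDeriv hqs (∑ i, a i • s i q), ha, map_zero]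
      exact funext fun i => Fintype.linearIndependent_iff.1 hli a h1 i
    · obtain ⟨a, rfl⟩ := (hmem v).1 hv
      exact ⟨a, heq a⟩

/-- The projection of a splitting with continuous summands is continuous. -/
theorem continuousWithinAt_of_frames {E : Type*} [NormedAddCommGroup E] [NormedSpace ℝ E]
    [FiniteDimensional ℝ E] {M : Type*} [TopologicalSpace M] {S : Set M} {q₀ : M} (hq₀ : q₀ ∈ S)
    {k k' : ℕ} {s : M → (Fin k → ℝ) →L[ℝ] E} {s' : M → (Fin k' → ℝ) →L[ℝ] E}
    (hs : ContinuousWithinAt s S q₀) (hs' : ContinuousWithinAt s' S q₀)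
    (hbij : Function.Bijective ((s q₀).coprod (s' q₀))) {P : M → E →L[ℝ] E}
    (hP : ∀ᶠ q in 𝓝[S] q₀, (∀ a, P q (s q a) = s q a) ∧ ∀ b, P q (s' q b) = 0) :
    ContinuousWithinAt P S q₀ := by
  set B : M → ((Fin k → ℝ) × (Fin k' → ℝ)) →L[ℝ] E := fun q => (s q).coprod (s' q) with hBdef
  have hB : ContinuousWithinAt B S q₀ := by
    have h1 : B = fun q => (s q) ∘L ContinuousLinearMap.fst ℝ _ _ +
        (s' q) ∘L ContinuousLinearMap.snd ℝ _ _ := by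
      funext q; ext <;> simp [hBdef]
    rw [h1]
    exact (hs.clm_comp continuousWithinAt_const).add (hs'.clm_comp continuousWithinAt_const)
  set e : ((Fin k → ℝ) × (Fin k' → ℝ)) ≃L[ℝ] E :=
    (LinearEquiv.ofBijective (B q₀).toLinearMap hbij).toContinuousLinearEquiv
  have he : (e : ((Fin k → ℝ) × (Fin k' → ℝ)) →L[ℝ] E) = B q₀ := by ext <;> rfl
  have hinv : ContinuousWithinAt (fun q => ContinuousLinearMap.inverse (B q)) S q₀ := by
    have h1 := (contDiffAt_map_inverse (𝕜 := ℝ) (n := 0) e).continuousAt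
    rw [he] at h1
    exact ContinuousAt.comp_continuousWithinAt (f := B) h1 hB
  have hEq : ∀ᶠ q in 𝓝[S] q₀, P q = (B q ∘L ((ContinuousLinearMap.inl ℝ (Fin k → ℝ) (Fin k' → ℝ)) ∘L
      (ContinuousLinearMap.fst ℝ _ _))) ∘L ContinuousLinearMap.inverse (B q) := by
    have h1 := hB.eventually (by rw [← he]; exact ContinuousLinearEquiv.nhds e)
    filter_upwards [h1, hP] with q ⟨e', he'⟩ hq
    ext ξ
    rw [← he', ContinuousLinearMap.inverse_equiv]
    set w := e'.symm ξ
    have hξ : ξ = s q w.1 + s' q w.2 := by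
      have : ξ = e' w := by simp [w]
      have h2 : e' w = B q w := by rw [← he']; rfl
      rw [this, h2]; rfl
    have h3 : ((e' : _ →L[ℝ] E) ∘L ((ContinuousLinearMap.inl ℝ (Fin k → ℝ) (Fin k' → ℝ)) ∘L
      (ContinuousLinearMap.fst ℝ _ _))) w = s q w.1 := by
      rw [he']; simp [hBdef]
    have h4 : P q ξ = s q w.1 := by rw [hξ, map_add, hq.1, hq.2, add_zero]
    rw [h4, ← h3]
    rfl
  refine ContinuousWithinAt.congr_of_eventuallyEq ?_ hEq (hEq.self_of_nhdsWithin hq₀)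
  exact (hB.clm_comp continuousWithinAt_const).clm_comp hinv

end

/-! ### Frames adapted to the splitting -/

section

attribute [local instance 2000] chartedSpaceSelf

section Diffeo

variable {E : Type*} [NormedAddCommGroup E] [NormedSpace ℝ E] {M : Type*}
    [TopologicalSpace M] [ChartedSpace E M] (f : M ≃ₘ^1⟮𝓘(ℝ, E), 𝓘(ℝ, E)⟯ M)

theorem mfderiv_symm_comp_mfderiv (q : M) (v : TangentSpace 𝓘(ℝ, E) q) :
    mfderiv 𝓘(ℝ, E) 𝓘(ℝ, E) f.symm (f q) (mfderiv 𝓘(ℝ, E) 𝓘(ℝ, E) f q v) =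
      mfderiv 𝓘(ℝ, E) 𝓘(ℝ, E) (f.symm ∘ f) q v := by
  rw [mfderiv_comp q (f.symm.contMDiff.mdifferentiable (by simp) _)
    (f.contMDiff.mdifferentiable (by simp) _)]
  rfl

theorem metricNorm_mfderiv_symm_mfderiv [IsManifold 𝓘(ℝ, E) 1 M]
    (g : ContMDiffRiemannianMetric 𝓘(ℝ, E) ∞ E (fun x : M => TangentSpace 𝓘(ℝ, E) x)) (q : M)
    (v : TangentSpace 𝓘(ℝ, E) q) :
    metricNorm g (mfderiv 𝓘(ℝ, E) 𝓘(ℝ, E) f.symm (f q) (mfderiv 𝓘(ℝ, E) 𝓘(ℝ, E) f q v)) =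
      metricNorm g v := by
  have h : ∀ h : M → M, h = id →
      metricNorm g (mfderiv 𝓘(ℝ, E) 𝓘(ℝ, E) h q v) = metricNorm g v := by
    rintro _ rfl
    rw [mfderiv_id]
    rfl
  rw [mfderiv_symm_comp_mfderiv]
  exact h _ (funext fun x => f.symm_apply_apply x)

theorem norm_mfderiv_symm_mfderiv [RiemannianBundle (fun x : M => TangentSpace 𝓘(ℝ, E) x)] (q : M)
    (v : TangentSpace 𝓘(ℝ, E) q) :
    ‖mfderiv 𝓘(ℝ, E) 𝓘(ℝ, E) f.symm (f q) (mfderiv 𝓘(ℝ, E) 𝓘(ℝ, E) f q v)‖ = ‖v‖ := by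
  have h : ∀ h : M → M, h = id → ‖mfderiv 𝓘(ℝ, E) 𝓘(ℝ, E) h q v‖ = ‖v‖ := by
    rintro _ rfl
    rw [mfderiv_id]
    rfl
  rw [mfderiv_symm_comp_mfderiv]
  exact h _ (funext fun x => f.symm_apply_apply x)

theorem mfderiv_injective (q : M) :
    Function.Injective (mfderiv 𝓘(ℝ, E) 𝓘(ℝ, E) f q) := by
  have h : ∀ h : M → M, h = id → Function.Injective (mfderiv 𝓘(ℝ, E) 𝓘(ℝ, E) h q) := by
    rintro _ rfl
    rw [mfderiv_id]
    exact fun _ _ h => h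
  intro v w hvw
  refine h (f.symm ∘ f) (funext fun x => f.symm_apply_apply x) ?_
  rw [← mfderiv_symm_comp_mfderiv, ← mfderiv_symm_comp_mfderiv, hvw]

/-- On a compact set, two Riemannian metrics are uniformly comparable and a diffeomorphism is
uniformly bi-Lipschitz. -/
theorem exists_norm_le_of_isCompact [IsManifold 𝓘(ℝ, E) ∞ M]
    [RiemannianBundle (fun x : M => TangentSpace 𝓘(ℝ, E) x)]
    [IsContinuousRiemannianBundle E (fun x : M => TangentSpace 𝓘(ℝ, E) x)]
    (g : ContMDiffRiemannianMetric 𝓘(ℝ, E) ∞ E (fun x : M => TangentSpace 𝓘(ℝ, E) x))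
    {Λ : Set M} (hΛ : IsCompact Λ) :
    ∃ C, 1 ≤ C ∧ ∀ q ∈ Λ, ∀ v : TangentSpace 𝓘(ℝ, E) q, metricNorm g v ≤ C * ‖v‖ ∧
      ‖v‖ ≤ C * metricNorm g v ∧ ‖v‖ ≤ C * ‖mfderiv 𝓘(ℝ, E) 𝓘(ℝ, E) f q v‖ := by
  have hg0 : ∀ q, ∀ v : TangentSpace 𝓘(ℝ, E) q, 0 ≤ metricNorm g v := fun q v => Real.sqrt_nonneg _
  obtain ⟨C, -, -, hC⟩ := hΛ.exists_uniform_constants (P := fun C _ q =>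
    ∀ v : TangentSpace 𝓘(ℝ, E) q, metricNorm g v ≤ C * ‖v‖ ∧
      ‖v‖ ≤ C * metricNorm g v ∧ ‖v‖ ≤ C * ‖mfderiv 𝓘(ℝ, E) 𝓘(ℝ, E) f q v‖)
    (fun C C' r r' q hC _ h v => ⟨(h v).1.trans (by gcongr),
      (h v).2.1.trans (mul_le_mul_of_nonneg_right hC (hg0 q v)), (h v).2.2.trans (by gcongr)⟩)
    (fun q₀ _ => by
      obtain ⟨C₁, hC₁, h₁⟩ := exists_norm_chartDeriv_le (E := E) q₀
      obtain ⟨C₂, hC₂, h₂⟩ := exists_metricNorm_chartDeriv_le g q₀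
      obtain ⟨C₃, hC₃, h₃⟩ := exists_norm_chartDeriv_le (E := E) (f q₀)
      obtain ⟨C₄, h₄⟩ := exists_norm_chartDeriv_mfderiv_le (f q₀) f.symm.contMDiff
      obtain ⟨C₅, hC₅, h₅⟩ := exists_norm_chartDeriv_le (E := E) (f.symm (f q₀))
      have hf : ContinuousAt f q₀ := f.continuous.continuousAt
      have hf' : ContinuousAt (fun q => f.symm (f q)) q₀ :=
        (f.symm.continuous.comp f.continuous).continuousAt
      refine ⟨max (C₂ * C₁) (max (C₁ * C₂) (C₅ * (|C₄| * C₃))), 1, one_pos, ?_⟩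
      refine eventually_nhdsWithin_of_eventually_nhds ?_
      filter_upwards [h₁, h₂, hf.eventually h₃, hf.eventually h₄, hf'.eventually h₅]
        with q h1 h2 h3 h4 h5 v
      refine ⟨?_, ?_, ?_⟩
      · calc metricNorm g v ≤ C₂ * (C₁ * ‖v‖) := (h2 v).2.trans (by gcongr; exact (h1 v).1)
          _ = C₂ * C₁ * ‖v‖ := by ring
          _ ≤ _ := by gcongr; exact le_max_left _ _
      · calc ‖v‖ ≤ C₁ * (C₂ * metricNorm g v) := (h1 v).2.trans (by gcongr; exact (h2 v).1)
          _ = C₁ * C₂ * metricNorm g v := by ring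
          _ ≤ _ := mul_le_mul_of_nonneg_right ((le_max_left _ _).trans (le_max_right _ _)) (hg0 q v)
      · set w := mfderiv 𝓘(ℝ, E) 𝓘(ℝ, E) f q v with hw
        calc ‖v‖ = ‖mfderiv 𝓘(ℝ, E) 𝓘(ℝ, E) f.symm (f q) w‖ :=
              (norm_mfderiv_symm_mfderiv f q v).symm
          _ ≤ C₅ * (|C₄| * (C₃ * ‖w‖)) := by
            refine (h5 _).2.trans ?_
            gcongr
            refine (h4 w).trans ?_
            gcongr
            · exact le_abs_self _
            · exact (h3 w).1
          _ = C₅ * (|C₄| * C₃) * ‖w‖ := by ring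
          _ ≤ _ := by gcongr; exact (le_max_right _ _).trans (le_max_right _ _))
  refine ⟨max 1 C, le_max_left _ _, fun q hq v => ?_⟩
  obtain ⟨h1, h2, h3⟩ := hC q hq v
  exact ⟨h1.trans (by gcongr; exact le_max_right _ _),
    h2.trans (mul_le_mul_of_nonneg_right (le_max_right _ _) (hg0 q v)),
    h3.trans (by gcongr; exact le_max_right _ _)⟩

end Diffeo

section Frame

variable {E : Type*} [NormedAddCommGroup E] [NormedSpace ℝ E] [FiniteDimensional ℝ E] {M : Type*}
    [TopologicalSpace M] [ChartedSpace E M]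
    [RiemannianBundle (fun x : M => TangentSpace 𝓘(ℝ, E) x)]

/-- A family of frames of the tangent spaces at the points of `Λ` which are isometric on each summand
of the splitting `E^cs ⊕ E^cu`, and the blocks `A`, `D` of the derivative of `f` in these frames. -/
structure SplittingFrame (f : M ≃ₘ^1⟮𝓘(ℝ, E), 𝓘(ℝ, E)⟯ M) (Λ : Set M)
    (Ecs Ecu : ∀ x : M, Submodule ℝ (TangentSpace 𝓘(ℝ, E) x)) (d m : ℕ) where
  W : ∀ q : M, (EuclideanSpace ℝ (Fin d) × EuclideanSpace ℝ (Fin m)) ≃L[ℝ] TangentSpace 𝓘(ℝ, E) q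
  A : M → EuclideanSpace ℝ (Fin d) ≃L[ℝ] EuclideanSpace ℝ (Fin d)
  D : M → EuclideanSpace ℝ (Fin m) →L[ℝ] EuclideanSpace ℝ (Fin m)
  mem_cu : ∀ q ∈ Λ, ∀ u, W q (u, 0) ∈ Ecu q
  norm_cu : ∀ q ∈ Λ, ∀ u, ‖W q (u, 0)‖ = ‖u‖
  mem_cs : ∀ q ∈ Λ, ∀ z, W q (0, z) ∈ Ecs q
  norm_cs : ∀ q ∈ Λ, ∀ z, ‖W q (0, z)‖ = ‖z‖
  isCompl : ∀ q ∈ Λ, IsCompl (Ecs q) (Ecu q)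
  mfderiv_apply : ∀ q ∈ Λ, ∀ w, mfderiv 𝓘(ℝ, E) 𝓘(ℝ, E) f q (W q w) = W (f q) (A q w.1, D q w.2)

/-- If `W` maps the factors of `X × Y` into complementary subspaces `P` and `Q`, the second coordinate
of a point of `P` vanishes. -/
theorem snd_eq_zero_of_mem {V X Y : Type*} [AddCommGroup V] [Module ℝ V] [TopologicalSpace V]
    [NormedAddCommGroup X] [NormedSpace ℝ X] [NormedAddCommGroup Y] [NormedSpace ℝ Y]
    {P Q : Submodule ℝ V} (h : Disjoint Q P) (W : (X × Y) ≃L[ℝ] V)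
    (hP : ∀ u, W (u, 0) ∈ P) (hQ : ∀ z, W (0, z) ∈ Q) {v : V} (hv : v ∈ P) : (W.symm v).2 = 0 := by
  set w := W.symm v
  have h1 : W (0, w.2) = v - W (w.1, 0) := by
    rw [eq_sub_iff_add_eq, ← map_add]; simp [w]
  have h2 : W (0, w.2) = 0 := Submodule.disjoint_def.1 h _ (hQ _)
    (by rw [h1]; exact P.sub_mem hv (hP _))
  have h3 : ((0 : X), w.2) = 0 := by simpa using h2
  exact congrArg Prod.snd h3

theorem fst_eq_zero_of_mem {V X Y : Type*} [AddCommGroup V] [Module ℝ V] [TopologicalSpace V]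
    [NormedAddCommGroup X] [NormedSpace ℝ X] [NormedAddCommGroup Y] [NormedSpace ℝ Y]
    {P Q : Submodule ℝ V} (h : Disjoint Q P) (W : (X × Y) ≃L[ℝ] V)
    (hP : ∀ u, W (u, 0) ∈ P) (hQ : ∀ z, W (0, z) ∈ Q) {v : V} (hv : v ∈ Q) : (W.symm v).1 = 0 := by
  set w := W.symm v
  have h1 : W (w.1, 0) = v - W (0, w.2) := by
    rw [eq_sub_iff_add_eq, ← map_add]; simp [w]
  have h2 : W (w.1, 0) = 0 := Submodule.disjoint_def.1 h _
    (by rw [h1]; exact Q.sub_mem hv (hQ _)) (hP _)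
  have h3 : (w.1, (0 : Y)) = 0 := by simpa using h2
  exact congrArg Prod.fst h3

/-- Frames adapted to a splitting of constant rank exist. They are chosen independently at each point;
the derivative of `f` is block diagonal in them by invariance of the splitting. -/
theorem exists_splittingFrame {f : M ≃ₘ^1⟮𝓘(ℝ, E), 𝓘(ℝ, E)⟯ M} {Λ : Set M} (hinv : MapsTo f Λ Λ)
    (hne : Λ.Nonempty) {Ecs Ecu : ∀ x : M, Submodule ℝ (TangentSpace 𝓘(ℝ, E) x)}
    (hcompl : ∀ x ∈ Λ, IsCompl (Ecs x) (Ecu x))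
    (hcs : ∀ x ∈ Λ, (Ecs x).map (mfderiv 𝓘(ℝ, E) 𝓘(ℝ, E) f x).toLinearMap = Ecs (f x))
    (hcu : ∀ x ∈ Λ, (Ecu x).map (mfderiv 𝓘(ℝ, E) 𝓘(ℝ, E) f x).toLinearMap = Ecu (f x))
    {d m : ℕ} (hd : ∀ x ∈ Λ, Module.finrank ℝ (Ecu x) = d) (hm : d + m = Module.finrank ℝ E) :
    Nonempty (SplittingFrame f Λ Ecs Ecu d m) := by
  have hfin : ∀ x : M, FiniteDimensional ℝ (TangentSpace 𝓘(ℝ, E) x) := fun x =>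
    inferInstanceAs (FiniteDimensional ℝ E)
  have hW₀ : ∀ q ∈ Λ, ∃ W : (EuclideanSpace ℝ (Fin d) × EuclideanSpace ℝ (Fin m)) ≃L[ℝ]
      TangentSpace 𝓘(ℝ, E) q, (∀ u, W (u, 0) ∈ Ecu q ∧ ‖W (u, 0)‖ = ‖u‖) ∧
        (∀ z, W (0, z) ∈ Ecs q ∧ ‖W (0, z)‖ = ‖z‖) := by
    intro q hq
    refine exists_isometric_frame (hcompl q hq).symm (hd q hq) ?_
    have h1 := Submodule.finrank_add_eq_of_isCompl (hcompl q hq)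
    rw [hd q hq] at h1
    have h2 : Module.finrank ℝ (TangentSpace 𝓘(ℝ, E) q) = Module.finrank ℝ E := rfl
    omega
  have hW : ∀ q, ∃ W : (EuclideanSpace ℝ (Fin d) × EuclideanSpace ℝ (Fin m)) ≃L[ℝ]
      TangentSpace 𝓘(ℝ, E) q, q ∈ Λ → (∀ u, W (u, 0) ∈ Ecu q ∧ ‖W (u, 0)‖ = ‖u‖) ∧
        (∀ z, W (0, z) ∈ Ecs q ∧ ‖W (0, z)‖ = ‖z‖) := by
    intro q
    by_cases hq : q ∈ Λ
    · obtain ⟨W, hW⟩ := hW₀ q hq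
      exact ⟨W, fun _ => hW⟩
    · obtain ⟨q₁, hq₁⟩ := hne
      obtain ⟨W, -⟩ := hW₀ q₁ hq₁
      exact ⟨W, fun h => absurd h hq⟩
  choose W hW using hW
  have hsnd : ∀ q ∈ Λ, ∀ v ∈ Ecu q, ((W q).symm v).2 = 0 := fun q hq v hv =>
    snd_eq_zero_of_mem (hcompl q hq).disjoint (W q) (fun u => ((hW q hq).1 u).1)
      (fun z => ((hW q hq).2 z).1) hv
  have hfst : ∀ q ∈ Λ, ∀ v ∈ Ecs q, ((W q).symm v).1 = 0 := fun q hq v hv =>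
    fst_eq_zero_of_mem (hcompl q hq).disjoint (W q) (fun u => ((hW q hq).1 u).1)
      (fun z => ((hW q hq).2 z).1) hv
  have hAD : ∀ q, ∃ (A : EuclideanSpace ℝ (Fin d) ≃L[ℝ] EuclideanSpace ℝ (Fin d))
      (D : EuclideanSpace ℝ (Fin m) →L[ℝ] EuclideanSpace ℝ (Fin m)), q ∈ Λ → ∀ w,
      mfderiv 𝓘(ℝ, E) 𝓘(ℝ, E) f q (W q w) = W (f q) (A w.1, D w.2) := by
    intro q
    by_cases hq : q ∈ Λ
    swap
    · exact ⟨.refl ℝ _, 0, fun h => absurd h hq⟩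
    set B : (EuclideanSpace ℝ (Fin d) × EuclideanSpace ℝ (Fin m)) →L[ℝ]
      (EuclideanSpace ℝ (Fin d) × EuclideanSpace ℝ (Fin m)) :=
      ((W (f q)).symm : TangentSpace 𝓘(ℝ, E) (f q) →L[ℝ] _) ∘L
        ((mfderiv 𝓘(ℝ, E) 𝓘(ℝ, E) f q) ∘L
          ((W q : _ →L[ℝ] TangentSpace 𝓘(ℝ, E) q))) with hB
    have hBapp : ∀ w, W (f q) (B w) = mfderiv 𝓘(ℝ, E) 𝓘(ℝ, E) f q (W q w) := fun w => by simp [hB]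
    have hBinj : Function.Injective B := by
      intro w w' hww'
      have h1 := congrArg (W (f q)) hww'
      rw [hBapp, hBapp] at h1
      exact (W q).injective (mfderiv_injective f q h1)
    have hB1 : ∀ u, (B (u, 0)).2 = 0 := fun u => hsnd (f q) (hinv hq) _
      (by rw [← hcu q hq]; exact ⟨_, ((hW q hq).1 u).1, rfl⟩)
    have hB2 : ∀ z, (B (0, z)).1 = 0 := fun z => hfst (f q) (hinv hq) _
      (by rw [← hcs q hq]; exact ⟨_, ((hW q hq).2 z).1, rfl⟩)
    set A₀ : EuclideanSpace ℝ (Fin d) →ₗ[ℝ] EuclideanSpace ℝ (Fin d) :=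
      ((ContinuousLinearMap.fst ℝ _ _) ∘L (B ∘L (ContinuousLinearMap.inl ℝ _ _))).toLinearMap
    have hA₀ : Function.Injective A₀ := by
      intro u u' huu'
      have h1 : B (u, 0) = B (u', 0) := Prod.ext huu' ((hB1 u).trans (hB1 u').symm)
      exact congrArg Prod.fst (hBinj h1)
    refine ⟨(LinearEquiv.ofInjectiveEndo A₀ hA₀).toContinuousLinearEquiv,
      (ContinuousLinearMap.snd ℝ _ _) ∘L (B ∘L (ContinuousLinearMap.inr ℝ _ _)), fun _ w => ?_⟩
    rw [← hBapp]
    congr 1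
    have h1 : B w = B (w.1, 0) + B (0, w.2) := by rw [← map_add]; simp
    rw [h1]
    refine Prod.ext ?_ ?_
    · rw [Prod.fst_add, hB2, add_zero]; rfl
    · rw [Prod.snd_add, hB1, zero_add]; rfl
  choose A D hAD using hAD
  exact ⟨{ W := W, A := A, D := D
           mem_cu := fun q hq u => ((hW q hq).1 u).1
           norm_cu := fun q hq u => ((hW q hq).1 u).2
           mem_cs := fun q hq z => ((hW q hq).2 z).1
           norm_cs := fun q hq z => ((hW q hq).2 z).2
           isCompl := hcompl
           mfderiv_apply := hAD }⟩

end Frame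

end

/-! ### The local data of a dominated splitting -/

section

attribute [local instance 2000] chartedSpaceSelf

namespace SplittingFrame

set_option linter.unusedSectionVars false

section Charts

variable {E : Type*} [NormedAddCommGroup E] [NormedSpace ℝ E] [FiniteDimensional ℝ E] {M : Type*}
    [TopologicalSpace M] [ChartedSpace E M]
    [RiemannianBundle (fun x : M => TangentSpace 𝓘(ℝ, E) x)]
    {f : M ≃ₘ^1⟮𝓘(ℝ, E), 𝓘(ℝ, E)⟯ M} {Λ : Set M}
    {Ecs Ecu : ∀ x : M, Submodule ℝ (TangentSpace 𝓘(ℝ, E) x)} {d m : ℕ}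
    (F : SplittingFrame f Λ Ecs Ecu d m)

open Classical in
/-- The frame at `q` read in the chart at `c`. Off the domain of this chart the frame is read in the
chart at `q` instead; this value is never used. -/
noncomputable def chartFrame [IsManifold 𝓘(ℝ, E) 1 M] (c q : M) :
    (EuclideanSpace ℝ (Fin d) × EuclideanSpace ℝ (Fin m)) ≃L[ℝ] E :=
  if h : q ∈ (chartAt E c).source then
    (F.W q).trans (ContinuousLinearEquiv.equivOfInverse (chartDeriv c q) (chartDerivSymm c q)
      (chartDerivSymm_chartDeriv h) (chartDeriv_chartDerivSymm h))
  else (F.W q).trans (ContinuousLinearEquiv.equivOfInverse (chartDeriv q q) (chartDerivSymm q q)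
    (chartDerivSymm_chartDeriv (mem_chart_source E q))
    (chartDeriv_chartDerivSymm (mem_chart_source E q)))

theorem chartFrame_apply [IsManifold 𝓘(ℝ, E) 1 M] {c q : M} (h : q ∈ (chartAt E c).source)
    (w : EuclideanSpace ℝ (Fin d) × EuclideanSpace ℝ (Fin m)) :
    F.chartFrame c q w = chartDeriv c q (F.W q w) := by
  rw [chartFrame, dif_pos h]
  rfl

theorem chartFrame_symm_apply [IsManifold 𝓘(ℝ, E) 1 M] {c q : M} (h : q ∈ (chartAt E c).source)
    (v : TangentSpace 𝓘(ℝ, E) q) :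
    (F.chartFrame c q).symm (chartDeriv c q v) = (F.W q).symm v := by
  rw [ContinuousLinearEquiv.symm_apply_eq, F.chartFrame_apply h,
    ContinuousLinearEquiv.apply_symm_apply]

theorem symm_apply_of_mem_cu {q : M} (hq : q ∈ Λ) {v : TangentSpace 𝓘(ℝ, E) q} (hv : v ∈ Ecu q) :
    F.W q (((F.W q).symm v).1, 0) = v := by
  have h := snd_eq_zero_of_mem (F.isCompl q hq).disjoint (F.W q) (F.mem_cu q hq) (F.mem_cs q hq) hv
  rw [← h, Prod.mk.eta, ContinuousLinearEquiv.apply_symm_apply]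

/-- The block `A` is the derivative along `E^cu`, in isometric coordinates. -/
theorem norm_A_symm_le (hinv : MapsTo f Λ Λ) {q : M} (hq : q ∈ Λ) :
    ‖((F.A q).symm : EuclideanSpace ℝ (Fin d) →L[ℝ] EuclideanSpace ℝ (Fin d))‖ ≤
      normInvCu f Ecu (f q) := by
  refine ContinuousLinearMap.opNorm_le_bound _ (ContinuousLinearMap.opNorm_nonneg _)
    fun u => ?_
  have h1 := F.mfderiv_apply q hq ((F.A q).symm u, 0)
  simp only [ContinuousLinearEquiv.apply_symm_apply, map_zero] at h1
  have h2 := norm_mfderiv_symm_mfderiv f q (F.W q ((F.A q).symm u, 0))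
  rw [h1, F.norm_cu q hq] at h2
  have h3 := ((mfderiv 𝓘(ℝ, E) 𝓘(ℝ, E) f.symm (f q)).comp (Ecu (f q)).subtypeL).le_opNorm
    ⟨F.W (f q) (u, 0), F.mem_cu _ (hinv hq) u⟩
  have h4 : ‖(⟨F.W (f q) (u, 0), F.mem_cu _ (hinv hq) u⟩ : Ecu (f q))‖ = ‖u‖ :=
    F.norm_cu _ (hinv hq) u
  rw [h4] at h3
  exact h2.symm.le.trans h3

/-- The domination inequality for the metric `g`, read in the frames: the seminorms are the `g`-norms on
the summands, and compactness makes them uniformly comparable with the norms of the frames. -/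
theorem exists_dominatedStep [IsManifold 𝓘(ℝ, E) ∞ M]
    [IsContinuousRiemannianBundle E (fun x : M => TangentSpace 𝓘(ℝ, E) x)]
    (hΛ : IsCompact Λ) (hinv : MapsTo f Λ Λ)
    (g : ContMDiffRiemannianMetric 𝓘(ℝ, E) ∞ E (fun x : M => TangentSpace 𝓘(ℝ, E) x)) {lam : ℝ}
    (hlam : 0 ≤ lam) (hlam1 : lam ≤ 1) (hdom : ∀ x ∈ Λ, ∀ u ∈ Ecs x, ∀ w ∈ Ecu (f x),
      metricNorm g (mfderiv 𝓘(ℝ, E) 𝓘(ℝ, E) f x u) *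
        metricNorm g (mfderiv 𝓘(ℝ, E) 𝓘(ℝ, E) f.symm (f x) w) ≤
      lam * (metricNorm g u * metricNorm g w)) :
    ∃ (nX : M → Seminorm ℝ (EuclideanSpace ℝ (Fin d)))
      (nY : M → Seminorm ℝ (EuclideanSpace ℝ (Fin m))) (C : ℝ), ∀ q ∈ Λ,
      DominatedStep (F.A q) (F.D q) (nX q) (nX (f q)) (nY q) (nY (f q)) C lam ∧
        ∀ z, ‖z‖ ≤ C * nY q z := by
  choose p hp using exists_seminorm_metricNorm g
  obtain ⟨C, hC1, hC⟩ := exists_norm_le_of_isCompact f g hΛ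
  set nX : M → Seminorm ℝ (EuclideanSpace ℝ (Fin d)) := fun q =>
    (p q).comp ((F.W q : EuclideanSpace ℝ (Fin d) × EuclideanSpace ℝ (Fin m) →L[ℝ]
      TangentSpace 𝓘(ℝ, E) q) ∘L (ContinuousLinearMap.inl ℝ _ _)).toLinearMap
  set nY : M → Seminorm ℝ (EuclideanSpace ℝ (Fin m)) := fun q =>
    (p q).comp ((F.W q : EuclideanSpace ℝ (Fin d) × EuclideanSpace ℝ (Fin m) →L[ℝ]
      TangentSpace 𝓘(ℝ, E) q) ∘L (ContinuousLinearMap.inr ℝ _ _)).toLinearMap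
  have hnX : ∀ q u, nX q u = metricNorm g (F.W q (u, 0)) := fun q u => hp q _
  have hnY : ∀ q z, nY q z = metricNorm g (F.W q (0, z)) := fun q z => hp q _
  have hX : ∀ q ∈ Λ, ∀ u, nX q u ≤ C * ‖u‖ ∧ ‖u‖ ≤ C * nX q u := fun q hq u => by
    rw [hnX, ← F.norm_cu q hq]
    exact ⟨(hC q hq _).1, (hC q hq _).2.1⟩
  have hY : ∀ q ∈ Λ, ∀ z, nY q z ≤ C * ‖z‖ ∧ ‖z‖ ≤ C * nY q z := fun q hq z => by
    rw [hnY, ← F.norm_cs q hq]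
    exact ⟨(hC q hq _).1, (hC q hq _).2.1⟩
  refine ⟨nX, nY, C, fun q hq => ⟨?_, fun z => (hY q hq z).2⟩⟩
  have hq' := hinv hq
  refine ⟨hC1, hlam, hlam1, ?_, fun u => (hX q hq u).1, fun u => (hX q hq u).2,
    fun u => (hX _ hq' u).1, fun u => (hX _ hq' u).2, fun z => (hY q hq z).1,
    fun z => (hY _ hq' z).1, fun u z => ?_⟩
  · refine ContinuousLinearMap.opNorm_le_bound _ (zero_le_one.trans hC1) fun u => ?_
    have h1 := (hC q hq (F.W q ((F.A q).symm u, 0))).2.2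
    rw [F.mfderiv_apply q hq] at h1
    simp only [ContinuousLinearEquiv.apply_symm_apply, map_zero] at h1
    rwa [F.norm_cu q hq, F.norm_cu _ hq'] at h1
  · have h1 := hdom q hq _ (F.mem_cs q hq z) _ (F.mem_cu _ hq' u)
    have h2 : F.W (f q) (u, 0) =
        mfderiv 𝓘(ℝ, E) 𝓘(ℝ, E) f q (F.W q ((F.A q).symm u, 0)) := by
      rw [F.mfderiv_apply q hq]; simp
    have h3 : metricNorm g (mfderiv 𝓘(ℝ, E) 𝓘(ℝ, E) f.symm (f q) (F.W (f q) (u, 0))) =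
        nX q ((F.A q).symm u) := by
      rw [h2, metricNorm_mfderiv_symm_mfderiv, hnX]
    have h4 : mfderiv 𝓘(ℝ, E) 𝓘(ℝ, E) f q (F.W q (0, z)) = F.W (f q) (0, F.D q z) := by
      rw [F.mfderiv_apply q hq]; simp
    rw [h3, h4, ← hnY, ← hnY, ← hnX] at h1
    exact h1

/-- The projection onto `E^cu` along `E^cs`, read in a chart, is continuous. -/
theorem continuousWithinAt_proj [IsManifold 𝓘(ℝ, E) 1 M]
    (hcs : IsContinuousSubbundleOn Ecs Λ) (hcu : IsContinuousSubbundleOn Ecu Λ) {c q₀ : M}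
    (hq₀ : q₀ ∈ Λ) (hc : q₀ ∈ (chartAt E c).source) :
    ContinuousWithinAt (fun q => ((F.chartFrame c q :
      EuclideanSpace ℝ (Fin d) × EuclideanSpace ℝ (Fin m) →L[ℝ] E) ∘L
      ((ContinuousLinearMap.inl ℝ (EuclideanSpace ℝ (Fin d)) (EuclideanSpace ℝ (Fin m))) ∘L
      (ContinuousLinearMap.fst ℝ _ _))) ∘L ((F.chartFrame c q).symm :
      E →L[ℝ] EuclideanSpace ℝ (Fin d) × EuclideanSpace ℝ (Fin m))) Λ q₀ := by
  obtain ⟨k, s, hs, hsF⟩ := hcu.exists_frame hq₀ hc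
  obtain ⟨k', s', hs', hsF'⟩ := hcs.exists_frame hq₀ hc
  have hsrc : ∀ᶠ q in 𝓝[Λ] q₀, q ∈ (chartAt E c).source :=
    mem_nhdsWithin_of_mem_nhds ((chartAt E c).open_source.mem_nhds hc)
  refine continuousWithinAt_of_frames hq₀ hs hs' ⟨?_, ?_⟩ ?_
  · obtain ⟨-, hinj, hmem, -⟩ := hsF.self_of_nhdsWithin hq₀
    obtain ⟨-, hinj', hmem', -⟩ := hsF'.self_of_nhdsWithin hq₀
    rw [injective_iff_map_eq_zero]
    rintro ⟨a, b⟩ hab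
    rw [ContinuousLinearMap.coprod_apply] at hab
    obtain ⟨v, hv, hav⟩ := hmem a
    obtain ⟨v', hv', hbv⟩ := hmem' b
    rw [hav, hbv, ← map_add] at hab
    have h1 : v + v' = 0 := by
      rw [← chartDerivSymm_chartDeriv hc (v + v'), hab, map_zero]
    have h2 : v = 0 := Submodule.disjoint_def.1 (F.isCompl q₀ hq₀).disjoint v
      (by rw [eq_neg_of_add_eq_zero_left h1]; exact (Ecs q₀).neg_mem hv') hv
    have h3 : v' = 0 := by rwa [h2, zero_add] at h1
    rw [h2, map_zero] at hav
    rw [h3, map_zero] at hbv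
    exact Prod.ext (hinj (hav.trans (map_zero _).symm)) (hinj' (hbv.trans (map_zero _).symm))
  · obtain ⟨-, -, -, hmem⟩ := hsF.self_of_nhdsWithin hq₀
    obtain ⟨-, -, -, hmem'⟩ := hsF'.self_of_nhdsWithin hq₀
    intro ξ
    obtain ⟨v', hv', v, hv, hvv⟩ := Submodule.mem_sup.1
      (show chartDerivSymm c q₀ ξ ∈ Ecs q₀ ⊔ Ecu q₀ by
        rw [(F.isCompl q₀ hq₀).sup_eq_top]; trivial)
    obtain ⟨a, ha⟩ := hmem v hv
    obtain ⟨b, hb⟩ := hmem' v' hv'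
    refine ⟨(a, b), ?_⟩
    rw [ContinuousLinearMap.coprod_apply, ha, hb, ← map_add, add_comm v, hvv,
      chartDeriv_chartDerivSymm hc]
  · filter_upwards [hsF, hsF', hsrc, self_mem_nhdsWithin] with q h1 h2 hq hqΛ
    obtain ⟨-, -, hmem, -⟩ := h1
    obtain ⟨-, -, hmem', -⟩ := h2
    refine ⟨fun a => ?_, fun b => ?_⟩
    · obtain ⟨v, hv, hav⟩ := hmem a
      have h3 := snd_eq_zero_of_mem (F.isCompl q hqΛ).disjoint (F.W q) (F.mem_cu q hqΛ)
        (F.mem_cs q hqΛ) hv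
      rw [hav]
      change F.chartFrame c q (((F.chartFrame c q).symm (chartDeriv c q v)).1, 0) = _
      rw [F.chartFrame_symm_apply hq, F.chartFrame_apply hq, F.symm_apply_of_mem_cu hqΛ hv]
    · obtain ⟨v, hv, hbv⟩ := hmem' b
      have h3 := fst_eq_zero_of_mem (F.isCompl q hqΛ).disjoint (F.W q) (F.mem_cu q hqΛ)
        (F.mem_cs q hqΛ) hv
      rw [hbv]
      change F.chartFrame c q (((F.chartFrame c q).symm (chartDeriv c q v)).1, 0) = _
      rw [F.chartFrame_symm_apply hq, h3]
      exact map_zero _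

/-- The frames read in a chart are uniformly bounded near the centre of the chart: the frames are
isometric on each summand, and the angle between the summands is controlled by the norm of the
projection. -/
theorem exists_norm_chartFrame_le [IsManifold 𝓘(ℝ, E) 1 M]
    [IsContinuousRiemannianBundle E (fun x : M => TangentSpace 𝓘(ℝ, E) x)]
    (hcs : IsContinuousSubbundleOn Ecs Λ) (hcu : IsContinuousSubbundleOn Ecu Λ) {c : M}
    (hc : c ∈ Λ) : ∃ C, ∀ᶠ q in 𝓝[Λ] c, (∀ w, ‖F.chartFrame c q w‖ ≤ C * ‖w‖) ∧
      ∀ ξ, ‖(F.chartFrame c q).symm ξ‖ ≤ C * ‖ξ‖ := by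
  obtain ⟨C, hC, hCq⟩ := exists_norm_chartDeriv_le (E := E) c
  have hP := F.continuousWithinAt_proj hcs hcu hc (mem_chart_source E c)
  set P : M → E →L[ℝ] E := fun q => ((F.chartFrame c q :
      EuclideanSpace ℝ (Fin d) × EuclideanSpace ℝ (Fin m) →L[ℝ] E) ∘L
      ((ContinuousLinearMap.inl ℝ (EuclideanSpace ℝ (Fin d)) (EuclideanSpace ℝ (Fin m))) ∘L
      (ContinuousLinearMap.fst ℝ _ _))) ∘L ((F.chartFrame c q).symm :
      E →L[ℝ] EuclideanSpace ℝ (Fin d) × EuclideanSpace ℝ (Fin m)) with hPdef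
  set K := ‖P c‖ + 1
  have hK : ∀ᶠ q in 𝓝[Λ] c, ‖P q‖ < K := hP.norm.eventually_lt_const (lt_add_one _)
  have hK0 : 0 < K := by positivity
  refine ⟨max (2 * C) (C * (1 + K)), ?_⟩
  filter_upwards [hK, mem_nhdsWithin_of_mem_nhds hCq, self_mem_nhdsWithin,
    mem_nhdsWithin_of_mem_nhds ((chartAt E c).open_source.mem_nhds (mem_chart_source E c))]
    with q hqK hqC hqΛ hq
  have hfst : ∀ u, ‖F.chartFrame c q (u, 0)‖ ≤ C * ‖u‖ ∧ ‖u‖ ≤ C * ‖F.chartFrame c q (u, 0)‖ :=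
    fun u => by
      rw [F.chartFrame_apply hq, ← F.norm_cu q hqΛ]
      exact hqC _
  have hsnd : ∀ z, ‖F.chartFrame c q (0, z)‖ ≤ C * ‖z‖ ∧ ‖z‖ ≤ C * ‖F.chartFrame c q (0, z)‖ :=
    fun u => by
      rw [F.chartFrame_apply hq, ← F.norm_cs q hqΛ]
      exact hqC _
  have hsplit : ∀ w, F.chartFrame c q w = F.chartFrame c q (w.1, 0) + F.chartFrame c q (0, w.2) :=
    fun w => by rw [← map_add]; simp
  refine ⟨fun w => ?_, fun ξ => ?_⟩
  · calc ‖F.chartFrame c q w‖ ≤ C * ‖w.1‖ + C * ‖w.2‖ := by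
          rw [hsplit]
          exact (norm_add_le _ _).trans (add_le_add (hfst _).1 (hsnd _).1)
      _ ≤ C * ‖w‖ + C * ‖w‖ := by gcongr; exacts [norm_fst_le w, norm_snd_le w]
      _ = 2 * C * ‖w‖ := by ring
      _ ≤ _ := by gcongr; exact le_max_left _ _
  · set w := (F.chartFrame c q).symm ξ with hw
    have hPξ : F.chartFrame c q (w.1, 0) = P q ξ := rfl
    have h1 : ‖F.chartFrame c q (w.1, 0)‖ ≤ K * ‖ξ‖ := by
      rw [hPξ]; exact ContinuousLinearMap.le_of_opNorm_le _ hqK.le _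
    have h2 : ‖F.chartFrame c q (0, w.2)‖ ≤ (1 + K) * ‖ξ‖ := by
      have h3 : F.chartFrame c q (0, w.2) = ξ - F.chartFrame c q (w.1, 0) := by
        rw [eq_sub_iff_add_eq, add_comm, ← hsplit, hw, ContinuousLinearEquiv.apply_symm_apply]
      rw [h3]
      exact (norm_sub_le _ _).trans (by linarith)
    have h3 : ‖w‖ ≤ C * ((1 + K) * ‖ξ‖) := by
      rw [Prod.norm_def]
      refine max_le ?_ ?_
      · refine (hfst _).2.trans ?_
        gcongr
        exact h1.trans (by gcongr; linarith)
      · refine (hsnd _).2.trans ?_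
        gcongr
    calc ‖w‖ ≤ C * (1 + K) * ‖ξ‖ := by rw [mul_assoc]; exact h3
      _ ≤ _ := by gcongr; exact le_max_right _ _

/-- In charts and frames, `f` is its derivative `A × D` up to an error of order `1 + α`. -/
theorem exists_approx [IsManifold 𝓘(ℝ, E) ∞ M] {α : ℝ≥0} (hα : 0 < α)
    (hα1 : α ≤ 1) (hf : IsC1Holder α f) {c c' q₀ : M}
    (hc : q₀ ∈ (chartAt E c).source) (hc' : f q₀ ∈ (chartAt E c').source) :
    ∃ C, ∃ r > 0, ∀ᶠ q in 𝓝[Λ] q₀, ∀ ρ ≤ r, ∀ ξ ξ',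
      ‖ξ - chartAt E c q‖ ≤ ρ → ‖ξ' - chartAt E c q‖ ≤ ρ →
      ‖chartAt E c' (f ((chartAt E c).symm ξ)) - chartAt E c' (f ((chartAt E c).symm ξ')) -
        F.chartFrame c' (f q) ((F.A q : EuclideanSpace ℝ (Fin d) →L[ℝ] _).prodMap (F.D q)
          ((F.chartFrame c q).symm (ξ - ξ')))‖ ≤ C * ρ ^ (α : ℝ) * ‖ξ - ξ'‖ := by
  obtain ⟨C, r, hr, h⟩ := hf.holderStrictAt hα hα1 hc hc'
  refine ⟨C, r, hr, ?_⟩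
  have h1 : ∀ᶠ q in 𝓝[Λ] q₀, q ∈ (chartAt E c).source :=
    mem_nhdsWithin_of_mem_nhds ((chartAt E c).open_source.mem_nhds hc)
  have h2 : ∀ᶠ q in 𝓝[Λ] q₀, f q ∈ (chartAt E c').source :=
    mem_nhdsWithin_of_mem_nhds
      (f.continuous.continuousAt.preimage_mem_nhds ((chartAt E c').open_source.mem_nhds hc'))
  filter_upwards [mem_nhdsWithin_of_mem_nhds (((chartAt E c).continuousAt hc).eventually h), h1, h2,
    self_mem_nhdsWithin] with q hq hqc hqc' hqΛ ρ hρ ξ ξ' hξ hξ'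
  refine le_trans (le_of_eq ?_) (hq.2.2 ρ hρ ξ ξ' hξ hξ')
  congr 2
  set w := (F.chartFrame c q).symm (ξ - ξ') with hw
  have h3 : ξ - ξ' = chartDeriv c q (F.W q w) := by
    rw [← F.chartFrame_apply hqc, hw, ContinuousLinearEquiv.apply_symm_apply]
  rw [h3, fderiv_chart_chartDeriv hqc hqc' (f.contMDiff.mdifferentiable (by simp) q),
    F.mfderiv_apply q hqΛ, F.chartFrame_apply hqc']
  rfl

end Charts

section Riemannian

variable {E : Type*} [NormedAddCommGroup E] [NormedSpace ℝ E] [FiniteDimensional ℝ E] {M : Type*}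
    [EMetricSpace M] [ChartedSpace E M] [IsManifold 𝓘(ℝ, E) ∞ M]
    [RiemannianBundle (fun x : M => TangentSpace 𝓘(ℝ, E) x)]
    [IsContinuousRiemannianBundle E (fun x : M => TangentSpace 𝓘(ℝ, E) x)]
    [IsRiemannianManifold 𝓘(ℝ, E) M]
    {f : M ≃ₘ^1⟮𝓘(ℝ, E), 𝓘(ℝ, E)⟯ M} {Λ : Set M}
    {Ecs Ecu : ∀ x : M, Submodule ℝ (TangentSpace 𝓘(ℝ, E) x)} {d m : ℕ}

/-- The charts of the manifold and frames adapted to the dominated splitting provide the local data. -/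
theorem exists_localCuData (F : SplittingFrame f Λ Ecs Ecu d m) {α : ℝ≥0} (hα : 0 < α)
    (hα1 : α ≤ 1) (hf : IsC1Holder α f) (hΛ : IsCompact Λ) (hinv : MapsTo f Λ Λ)
    (hcs : IsContinuousSubbundleOn Ecs Λ) (hcu : IsContinuousSubbundleOn Ecu Λ)
    (g : ContMDiffRiemannianMetric 𝓘(ℝ, E) ∞ E (fun x : M => TangentSpace 𝓘(ℝ, E) x)) {lam : ℝ}
    (hlam : 0 ≤ lam) (hlam1 : lam < 1) (hdom : ∀ x ∈ Λ, ∀ u ∈ Ecs x, ∀ w ∈ Ecu (f x),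
      metricNorm g (mfderiv 𝓘(ℝ, E) 𝓘(ℝ, E) f x u) *
        metricNorm g (mfderiv 𝓘(ℝ, E) 𝓘(ℝ, E) f.symm (f x) w) ≤
      lam * (metricNorm g u * metricNorm g w)) :
    ∃ L : LocalCuData (EuclideanSpace ℝ (Fin d)) (EuclideanSpace ℝ (Fin m)) E f Λ,
      L.e = chartAt E ∧ L.frame = F.chartFrame ∧ L.A = F.A := by
  obtain ⟨nX, nY, C, hstep⟩ := F.exists_dominatedStep hΛ hinv g hlam hlam1.le hdom
  exact ⟨{
    e := chartAt E
    frame := F.chartFrame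
    A := F.A
    D := F.D
    nX := nX
    nY := nY
    α := α
    lam := lam
    α_pos := hα
    α_le := hα1
    lam_nonneg := hlam
    lam_lt := hlam1
    mem_source := mem_chart_source E
    edist_le := fun c _ => exists_edist_chart_symm_le c
    approx := fun c c' q₀ _ hc hc' => F.exists_approx hα hα1 hf hc hc'
    frame_le := fun c hc => F.exists_norm_chartFrame_le hcs hcu hc
    step := ⟨C, hstep⟩
    continuousAt_proj := fun c hc => by
      filter_upwards [self_mem_nhdsWithin, mem_nhdsWithin_of_mem_nhds
        ((chartAt E c).open_source.mem_nhds (mem_chart_source E c))] with q₀ hq₀ hq₀c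
      exact F.continuousWithinAt_proj hcs hcu hq₀ hq₀c }, rfl, rfl, rfl⟩

end Riemannian

end SplittingFrame

end

/-! ### Disks tangent to the centre-unstable cone field -/

section

attribute [local instance 2000] chartedSpaceSelf

section Expansion

variable {E : Type*} [NormedAddCommGroup E] [NormedSpace ℝ E] {M : Type*}
    [TopologicalSpace M] [ChartedSpace E M]
    [RiemannianBundle (fun x : M => TangentSpace 𝓘(ℝ, E) x)]
    {f : M ≃ₘ^1⟮𝓘(ℝ, E), 𝓘(ℝ, E)⟯ M}
    {Ecs Ecu : ∀ x : M, Submodule ℝ (TangentSpace 𝓘(ℝ, E) x)}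

/-- Non-uniform expansion at `x` as a lower bound for the expansion along infinitely many initial
segments of the orbit. The term `j = i + 1` of the sum is the expansion of the step from `f^i x`. -/
theorem NUE.exists_frequently {x : M} (h : NUE f Ecu x) : ∃ c > 0, ∃ᶠ n : ℕ in atTop, 1 ≤ n ∧
    ∑ i ∈ Finset.range n, Real.log (normInvCu f Ecu (f (f^[i] x))) ≤ -c * n := by
  rw [NUE] at h
  obtain ⟨b, hb, hb0⟩ := EReal.lt_iff_exists_real_btwn.1 h
  have hb0' : b < 0 := by exact_mod_cast hb0
  refine ⟨-b, by linarith, ?_⟩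
  refine ((frequently_lt_of_liminf_lt (by isBoundedDefault) hb).and_eventually
    (eventually_ge_atTop 1)).mono fun n ⟨h1, hn⟩ => ⟨hn, ?_⟩
  have h2 : 1 / (n : ℝ) * ∑ j ∈ Finset.Icc 1 n, Real.log (normInvCu f Ecu (f^[j] x)) < b := by
    exact_mod_cast h1
  have hn0 : (0 : ℝ) < n := by exact_mod_cast hn
  rw [one_div, inv_mul_lt_iff₀ hn0] at h2
  have h3 : ∑ i ∈ Finset.range n, Real.log (normInvCu f Ecu (f (f^[i] x))) =
      ∑ j ∈ Finset.Icc 1 n, Real.log (normInvCu f Ecu (f^[j] x)) := by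
    rw [← Finset.Ico_add_one_right_eq_Icc, Finset.sum_Ico_eq_sum_range]
    refine Finset.sum_congr (by simp) fun i _ => ?_
    rw [add_comm 1 i, Function.iterate_succ_apply']
  rw [h3]
  nlinarith

/-- The bundle `E^cu` is not trivial at a point where it is expanded: the logarithm of the norm of
a zero map is zero. -/
theorem NUE.finrank_ne_zero [FiniteDimensional ℝ E] {x : M} (h : NUE f Ecu x) :
    ∃ n, Module.finrank ℝ (Ecu (f^[n] x)) ≠ 0 := by
  by_contra! h0
  obtain ⟨c, hc, hfr⟩ := h.exists_frequently
  obtain ⟨n, hn, h1⟩ := hfr.exists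
  have h2 : ∀ i, normInvCu f Ecu (f (f^[i] x)) = 0 := fun i => by
    have h3 := h0 (i + 1)
    rw [Function.iterate_succ_apply'] at h3
    have hfin : FiniteDimensional ℝ (TangentSpace 𝓘(ℝ, E) (f (f^[i] x))) :=
      inferInstanceAs (FiniteDimensional ℝ E)
    have h4 : Ecu (f (f^[i] x)) = ⊥ := Submodule.finrank_eq_zero.1 h3
    refine le_antisymm (ContinuousLinearMap.opNorm_le_bound _ le_rfl fun v => ?_)
      (ContinuousLinearMap.opNorm_nonneg _)
    have h5 : v = 0 := Subtype.ext ((Submodule.mem_bot ℝ).1 (h4 ▸ v.2))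
    rw [h5, map_zero, norm_zero, zero_mul]
  simp only [h2, Real.log_zero, Finset.sum_const_zero] at h1
  have hn0 : (0 : ℝ) < n := by exact_mod_cast hn
  nlinarith

end Expansion

theorem IsContinuousSubbundleOn.mono {E : Type*} [NormedAddCommGroup E] [NormedSpace ℝ E]
    {M : Type*} [TopologicalSpace M] [ChartedSpace E M] [IsManifold 𝓘(ℝ, E) 1 M]
    {F : ∀ x : M, Submodule ℝ (TangentSpace 𝓘(ℝ, E) x)} {S S' : Set M}
    (hF : IsContinuousSubbundleOn F S) (h : S' ⊆ S) : IsContinuousSubbundleOn F S' :=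
  fun x hx => by
    obtain ⟨V, hV, k, s, hs⟩ := hF x (h hx)
    exact ⟨V, nhdsWithin_mono x h hV, k, s, hs⟩

/-- The points where a continuous subbundle has a given rank form a closed set. -/
theorem IsContinuousSubbundleOn.isClosed_finrank_eq {E : Type*} [NormedAddCommGroup E]
    [NormedSpace ℝ E] {M : Type*} [TopologicalSpace M] [ChartedSpace E M] [IsManifold 𝓘(ℝ, E) 1 M]
    {F : ∀ x : M, Submodule ℝ (TangentSpace 𝓘(ℝ, E) x)} {S : Set M}
    (hF : IsContinuousSubbundleOn F S) (hS : IsClosed S) (d : ℕ) :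
    IsClosed {q ∈ S | Module.finrank ℝ (F q) = d} := by
  refine isClosed_of_closure_subset fun q hq => ?_
  have hqS : q ∈ S := hS.closure_subset_iff.2 (sep_subset _ _) hq
  obtain ⟨k, s, -, hk⟩ := hF.exists_frame hqS (mem_chart_source E q)
  have hne : (𝓝[{q ∈ S | Module.finrank ℝ (F q) = d}] q).NeBot := mem_closure_iff_nhdsWithin_neBot.1 hq
  have hk' := hk.filter_mono (nhdsWithin_mono q
    (sep_subset S fun q => Module.finrank ℝ (F q) = d))
  obtain ⟨q', h1, h2⟩ := (hk'.and self_mem_nhdsWithin).exists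
  exact ⟨hqS, (hk.self_of_nhdsWithin hqS).1.trans (h1.1.symm.trans h2.2)⟩

/-- A disk tangent to the centre-unstable cone field is transverse to `E^cs`, and its tangent spaces
are graphs over `E^cu`. -/
theorem SplittingFrame.transverseDisk {E : Type*} [NormedAddCommGroup E] [NormedSpace ℝ E]
    [FiniteDimensional ℝ E] {M : Type*} [EMetricSpace M] [ChartedSpace E M] [IsManifold 𝓘(ℝ, E) 1 M]
    [RiemannianBundle (fun x : M => TangentSpace 𝓘(ℝ, E) x)]
    {f : M ≃ₘ^1⟮𝓘(ℝ, E), 𝓘(ℝ, E)⟯ M} {Λ : Set M}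
    {Ecs Ecu : ∀ x : M, Submodule ℝ (TangentSpace 𝓘(ℝ, E) x)} {d m : ℕ}
    [Nontrivial (EuclideanSpace ℝ (Fin d))] (hinv : MapsTo f Λ Λ)
    (F : SplittingFrame f Λ Ecs Ecu d m) {t : Finset M}
    {T : CuAtlas (EuclideanSpace ℝ (Fin d)) (EuclideanSpace ℝ (Fin m)) E t f Λ}
    (hchart : ∀ c : t, T.chart c = chartAt E (c : M))
    (hsource : ∀ c : t, T.source c = (chartAt E (c : M)).source)
    (hframe : ∀ c : t, T.frame c = F.chartFrame (c : M)) (hA : T.A = F.A)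
    {φ : EuclideanSpace ℝ (Fin d) → M} {S : Set (EuclideanSpace ℝ (Fin d))}
    (hφ : ∀ p ∈ S, ContMDiffAt 𝓘(ℝ, EuclideanSpace ℝ (Fin d)) 𝓘(ℝ, E) 1 φ p)
    (himm : ∀ p ∈ S,
      Function.Injective (mfderiv 𝓘(ℝ, EuclideanSpace ℝ (Fin d)) 𝓘(ℝ, E) φ p)) {a : ℝ}
    (hcone : ∀ p ∈ S,
      range (mfderiv 𝓘(ℝ, EuclideanSpace ℝ (Fin d)) 𝓘(ℝ, E) φ p) ⊆ cuCone Ecs Ecu a (φ p))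
    (hmem : ∀ p ∈ S, φ p ∈ Λ) (hNUE : ∀ p ∈ S, NUE f Ecu (φ p)) : TransverseDisk T φ S := by
  refine ⟨hmem, fun p hp => ?_, fun p hp => ?_, fun p hp => ?_⟩
  · filter_upwards [(contMDiffAt_iff_contMDiffAt_nhds (by simp)).1 (hφ p hp)] with p' hp'
    exact hp'.continuousAt
  · set q := φ p with hq
    have hqΛ : q ∈ Λ := hmem p hp
    set c : M := (T.idx q : M) with hc
    have hqc : q ∈ (chartAt E c).source := by
      rw [← hsource]; exact T.dom_subset_source _ (T.mem_dom_idx q hqΛ)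
    set φ' : EuclideanSpace ℝ (Fin d) →L[ℝ] TangentSpace 𝓘(ℝ, E) q :=
      mfderiv 𝓘(ℝ, EuclideanSpace ℝ (Fin d)) 𝓘(ℝ, E) φ p with hφ'
    set B : EuclideanSpace ℝ (Fin d) →L[ℝ] EuclideanSpace ℝ (Fin d) × EuclideanSpace ℝ (Fin m) :=
      ((F.W q).symm : TangentSpace 𝓘(ℝ, E) q →L[ℝ] _) ∘L φ' with hB
    set G₀ : EuclideanSpace ℝ (Fin d) →ₗ[ℝ] EuclideanSpace ℝ (Fin d) :=
      ((ContinuousLinearMap.fst ℝ _ _) ∘L B).toLinearMap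
    have hG₀ : Function.Injective G₀ := by
      rw [injective_iff_map_eq_zero]
      intro x hx
      have hx1 : (B x).1 = 0 := hx
      obtain ⟨v₁, hv₁, v₂, hv₂, hv, hle⟩ := hcone p hp ⟨x, rfl⟩
      have hv' : φ' x = v₁ + v₂ := hv
      have h1 : φ' x ∈ Ecs q := by
        have h2 : φ' x = F.W q (0, (B x).2) := by
          rw [← hx1, Prod.mk.eta]; simp [hB]
        rw [h2]
        exact F.mem_cs q hqΛ _
      have h2 : v₂ = 0 := Submodule.disjoint_def.1 (F.isCompl q hqΛ).disjoint v₂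
        (by rw [eq_sub_of_add_eq' hv'.symm]; exact (Ecs q).sub_mem h1 hv₁) hv₂
      rw [h2, norm_zero, mul_zero] at hle
      have h3 : v₁ = 0 := norm_le_zero_iff.1 hle
      rw [h2, h3, add_zero] at hv'
      exact himm p hp (hv'.trans (map_zero φ').symm)
    refine ⟨(LinearEquiv.ofInjectiveEndo G₀ hG₀).toContinuousLinearEquiv,
      (ContinuousLinearMap.snd ℝ _ _) ∘L B, ?_⟩
    have h1 : ContDiffAt ℝ 1 (fun p' => chartAt E c (φ p')) p := by
      have h2 : ContMDiffAt 𝓘(ℝ, E) 𝓘(ℝ, E) 1 (chartAt E c) (φ p) :=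
        (contMDiffOn_chart (I := 𝓘(ℝ, E)) (n := 1) (x := c)).contMDiffAt
          ((chartAt E c).open_source.mem_nhds hqc)
      exact contMDiffAt_iff_contDiffAt.1 (h2.comp p (hφ p hp))
    have h2 : HasFDerivAt (fun p' => chartAt E c (φ p')) ((chartDeriv c q) ∘L φ') p :=
      hasFDerivAt_chartAt_comp ((hφ p hp).mdifferentiableAt (by simp)).hasMFDerivAt hqc
    have h3 := h1.hasStrictFDerivAt' h2 (by simp)
    have h4 := (((T.frame (T.idx q) q).symm :
      E →L[ℝ] EuclideanSpace ℝ (Fin d) × EuclideanSpace ℝ (Fin m)).hasStrictFDerivAt).comp p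
      (h3.sub_const (chartAt E c q))
    have h5 : ((T.frame (T.idx q) q).symm :
      E →L[ℝ] EuclideanSpace ℝ (Fin d) × EuclideanSpace ℝ (Fin m)) ∘L ((chartDeriv c q) ∘L φ') =
        ((LinearEquiv.ofInjectiveEndo G₀ hG₀).toContinuousLinearEquiv :
          EuclideanSpace ℝ (Fin d) →L[ℝ] _).prod ((ContinuousLinearMap.snd ℝ _ _) ∘L B) := by
      refine ContinuousLinearMap.ext fun x => ?_
      rw [hframe]
      exact F.chartFrame_symm_apply hqc (φ' x)
    rw [h5] at h4
    have h6 : ∀ p', T.loc q (φ p') =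
        (T.frame (T.idx q) q).symm (chartAt E c (φ p') - chartAt E c q) := fun p' => by
      rw [hc, ← hchart]; rfl
    simp only [h6]
    exact h4
  · obtain ⟨c, hc, hfr⟩ := (hNUE p hp).exists_frequently
    refine ⟨c, hc, hfr.mono fun n hn => le_trans (Finset.sum_le_sum fun i _ => ?_) hn.2⟩
    rw [hA]
    refine Real.log_le_log ?_ (F.norm_A_symm_le hinv (hinv.iterate i (hmem p hp)))
    exact (F.A (f^[i] (φ p))).norm_symm_pos

/-- The part of a `C^1` graph in a chart over a ball of radius `ρ < δ` is an embedded disk. -/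
theorem isEmbeddedDisk_graph {E : Type*} [NormedAddCommGroup E] [NormedSpace ℝ E]
    {M : Type*} [TopologicalSpace M] [ChartedSpace E M] [IsManifold 𝓘(ℝ, E) 1 M] {d : ℕ} {Y : Type*}
    [NormedAddCommGroup Y] [NormedSpace ℝ Y] (c : M) (ξ₀ : E)
    (Θ : (EuclideanSpace ℝ (Fin d) × Y) ≃L[ℝ] E) {H : EuclideanSpace ℝ (Fin d) → Y} {δ ρ : ℝ}
    (hρ : 0 < ρ) (hρδ : ρ < δ) (hH : ContDiffOn ℝ 1 H (Metric.ball 0 δ))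
    (htgt : ∀ v, ‖v‖ < δ → ξ₀ + Θ (v, H v) ∈ (chartAt E c).target) :
    IsEmbeddedDisk (E := E) d
      (fun p => (chartAt E c).symm (ξ₀ + Θ (ρ • p, H (ρ • p)))) := by
  set h : EuclideanSpace ℝ (Fin d) → E := fun p => ξ₀ + Θ (ρ • p, H (ρ • p)) with hh
  set L : E →L[ℝ] EuclideanSpace ℝ (Fin d) :=
    (ContinuousLinearMap.fst ℝ (EuclideanSpace ℝ (Fin d)) Y) ∘L
      (Θ.symm : E →L[ℝ] EuclideanSpace ℝ (Fin d) × Y) with hL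
  have hLh : ∀ p, L (h p) = L ξ₀ + ρ • p := fun p => by simp [hL, hh]
  have hnorm : ∀ p ∈ unitBall d, ‖ρ • p‖ < δ := fun p hp => by
    rw [norm_smul, Real.norm_of_nonneg hρ.le]
    rw [mem_closedBall_zero_iff] at hp
    nlinarith [norm_nonneg p]
  have hψ : ∀ p ∈ unitBall d, ContMDiffAt 𝓘(ℝ, EuclideanSpace ℝ (Fin d)) 𝓘(ℝ, E) 1
      (fun p => (chartAt E c).symm (h p)) p := by
    intro p hp
    have h1 : ContDiffAt ℝ 1 H (ρ • p) :=
      hH.contDiffAt (Metric.isOpen_ball.mem_nhds (by simpa using hnorm p hp))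
    have h2 : ContDiffAt ℝ 1 (fun p : EuclideanSpace ℝ (Fin d) => ρ • p) p := by fun_prop
    have h3 : ContDiffAt ℝ 1 h p :=
      contDiffAt_const.add (Θ.contDiff.contDiffAt.comp p (h2.prodMk (h1.comp p h2)))
    have h4 : ContMDiffAt 𝓘(ℝ, E) 𝓘(ℝ, E) 1 (chartAt E c).symm (h p) :=
      (contMDiffOn_chart_symm (I := 𝓘(ℝ, E)) (n := 1) (x := c)).contMDiffAt
        ((chartAt E c).open_target.mem_nhds (htgt _ (hnorm p hp)))
    exact h4.comp p (contMDiffAt_iff_contDiffAt.2 h3)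
  have hchart : ∀ p, ‖ρ • p‖ < δ → chartAt E c ((chartAt E c).symm (h p)) = h p := fun p hp =>
    (chartAt E c).right_inv (htgt _ hp)
  refine ⟨hψ, fun p hp p' hp' hpp' => ?_, fun p hp => ?_⟩
  · have h1 : h p = h p' := by
      rw [← hchart p (hnorm p hp), ← hchart p' (hnorm p' hp')]
      exact congrArg (chartAt E c) hpp'
    have h2 := congrArg L h1
    rw [hLh, hLh] at h2
    exact smul_right_injective _ hρ.ne' (add_left_cancel h2)
  · set ψ' : EuclideanSpace ℝ (Fin d) →L[ℝ] TangentSpace 𝓘(ℝ, E) ((chartAt E c).symm (h p)) :=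
      mfderiv 𝓘(ℝ, EuclideanSpace ℝ (Fin d)) 𝓘(ℝ, E) (fun p => (chartAt E c).symm (h p)) p
    have h1 := hasFDerivAt_chartAt_comp ((hψ p hp).mdifferentiableAt (by simp)).hasMFDerivAt
      (c := c) ((chartAt E c).map_target (htgt _ (hnorm p hp)))
    have h2 : HasFDerivAt (fun p' => L (chartAt E c ((chartAt E c).symm (h p'))))
        (L ∘L (((chartDeriv c _).comp ψ' : EuclideanSpace ℝ (Fin d) →L[ℝ] E))) p :=
      L.hasFDerivAt.comp p h1
    have h3 : HasFDerivAt (fun p' => L (chartAt E c ((chartAt E c).symm (h p'))))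
        (ρ • ContinuousLinearMap.id ℝ (EuclideanSpace ℝ (Fin d))) p := by
      refine (((hasFDerivAt_id p).const_smul ρ).const_add (L ξ₀)).congr_of_eventuallyEq ?_
      have h4 : ContinuousAt (fun p' : EuclideanSpace ℝ (Fin d) => ‖ρ • p'‖) p := by fun_prop
      filter_upwards [h4.eventually_lt_const (hnorm p hp)] with p' hp'
      rw [hchart p' hp', hLh]
      rfl
    have h4 := h2.unique h3
    have h5 : ∀ x, L (chartDeriv c _ (ψ' x)) = ρ • x := fun x => by
      have := congrArg (fun K : EuclideanSpace ℝ (Fin d) →L[ℝ] EuclideanSpace ℝ (Fin d) => K x) h4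
      exact this
    intro x y hxy
    have h6 : ψ' x = ψ' y := hxy
    exact smul_right_injective _ hρ.ne'
      ((h5 x).symm.trans ((congrArg (fun v => L (chartDeriv c _ v)) h6).trans (h5 y)))

end

end DominatedSplitting

open DominatedSplitting in
theorem theorem4p1
    {E : Type*} [NormedAddCommGroup E] [NormedSpace ℝ E] [FiniteDimensional ℝ E]
    {M : Type*} [EMetricSpace M] [ChartedSpace E M] [IsManifold 𝓘(ℝ, E) ∞ M]
    [RiemannianBundle (fun x : M => TangentSpace 𝓘(ℝ, E) x)]
    [IsContMDiffRiemannianBundle 𝓘(ℝ, E) ∞ E (fun x : M => TangentSpace 𝓘(ℝ, E) x)]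
    [IsRiemannianManifold 𝓘(ℝ, E) M]
    -- a `C^{1+α}` diffeomorphism
    (f : M ≃ₘ^1⟮𝓘(ℝ, E), 𝓘(ℝ, E)⟯ M) (α : ℝ≥0) (hα : 0 < α) (hα' : α ≤ 1)
    (hf : DominatedSplitting.IsC1Holder α f)
    -- a compact invariant set with a dominated splitting
    (Λ : Set M) (hΛ : IsCompact Λ) (hinv : MapsTo f Λ Λ)
    (Ecs Ecu : ∀ x : M, Submodule ℝ (TangentSpace 𝓘(ℝ, E) x))
    (hdom : DominatedSplitting.IsDominatedSplitting f Λ Ecs Ecu)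
    -- a continuous extension of the splitting to a neighbourhood, and a cone width
    (U : Set M) (hU : IsOpen U) (hΛU : Λ ⊆ U)
    (Fcs Fcu : ∀ x : M, Submodule ℝ (TangentSpace 𝓘(ℝ, E) x))
    (hF : DominatedSplitting.IsContinuousSplittingOn Fcs Fcu U)
    (hFcs : ∀ x ∈ Λ, Fcs x = Ecs x) (hFcu : ∀ x ∈ Λ, Fcu x = Ecu x)
    (a : ℝ) (ha : 0 < a) (ha' : a < 1)
    -- a disk in `U` tangent to the centre-unstable cone field
    (d : ℕ) (φ : EuclideanSpace ℝ (Fin d) → M)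
    (hφ : DominatedSplitting.IsEmbeddedDisk (E := E) d φ)
    (hφU : φ '' DominatedSplitting.unitBall d ⊆ U)
    (hcone : DominatedSplitting.IsTangentToCuCone Fcs Fcu a d φ)
    (hpos : 0 < DominatedSplitting.lebDisk (E := E) d φ Λ)
    (hNUE : ∀ x ∈ φ '' DominatedSplitting.unitBall d ∩ Λ, DominatedSplitting.NUE f Ecu x) :
    ∃ ψ : EuclideanSpace ℝ (Fin d) → M,
      DominatedSplitting.IsUnstableDisk f d ψ ∧
        ψ '' DominatedSplitting.unitBall d ⊆ Λ := by
  set S : Set (EuclideanSpace ℝ (Fin d)) := unitBall d ∩ φ ⁻¹' Λ with hSdef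
  have hφc : ContinuousOn φ (unitBall d) := fun p hp =>
    (hφ.contMDiffAt p hp).continuousAt.continuousWithinAt
  have hSclosed : IsClosed S := hφc.preimage_isClosed_of_isClosed Metric.isClosed_closedBall
    hΛ.isClosed
  have hSfin : volume S ≠ ⊤ :=
    ((measure_mono inter_subset_left).trans_lt measure_closedBall_lt_top).ne
  have hS0 : volume S ≠ 0 := fun h => hpos.ne' (setLIntegral_measure_zero S _ h)
  obtain ⟨p₀, hp₀⟩ : S.Nonempty := nonempty_of_measure_ne_zero hS0
  -- The part of `Λ` where `E^cu` has the dimension of the disk.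
  set Λ' : Set M := {q ∈ Λ | Module.finrank ℝ (Ecu q) = d} with hΛ'
  have hsub : Λ' ⊆ Λ := sep_subset _ _
  have hcomp : IsCompact Λ' := hΛ.of_isClosed_subset
    (hdom.splitting.right.isClosed_finrank_eq hΛ.isClosed d) hsub
  have hinv' : MapsTo f Λ' Λ' := fun q hq => ⟨hinv hq.1, by
    have hfin : FiniteDimensional ℝ (TangentSpace 𝓘(ℝ, E) q) :=
      inferInstanceAs (FiniteDimensional ℝ E)
    rw [← hdom.map_cu q hq.1, ← hq.2]
    exact (Submodule.equivMapOfInjective _ (mfderiv_injective f q) (Ecu q)).finrank_eq.symm⟩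
  have hmem : ∀ p ∈ S, φ p ∈ Λ' := fun p hp => ⟨hp.2, by
    rw [← hFcu _ hp.2]; exact (hcone p hp.1).1⟩
  have hNUE' : ∀ p ∈ S, NUE f Ecu (φ p) := fun p hp => hNUE _ ⟨mem_image_of_mem φ hp.1, hp.2⟩
  -- The iterates stay in `Λ'`, so `d = 0` would contradict the expansion.
  have hd : d ≠ 0 := by
    obtain ⟨n, hn⟩ := (hNUE' p₀ hp₀).finrank_ne_zero
    rwa [(hinv'.iterate n (hmem p₀ hp₀)).2] at hn
  have hfind : NeZero d := ⟨hd⟩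
  have hdE : d ≤ Module.finrank ℝ E := by
    have hfin : FiniteDimensional ℝ (TangentSpace 𝓘(ℝ, E) (φ p₀)) :=
      inferInstanceAs (FiniteDimensional ℝ E)
    rw [← (hmem p₀ hp₀).2]
    exact Submodule.finrank_le (Ecu (φ p₀))
  have hne : Λ'.Nonempty := ⟨_, hmem p₀ hp₀⟩
  have hcont : IsContinuousRiemannianBundle E (fun x : M => TangentSpace 𝓘(ℝ, E) x) := by
    obtain ⟨b, hb, hb'⟩ := IsContMDiffRiemannianBundle.exists_contMDiff (IB := 𝓘(ℝ, E)) (n := ∞)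
      (F := E) (E := fun x : M => TangentSpace 𝓘(ℝ, E) x)
    exact ⟨b, hb.continuous, hb'⟩
  obtain ⟨g, lam, hlam0, hlam1, hg⟩ := hdom.dominated
  obtain ⟨F⟩ := exists_splittingFrame (m := Module.finrank ℝ E - d) hinv' hne
    (fun x hx => hdom.splitting.isCompl x hx.1) (fun x hx => hdom.map_cs x hx.1)
    (fun x hx => hdom.map_cu x hx.1) (fun x hx => hx.2) (by omega)
  obtain ⟨L, hLe, hLframe, hLA⟩ := F.exists_localCuData hα hα' hf hcomp hinv'
    (hdom.splitting.left.mono hsub) (hdom.splitting.right.mono hsub) g hlam0.le hlam1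
    (fun x hx => hg x hx.1)
  obtain ⟨t, T, hchart, hpar, hsource, htarget, hframe, hA⟩ :=
    L.exists_cuAtlas hcomp hne f.continuous
  rw [hLA] at hA
  simp only [hLe] at hchart hpar hsource htarget
  simp only [hLframe] at hframe
  have hT : TransverseDisk T φ S := F.transverseDisk hinv' hchart hsource hframe hA
    (fun p hp => hφ.contMDiffAt p hp.1) (fun p hp => hφ.immersive p hp.1) (a := a)
    (fun p hp => by
      have h1 := (hcone p hp.1).2
      simp only [cuCone] at h1 ⊢
      rwa [hFcs _ hp.2, hFcu _ hp.2] at h1) hmem hNUE'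
  obtain ⟨δ, hδ, τ, hτ0, hτ1, c, z, hz, Θ, H, hH, hΘ, hcontr⟩ :=
    hT.exists_unstable_graph (finv := f.symm) volume hinv' f.continuous f.symm.continuous
      f.symm_apply_apply hSclosed.measurableSet hSfin hS0
  have hρ : ∀ p ∈ unitBall d, ‖(δ / 2) • p‖ ≤ δ / 2 := fun p hp => by
    rw [norm_smul, Real.norm_of_nonneg (half_pos hδ).le]
    exact mul_le_of_le_one_right (half_pos hδ).le (mem_closedBall_zero_iff.1 hp)
  have hρ' : ∀ p ∈ unitBall d, ‖(δ / 2) • p‖ < δ := fun p hp => (hρ p hp).trans_lt (half_lt_self hδ)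
  have hC := T.one_le
  refine ⟨fun p => (chartAt E (c : M)).symm
    (chartAt E (c : M) z + Θ ((δ / 2) • p, H ((δ / 2) • p))), ⟨?_, ?_⟩, ?_⟩
  · refine isEmbeddedDisk_graph _ _ Θ (half_pos hδ) (half_lt_self hδ) hH fun v hv => ?_
    exact htarget c _ z hz (by rw [add_sub_cancel_left]; exact (hΘ v hv).1)
  · refine ⟨T.C ^ 2 * δ, τ, by positivity, hτ0, hτ1, ?_⟩
    rintro _ ⟨p, hp, rfl⟩ _ ⟨p', hp', rfl⟩ n
    have h1 := hcontr _ _ (hρ' p hp) (hρ' p' hp') n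
    rw [hpar, hchart] at h1
    refine h1.trans (ENNReal.ofReal_le_ofReal ?_)
    have h2 : ‖(δ / 2) • p - (δ / 2) • p'‖ ≤ δ :=
      (norm_sub_le _ _).trans (by linarith [hρ p hp, hρ p' hp'])
    calc T.C ^ 2 * (τ ^ n * ‖(δ / 2) • p - (δ / 2) • p'‖) ≤ T.C ^ 2 * (τ ^ n * δ) := by gcongr
      _ = T.C ^ 2 * δ * τ ^ n := by ring
  · rintro _ ⟨p, hp, rfl⟩
    have h1 := (hΘ _ (hρ' p hp)).2
    rw [hpar, hchart] at h1
    exact hsub h1
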